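/- The group $PSL(3,\mathbb C)=SL(3,\mathbb C)/\{\text{cube roots of unity}\}$ acts on $\mathbb P^2_{\mathbb C}$ by projective transformations. For a subgroup $\Gamma\subset PSL(3,\mathbb C)$ and a set $K\subset\mathbb P^2_{\mathbb C}$, a point $q$ is a cluster point of $\Gamma K$ if $\gamma_m(k_m)\to q$ for some sequence $(k_m)$ in $K$ and some sequence $(\gamma_m)$ of pairwise distinct elements of $\Gamma$. Let $L_0(\Gamma)$ be the closure of the set of points with infinite isotropy group, $L_1(\Gamma)$ the closure of the set of cluster points of orbits $\Gamma z$ with $z\notin L_0(\Gamma)$, and $L_2(\Gamma)$ the closure of the set of cluster points of $\Gamma K$, where $K$ runs over the compact subsets of $\mathbb P^2_{\mathbb C}\setminus(L_0(\Gamma)\cup L_1(\Gamma))$. The Kulkarni limit set is $\Lambda(\Gamma)=L_0(\Gamma)\cup L_1(\Gamma)\cup L_2(\Gamma)$, and $\Omega(\Gamma)=\mathbb P^2_{\mathbb C}\setminus\Lambda(\Gamma)$. A set of complex lines in $\mathbb P^2_{\mathbb C}$ is in general position if no three distinct lines of it have a common point; $LiG(\Omega)$ denotes the maximal number of lines in a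 set of complex lines in general position all of which are contained in $\mathbb P^2_{\mathbb C}\setminus\Omega$ (with $LiG(\Omega)=\infty$ if these numbers are unbounded). A matrix $A\in SL(2,\mathbb Z)$ is a hyperbolic toral automorphism if none of its complex eigenvalues lies on the unit circle. For such an $A$ let $$\Gamma_A=\left\{\begin{pmatrix}A^k&b\\0&1\end{pmatrix}: k\in\mathbb Z,\ b\in\mathbb Z^2\right\}\subset PSL(3,\mathbb C).$$ For $B\in SL(2,\mathbb Z)$, $\nu\in\mathbb Q^2$ and $l\in\mathbb Z$ let $\phi(\nu,l)=\sum_{j=0}^{l-1}B^j\nu$ if $l\ge 0$ and $\phi(\nu,l)=-\sum_{j=1}^{|l|}B^{-j}\nu$ if $l<0$. If $A,B\in SL(2,\mathbb Z)$ generate a group isomorphic to $\mathbb Z\times\mathbb Z$ all of whose elements other than the identity are hyperbolic toral automorphisms, and $\nu\in\mathbb Q^2$ satisfies $A\nu-\nu\in\mathbb Z^2$, let $$\Gamma_{A,B,\nu}=\left\{\begin{pmatrix}A^kB^l&b+\phi(\nu,l)\\0&1\end{pmatrix}: k,l\in\mathbb Z,\ b\in\mathbb Z^2\right\}\subset PSL(3,\mathbb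 C).$$ A subgroup of $PSL(3,\mathbb C)$ is a hyperbolic toral group if it is conjugate in $PSL(3,\mathbb C)$ to one of the groups $\Gamma_A$ or $\Gamma_{A,B,\nu}$. **Theorem.** Let $\Gamma$ be a discrete subgroup of $PSL(3,\mathbb C)$. Then $LiG(\Omega(\Gamma))=4$, i.e. the maximal number of complex lines in general position contained in $\Lambda(\Gamma)$ is exactly four, if and only if $\Gamma$ contains a hyperbolic toral subgroup whose index in $\Gamma$ is finite and at most $8$. -/

import Mathlib

open scoped LinearAlgebra.Projectivization MatrixGroups
open Filter Topology Matrix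

noncomputable section

namespace KulkarniLines

/-- The complex projective plane. -/
abbrev P2 : Type := ℙ ℂ (Fin 3 → ℂ)

/-- The quotient topology on the projective plane, induced by the quotient map
from the nonzero vectors of `ℂ³`. -/
instance : TopologicalSpace P2 :=
  TopologicalSpace.coinduced (Projectivization.mk' ℂ : {v : Fin 3 → ℂ // v ≠ 0} → P2) inferInstance

/-! ### Kulkarni limit set

`PSL(3, ℂ)` is the quotient of `SL(3, ℂ)` by its centre, with the quotient topology, acting on the
projective plane by `[[g]] • [w] = [g w]`. -/

/-- `q` is a cluster point of the family `Γ K`: there are points `k m ∈ K` and pairwise distinct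
elements `γ m ∈ Γ` with `γ m • k m → q`. -/
def IsClusterPoint (Γ : Subgroup PSL(3, ℂ)) (K : Set P2) (q : P2) : Prop :=
  ∃ (k : ℕ → P2) (γ : ℕ → PSL(3, ℂ)), (∀ m, k m ∈ K) ∧ (∀ m, γ m ∈ Γ) ∧
    Function.Injective γ ∧ Tendsto (fun m => γ m • k m) atTop (𝓝 q)

/-- Closure of the set of points with infinite isotropy group. -/
def L0 (Γ : Subgroup PSL(3, ℂ)) : Set P2 :=
  closure {x | {γ : PSL(3, ℂ) | γ ∈ Γ ∧ γ • x = x}.Infinite}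

/-- Closure of the set of cluster points of the orbits `Γ z`, `z ∉ L0 Γ`. -/
def L1 (Γ : Subgroup PSL(3, ℂ)) : Set P2 :=
  closure {q | ∃ z ∉ L0 Γ, IsClusterPoint Γ {z} q}

/-- Closure of the set of cluster points of `Γ K`, where `K` runs over the compact subsets of the
complement of `L0 Γ ∪ L1 Γ`. -/
def L2 (Γ : Subgroup PSL(3, ℂ)) : Set P2 :=
  closure {q | ∃ K : Set P2, IsCompact K ∧ K ⊆ (L0 Γ ∪ L1 Γ)ᶜ ∧ IsClusterPoint Γ K q}

/-- The limit set in the sense of Kulkarni. -/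
def limitSet (Γ : Subgroup PSL(3, ℂ)) : Set P2 := L0 Γ ∪ L1 Γ ∪ L2 Γ

/-- The discontinuity region in the sense of Kulkarni. -/
def discontinuityRegion (Γ : Subgroup PSL(3, ℂ)) : Set P2 := (limitSet Γ)ᶜ

/-! ### Counting lines -/

/-- A complex line: the set of points of the plane which, as one-dimensional subspaces of `ℂ³`,
lie in a fixed two-dimensional subspace. -/
def IsComplexLine (l : Set P2) : Prop :=
  ∃ W : Submodule ℂ (Fin 3 → ℂ), Module.finrank ℂ W = 2 ∧ l = {p | p.submodule ≤ W}

/-- Lines are in general position if no three distinct ones are concurrent. -/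
def InGeneralPosition (S : Set (Set P2)) : Prop :=
  ∀ l₁ ∈ S, ∀ l₂ ∈ S, ∀ l₃ ∈ S, l₁ ≠ l₂ → l₂ ≠ l₃ → l₁ ≠ l₃ → l₁ ∩ l₂ ∩ l₃ = ∅

/-- The sets of complex lines in general position that lie outside `Ω`. -/
def LG (Ω : Set P2) : Set (Set (Set P2)) :=
  {S | (∀ l ∈ S, IsComplexLine l) ∧ InGeneralPosition S ∧ ⋃₀ S ⊆ Ωᶜ}

/-- The maximal number of complex lines in general position outside `Ω`. It takes values in `ℕ∞`,
where a finite supremum of a nonempty set is a maximum. -/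
def LiG (Ω : Set P2) : ℕ∞ := sSup (Set.encard '' LG Ω)

/-! ### Hyperbolic toral groups -/

/-- No complex eigenvalue of `A` lies on the unit circle. -/
def IsHyperbolicToralAut (A : SL(2, ℤ)) : Prop :=
  ∀ μ : ℂ, Module.End.HasEigenvalue (Matrix.toLin' (A.1.map (Int.cast : ℤ → ℂ))) μ → ‖μ‖ ≠ 1

/-- The image `M x` of a rational vector `x`. -/
def act (M : SL(2, ℤ)) (x : Fin 2 → ℚ) : Fin 2 → ℚ := (M.1.map (Int.cast : ℤ → ℚ)) *ᵥ x

/-- `φ(B, x, l)` is `∑_{0 ≤ j < l} B^j x` for `l ≥ 0` and `-∑_{1 ≤ j ≤ |l|} B^{-j} x` for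
`l < 0`. -/
def phi (B : SL(2, ℤ)) (x : Fin 2 → ℚ) (l : ℤ) : Fin 2 → ℚ :=
  if 0 ≤ l then ∑ j ∈ Finset.range l.toNat, act (B ^ j) x
  else -∑ j ∈ Finset.Icc 1 l.natAbs, act (B ^ (-(j : ℤ))) x

/-- The block matrix with rows `(M, v)` and `(0, 1)`. -/
def affineSL (M : SL(2, ℤ)) (v : Fin 2 → ℚ) : SL(3, ℂ) :=
  ⟨!![((M.1 0 0 : ℤ) : ℂ), ((M.1 0 1 : ℤ) : ℂ), ((v 0 : ℚ) : ℂ);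
      ((M.1 1 0 : ℤ) : ℂ), ((M.1 1 1 : ℤ) : ℂ), ((v 1 : ℚ) : ℂ);
      0, 0, 1], by
    have h : M.1 0 0 * M.1 1 1 - M.1 0 1 * M.1 1 0 = 1 := by
      rw [← Matrix.det_fin_two]; exact M.2
    have h' : ((M.1 0 0 : ℤ) : ℂ) * ((M.1 1 1 : ℤ) : ℂ)
        - ((M.1 0 1 : ℤ) : ℂ) * ((M.1 1 0 : ℤ) : ℂ) = 1 := by exact_mod_cast h
    rw [Matrix.det_fin_three]
    simpa using h'⟩

/-- An integral vector as a rational vector. -/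
def intVec (b : Fin 2 → ℤ) : Fin 2 → ℚ := fun i => (b i : ℚ)

/-- The group `Γ_A`, as a subset of `PSL(3, ℂ)`. -/
def toralOne (A : SL(2, ℤ)) : Set PSL(3, ℂ) :=
  {γ | ∃ (k : ℤ) (b : Fin 2 → ℤ), γ = (affineSL (A ^ k) (intVec b) : SL(3, ℂ))}

/-- The group `Γ_{A,B,ν}`, as a subset of `PSL(3, ℂ)`. -/
def toralTwo (A B : SL(2, ℤ)) (ν : Fin 2 → ℚ) : Set PSL(3, ℂ) :=
  {γ | ∃ (k l : ℤ) (b : Fin 2 → ℤ),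
    γ = (affineSL (A ^ k * B ^ l) (intVec b + phi B ν l) : SL(3, ℂ))}

/-- The conditions imposed on the data `(A, B, ν)` of a group `Γ_{A,B,ν}`. -/
structure ToralTwoData (A B : SL(2, ℤ)) (ν : Fin 2 → ℚ) : Prop where
  free : Nonempty (Subgroup.closure {A, B} ≃* Multiplicative (ℤ × ℤ))
  hyperbolic : ∀ M ∈ Subgroup.closure {A, B}, M ≠ 1 → IsHyperbolicToralAut M
  integral : ∃ b : Fin 2 → ℤ, act A ν - ν = intVec b

/-- A subgroup of `PSL(3, ℂ)` is hyperbolic toral if it is conjugate in `PSL(3, ℂ)` to a group `Γ_A`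
or to a group `Γ_{A,B,ν}`. -/
def IsHyperbolicToralGroup (H : Subgroup PSL(3, ℂ)) : Prop :=
  (∃ A : SL(2, ℤ), IsHyperbolicToralAut A ∧
    ∃ g : PSL(3, ℂ), (H : Set PSL(3, ℂ)) = (fun γ => g * γ * g⁻¹) '' toralOne A) ∨
  (∃ (A B : SL(2, ℤ)) (ν : Fin 2 → ℚ), ToralTwoData A B ν ∧
    ∃ g : PSL(3, ℂ), (H : Set PSL(3, ℂ)) = (fun γ => g * γ * g⁻¹) '' toralTwo A B ν)

end KulkarniLines

end

/-!
Why the theorem holds.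

Pairs of affine maps. All groups that matter fix two points of the plane and so are conjugate to
groups `Δ` of maps `(x, y) ↦ (a₀ x + b₀, a₁ y + b₁)` of the affine chart (`Aff2`,
`exists_conjBy_eq_map`). The limit set is controlled from above by limit matrices: rescaled
matrices of distinct elements of a discrete group converge, along a subsequence, to a nonzero
singular matrix, and a closed invariant set containing all the kernels of such limits contains the
limit set (`limitSet_subset_of_kernels`).

From toral groups to four lines. The limit set does not change on passing to a subgroup of finite
index (`limitSet_eq_of_relIndex`), so one may take the toral group itself. The groups `Γ_{A,B,ν}`
do not occur: logarithms of eigenvalues would embed `ℤ²` as a discrete subgroup of `ℝ`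
(`not_toralTwoData`). Diagonalizing `A` over `ℝ` turns `Γ_A` into a group of real pairs of affine
maps with linear parts `(λᵏ, λ⁻ᵏ)`. Its limit matrices are real up to a factor, so all limit points
have a real coordinate or are at infinity, and every limit line passes through one of the two
points at infinity of the axes. At most two lines in general position pass through a given point,
which gives the bound four. Conversely `L0` and `L1` contain only points with both coordinates real
or at infinity, so compact sets of points with one coordinate equal to `I` are allowed in the
definition of `L2`. Expanding the other coordinate shows that the lines `w j = σ j`, with `σ` in
the translation lattice, lie in `L2` (`line_subset_L2`); two of them in each direction are in
general position.

From four lines to toral groups. Let four limit lines be in general position and four be the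
maximal number. A point lying on infinitely many limit lines is a centre. Every limit line passes
through a vertex of the four given lines, so all but finitely many pass through a centre
(`finite_lines_off_centers`). Three centres would give five lines in general position
(`centers_not_three`). With fewer than two centres, a subgroup of finite index would fix too many
lines for a discrete group (`exists_two_centers`). So there are exactly two centres, and the
subgroup of index at most two fixing both is conjugate to a group `Δ` as above, with infinitely
many limit lines parallel to each axis.

For such a discrete `Δ`, a commutator is a nonzero translation. Discreteness forbids to contract a
translation vector, so some element expands one coordinate and contracts the other, and lattice
vectors lie on no axis (`isHyperbolic_of_hasParallelLines`). The points whose difference to a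
hyperbolic fixed point is in the real span of the lattice lie in `L0` (`add_realSpan_mem_L0`). That
span is the product of a real subspace of `ℂ` in each coordinate (`mem_realSpan_iff`). If both are
`ℂ`, the limit set is the plane, which contains five lines in general position
(`limitSet_ne_univ`). If only one is `ℂ`, there is no second limit line in that direction
(`not_hasParallelLines_of_axisSpan`). So both are real lines, the lattice has rank two, and linear
parts are real and integral in a lattice basis. Positive linear parts form a subgroup of index at
most four, and its linear parts form an infinite cyclic group: this subgroup is conjugate to some
`Γ_A` (`exists_toral`), and the total index is at most `2 * 4`.
-/

namespace KulkarniLines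
open scoped Pointwise

/-! ### The projective plane and its topology -/

/-- The point of the projective plane with homogeneous coordinates `v`. The value at `v = 0` is a
junk point. -/
noncomputable def pr (v : Fin 3 → ℂ) : P2 :=
  if h : v ≠ 0 then Projectivization.mk ℂ v h
  else Projectivization.mk ℂ (fun _ => 1) (fun h => one_ne_zero (congrFun h 0))

lemma pr_of_ne {v : Fin 3 → ℂ} (h : v ≠ 0) : pr v = Projectivization.mk ℂ v h := dif_pos h

lemma exists_pr (p : P2) : ∃ v, v ≠ 0 ∧ pr v = p :=
  ⟨p.rep, p.rep_nonzero, by rw [pr_of_ne p.rep_nonzero, Projectivization.mk_rep]⟩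

lemma pr_eq_iff {u v : Fin 3 → ℂ} (hu : u ≠ 0) (hv : v ≠ 0) :
    pr u = pr v ↔ ∃ c : ℂ, c ≠ 0 ∧ u = c • v := by
  rw [pr_of_ne hu, pr_of_ne hv, Projectivization.mk_eq_mk_iff']
  constructor
  · rintro ⟨c, rfl⟩
    exact ⟨c, fun h => hu (by simp [h]), rfl⟩
  · rintro ⟨c, -, rfl⟩
    exact ⟨c, rfl⟩

lemma pr_smul {c : ℂ} (hc : c ≠ 0) (v : Fin 3 → ℂ) : pr (c • v) = pr v := by
  by_cases hv : v = 0
  · simp [hv]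
  · exact (pr_eq_iff (smul_ne_zero hc hv) hv).2 ⟨c, hc, rfl⟩

lemma mulVec_ne_zero (g : SL(3, ℂ)) {v : Fin 3 → ℂ} (hv : v ≠ 0) : g.1 *ᵥ v ≠ 0 := by
  intro h
  apply hv
  have := congrArg (fun w => (g⁻¹).1 *ᵥ w) h
  simpa [Matrix.mulVec_mulVec, ← Matrix.SpecialLinearGroup.coe_mul,
    -Matrix.SpecialLinearGroup.coe_inv] using this

lemma smul_pr (g : SL(3, ℂ)) {v : Fin 3 → ℂ} (hv : v ≠ 0) :
    (g : PSL(3, ℂ)) • pr v = pr (g.1 *ᵥ v) := by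
  rw [pr_of_ne hv, pr_of_ne (mulVec_ne_zero g hv)]
  rfl

/-- The projection of nonzero vectors to the plane is open: the saturation of an open set is the
union of its multiples. -/
lemma isOpenQuotientMap_mk :
    IsOpenQuotientMap (Projectivization.mk' ℂ : {v : Fin 3 → ℂ // v ≠ 0} → P2) := by
  have hq : IsQuotientMap (Projectivization.mk' ℂ : {v : Fin 3 → ℂ // v ≠ 0} → P2) := by
    refine ⟨⟨rfl⟩, ?_⟩
    intro p
    exact ⟨⟨p.rep, p.rep_nonzero⟩, p.mk_rep⟩
  refine .of_isOpenMap_isQuotientMap ?_ hq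
  intro U hU
  rw [← hq.isOpen_preimage]
  have : (Projectivization.mk' ℂ : {v : Fin 3 → ℂ // v ≠ 0} → P2) ⁻¹'
      ((Projectivization.mk' ℂ : {v : Fin 3 → ℂ // v ≠ 0} → P2) '' U) =
      ⋃ c : ℂˣ, (fun v : {v : Fin 3 → ℂ // v ≠ 0} =>
        (⟨(c : ℂ) • v.1, smul_ne_zero c.ne_zero v.2⟩ : {v : Fin 3 → ℂ // v ≠ 0})) ⁻¹' U := by
    ext v
    simp only [Set.mem_preimage, Set.mem_image, Set.mem_iUnion]
    constructor
    · rintro ⟨u, hu, h⟩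
      obtain ⟨c, hc⟩ := (Projectivization.mk_eq_mk_iff ℂ _ _ u.2 v.2).1 h
      refine ⟨c, ?_⟩
      convert hu using 1
      exact Subtype.ext hc
    · rintro ⟨c, hc⟩
      exact ⟨_, hc, (Projectivization.mk_eq_mk_iff ℂ _ _ _ v.2).2 ⟨c, rfl⟩⟩
  rw [this]
  refine isOpen_iUnion fun c => hU.preimage ?_
  exact Continuous.subtype_mk (continuous_subtype_val.const_smul (c : ℂ)) _

lemma map_pr_nhds {v : Fin 3 → ℂ} (hv : v ≠ 0) : map pr (𝓝 v) = 𝓝 (pr v) := by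
  have h1 := isOpenQuotientMap_mk.map_nhds_eq ⟨v, hv⟩
  have h2 : map (Subtype.val) (𝓝 (⟨v, hv⟩ : {v : Fin 3 → ℂ // v ≠ 0})) = 𝓝 v :=
    map_nhds_subtype_coe_eq_nhds (p := fun w => w ≠ 0) hv (isOpen_ne.mem_nhds hv)
  rw [pr_of_ne hv, ← h2, Filter.map_map]
  refine Eq.trans ?_ h1
  congr 1
  funext u
  exact pr_of_ne u.2

lemma continuousAt_pr {v : Fin 3 → ℂ} (hv : v ≠ 0) : ContinuousAt pr v := (map_pr_nhds hv).le

/-- The equivalence relation of proportionality is closed, being given by vanishing of the cross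
product. -/
instance : T2Space P2 := by
  rw [t2Space_iff_of_isOpenQuotientMap isOpenQuotientMap_mk]
  have : {q : {v : Fin 3 → ℂ // v ≠ 0} × {v : Fin 3 → ℂ // v ≠ 0} |
      Projectivization.mk' ℂ q.1 = (Projectivization.mk' ℂ q.2 : P2)} =
      {q | q.1.1 ⨯₃ q.2.1 = 0} := by
    ext q
    exact Projectivization.mk_eq_mk_iff_crossProduct_eq_zero q.1.2 q.2.2
  rw [this]
  refine isClosed_eq ?_ continuous_const
  simp only [cross_apply]
  refine continuous_pi fun i => ?_
  have h1 : ∀ j, Continuous fun q : {v : Fin 3 → ℂ // v ≠ 0} × {v : Fin 3 → ℂ // v ≠ 0} =>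
      q.1.1 j := fun j => (continuous_apply j).comp (continuous_subtype_val.comp continuous_fst)
  have h2 : ∀ j, Continuous fun q : {v : Fin 3 → ℂ // v ≠ 0} × {v : Fin 3 → ℂ // v ≠ 0} =>
      q.2.1 j := fun j => (continuous_apply j).comp (continuous_subtype_val.comp continuous_snd)
  fin_cases i
  · exact ((h1 1).mul (h2 2)).sub ((h1 2).mul (h2 1))
  · exact ((h1 2).mul (h2 0)).sub ((h1 0).mul (h2 2))
  · exact ((h1 0).mul (h2 1)).sub ((h1 1).mul (h2 0))

/-- A convergent family of points of the plane lifts to a convergent family of vectors. -/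
lemma exists_tendsto_lift {α : Type*} {l : Filter α} {k : α → P2} {v : Fin 3 → ℂ} (hv : v ≠ 0)
    (hk : Tendsto k l (𝓝 (pr v))) :
    ∃ u : α → Fin 3 → ℂ, (∀ m, u m ≠ 0) ∧ (∀ m, pr (u m) = k m) ∧ Tendsto u l (𝓝 v) := by
  obtain ⟨i, hi⟩ : ∃ i, v i ≠ 0 := by
    by_contra! h
    exact hv (funext h)
  -- a local section: the representative whose `i`-th coordinate is `v i`
  let σ : P2 → Fin 3 → ℂ := fun p => if p.rep i = 0 then p.rep else (v i / p.rep i) • p.rep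
  have hσ : ∀ u : Fin 3 → ℂ, u i ≠ 0 → σ (pr u) = (v i / u i) • u := by
    intro u hu
    have hu0 : u ≠ 0 := fun h => hu (by simp [h])
    have hrep : pr u = pr (pr u).rep := by
      rw [pr_of_ne (pr u).rep_nonzero, Projectivization.mk_rep]
    obtain ⟨c, hc, hc'⟩ := (pr_eq_iff hu0 (pr u).rep_nonzero).1 hrep
    have hci : u i = c * (pr u).rep i := by
      conv_lhs => rw [hc']
      simp
    have hri : (pr u).rep i ≠ 0 := fun h => hu (by rw [hci, h, mul_zero])
    simp only [σ, if_neg hri]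
    have key : (v i / u i) • u = (v i / u i * c) • (pr u).rep := by
      rw [mul_smul, ← hc']
    rw [key, hci]
    congr 1
    field_simp
  refine ⟨fun m => σ (k m), fun m => ?_, fun m => ?_, ?_⟩
  · simp only [σ]
    split_ifs with h
    · exact (k m).rep_nonzero
    · exact smul_ne_zero (div_ne_zero hi h) (k m).rep_nonzero
  · simp only [σ]
    split_ifs with h
    · rw [pr_of_ne (k m).rep_nonzero, Projectivization.mk_rep]
    · rw [pr_smul (div_ne_zero hi h), pr_of_ne (k m).rep_nonzero, Projectivization.mk_rep]
  · suffices hs : Tendsto σ (𝓝 (pr v)) (𝓝 v) from hs.comp hk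
    rw [← map_pr_nhds hv, tendsto_map'_iff]
    have h1 : Tendsto (fun u : Fin 3 → ℂ => (v i / u i) • u) (𝓝 v) (𝓝 ((v i / v i) • v)) := by
      refine Tendsto.smul (tendsto_const_nhds.div ((continuous_apply i).tendsto v) hi) tendsto_id
    rw [div_self hi, one_smul] at h1
    refine h1.congr' ?_
    have : ∀ᶠ u : Fin 3 → ℂ in 𝓝 v, u i ≠ 0 :=
      (continuous_apply i).continuousAt.eventually_ne hi
    filter_upwards [this] with u hu
    exact (hσ u hu).symm

lemma tendsto_mulVec {α : Type*} {l : Filter α} {M : α → Matrix (Fin 3) (Fin 3) ℂ}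
    {S : Matrix (Fin 3) (Fin 3) ℂ} {u : α → Fin 3 → ℂ} {v : Fin 3 → ℂ}
    (hM : Tendsto M l (𝓝 S)) (hu : Tendsto u l (𝓝 v)) :
    Tendsto (fun m => M m *ᵥ u m) l (𝓝 (S *ᵥ v)) := by
  rw [tendsto_pi_nhds] at hu ⊢
  intro i
  simp only [Matrix.mulVec, dotProduct]
  refine tendsto_finsetSum _ fun j _ => Tendsto.mul ?_ (hu j)
  exact (tendsto_pi_nhds.1 ((tendsto_pi_nhds.1 hM) i)) j

/-- If matrices converge to `S` and vectors to `v` outside the kernel of `S`, the images converge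
in the projective plane. -/
lemma tendsto_pr_mulVec {α : Type*} {l : Filter α} {M : α → Matrix (Fin 3) (Fin 3) ℂ}
    {S : Matrix (Fin 3) (Fin 3) ℂ} {u : α → Fin 3 → ℂ} {v : Fin 3 → ℂ}
    (hM : Tendsto M l (𝓝 S)) (hu : Tendsto u l (𝓝 v)) (h : S *ᵥ v ≠ 0) :
    Tendsto (fun m => pr (M m *ᵥ u m)) l (𝓝 (pr (S *ᵥ v))) := by
  exact (continuousAt_pr h).tendsto.comp (tendsto_mulVec hM hu)

instance : ContinuousConstSMul PSL(3, ℂ) P2 where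
  continuous_const_smul γ := by
    induction γ using QuotientGroup.induction_on with | H g =>
    rw [continuous_iff_continuousAt]
    intro p
    obtain ⟨v, hv, rfl⟩ := exists_pr p
    rw [ContinuousAt, ← map_pr_nhds hv, tendsto_map'_iff]
    change Tendsto _ _ (𝓝 ((g : PSL(3, ℂ)) • pr v))
    rw [smul_pr g hv]
    refine (tendsto_pr_mulVec (M := fun _ => g.1) tendsto_const_nhds tendsto_id
      (mulVec_ne_zero g hv)).congr' ?_
    filter_upwards [isOpen_ne.mem_nhds hv] with u hu
    exact (smul_pr g hu).symm

/-! ### Conjugation and finite-index invariance of the limit set -/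

/-- The conjugate subgroup `g Γ g⁻¹`. -/
def conjBy (g : PSL(3, ℂ)) (Γ : Subgroup PSL(3, ℂ)) : Subgroup PSL(3, ℂ) :=
  Γ.map (MulAut.conj g).toMonoidHom

lemma mem_conjBy {g γ : PSL(3, ℂ)} {Γ : Subgroup PSL(3, ℂ)} :
    γ ∈ conjBy g Γ ↔ g⁻¹ * γ * g ∈ Γ := by
  simp only [conjBy, Subgroup.mem_map]
  constructor
  · rintro ⟨x, hx, rfl⟩
    simpa [mul_assoc] using hx
  · intro h
    exact ⟨_, h, by simp [mul_assoc]⟩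

lemma conjBy_conjBy (g h : PSL(3, ℂ)) (Γ : Subgroup PSL(3, ℂ)) :
    conjBy g (conjBy h Γ) = conjBy (g * h) Γ := by
  ext γ
  simp [mem_conjBy, mul_assoc]

lemma conjBy_one (Γ : Subgroup PSL(3, ℂ)) : conjBy 1 Γ = Γ := by
  ext γ
  simp [mem_conjBy]

lemma conjBy_of_mem {Γ : Subgroup PSL(3, ℂ)} {g : PSL(3, ℂ)} (hg : g ∈ Γ) : conjBy g Γ = Γ := by
  ext γ
  rw [mem_conjBy, Subgroup.mul_mem_cancel_right _ hg,
    Subgroup.mul_mem_cancel_left _ (inv_mem hg)]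

lemma IsClusterPoint.conjBy {Γ : Subgroup PSL(3, ℂ)} {K : Set P2} {q : P2}
    (h : IsClusterPoint Γ K q) (g : PSL(3, ℂ)) : IsClusterPoint (conjBy g Γ) (g • K) (g • q) := by
  obtain ⟨k, γ, hk, hγ, hinj, hlim⟩ := h
  refine ⟨fun m => g • k m, fun m => g * γ m * g⁻¹, fun m => Set.smul_mem_smul_set (hk m),
    fun m => ?_, fun a b hab => hinj (by simpa using hab), ?_⟩
  · rw [mem_conjBy]
    simpa [mul_assoc] using hγ m
  · simpa [mul_smul] using hlim.const_smul g

lemma isClusterPoint_conjBy_iff {Γ : Subgroup PSL(3, ℂ)} {K : Set P2} {q : P2} (g : PSL(3, ℂ)) :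
    IsClusterPoint (conjBy g Γ) K q ↔ IsClusterPoint Γ (g⁻¹ • K) (g⁻¹ • q) := by
  constructor
  · intro h
    simpa [conjBy_conjBy, conjBy_one] using h.conjBy g⁻¹
  · intro h
    simpa using h.conjBy g

lemma L0_conjBy (g : PSL(3, ℂ)) (Γ : Subgroup PSL(3, ℂ)) : L0 (conjBy g Γ) = g • L0 Γ := by
  have h : {x : P2 | {γ : PSL(3, ℂ) | γ ∈ conjBy g Γ ∧ γ • x = x}.Infinite} =
      g • {x : P2 | {γ : PSL(3, ℂ) | γ ∈ Γ ∧ γ • x = x}.Infinite} := by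
    ext x
    rw [Set.mem_smul_set_iff_inv_smul_mem, Set.mem_ofPred_eq, Set.mem_ofPred_eq]
    have : {γ : PSL(3, ℂ) | γ ∈ conjBy g Γ ∧ γ • x = x} =
        (MulAut.conj g) '' {γ : PSL(3, ℂ) | γ ∈ Γ ∧ γ • g⁻¹ • x = g⁻¹ • x} := by
      ext γ
      constructor
      · rintro ⟨h1, h2⟩
        refine ⟨g⁻¹ * γ * g, ⟨mem_conjBy.1 h1, ?_⟩, by simp [mul_assoc]⟩
        simp [mul_smul, h2]
      · rintro ⟨δ, ⟨h1, h2⟩, rfl⟩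
        refine ⟨mem_conjBy.2 (by simpa [mul_assoc] using h1), ?_⟩
        simp [mul_smul, h2]
    rw [this, Set.infinite_image_iff (MulAut.conj g).injective.injOn]
  rw [L0, h, closure_smul, L0]

lemma L1_conjBy (g : PSL(3, ℂ)) (Γ : Subgroup PSL(3, ℂ)) : L1 (conjBy g Γ) = g • L1 Γ := by
  rw [L1, L1, ← closure_smul]
  congr 1
  ext q
  rw [Set.mem_smul_set_iff_inv_smul_mem, Set.mem_ofPred_eq, Set.mem_ofPred_eq]
  simp only [L0_conjBy, isClusterPoint_conjBy_iff, Set.smul_set_singleton,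
    Set.mem_smul_set_iff_inv_smul_mem]
  constructor
  · rintro ⟨z, hz, h⟩
    exact ⟨_, hz, h⟩
  · rintro ⟨z, hz, h⟩
    exact ⟨g • z, by simpa using hz, by simpa using h⟩

lemma L2_conjBy (g : PSL(3, ℂ)) (Γ : Subgroup PSL(3, ℂ)) : L2 (conjBy g Γ) = g • L2 Γ := by
  rw [L2, L2, ← closure_smul]
  congr 1
  ext q
  rw [Set.mem_smul_set_iff_inv_smul_mem, Set.mem_ofPred_eq, Set.mem_ofPred_eq]
  simp only [L0_conjBy, L1_conjBy, isClusterPoint_conjBy_iff, ← Set.smul_set_union,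
    ← Set.smul_set_compl]
  constructor
  · rintro ⟨K, hK, hsub, h⟩
    exact ⟨_, hK.smul g⁻¹, by rwa [Set.smul_set_subset_iff_subset_inv_smul_set, inv_inv], h⟩
  · rintro ⟨K, hK, hsub, h⟩
    exact ⟨g • K, hK.smul g, Set.smul_set_mono hsub, by simpa using h⟩

lemma limitSet_conjBy (g : PSL(3, ℂ)) (Γ : Subgroup PSL(3, ℂ)) :
    limitSet (conjBy g Γ) = g • limitSet Γ := by
  simp only [limitSet, L0_conjBy, L1_conjBy, L2_conjBy, Set.smul_set_union]

lemma smul_L0 {Γ : Subgroup PSL(3, ℂ)} {g : PSL(3, ℂ)} (hg : g ∈ Γ) : g • L0 Γ = L0 Γ := by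
  rw [← L0_conjBy, conjBy_of_mem hg]

lemma smul_L1 {Γ : Subgroup PSL(3, ℂ)} {g : PSL(3, ℂ)} (hg : g ∈ Γ) : g • L1 Γ = L1 Γ := by
  rw [← L1_conjBy, conjBy_of_mem hg]

/-- A sequence in `Γ` has a subsequence in a single right coset of a finite-index subgroup. -/
lemma exists_subseq_coset {Γ₀ Γ : Subgroup PSL(3, ℂ)} (hi : Γ₀.relIndex Γ ≠ 0)
    {γ : ℕ → PSL(3, ℂ)} (hγ : ∀ m, γ m ∈ Γ) :
    ∃ φ : ℕ → ℕ, StrictMono φ ∧ ∀ m, γ (φ m) * (γ (φ 0))⁻¹ ∈ Γ₀ := by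
  have : Finite (Γ ⧸ Γ₀.subgroupOf Γ) :=
    have : (Γ₀.subgroupOf Γ).FiniteIndex := ⟨hi⟩
    Subgroup.finite_quotient_of_finiteIndex
  obtain ⟨y, hy⟩ := Finite.exists_infinite_fiber
    (fun m => (QuotientGroup.mk (⟨γ m, hγ m⟩⁻¹ : Γ) : Γ ⧸ Γ₀.subgroupOf Γ))
  rw [Set.infinite_coe_iff] at hy
  refine ⟨Nat.nth _, Nat.nth_strictMono hy, fun m => ?_⟩
  have h1 := Nat.nth_mem_of_infinite hy m
  have h2 := Nat.nth_mem_of_infinite hy 0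
  have h3 := QuotientGroup.eq.1 (Eq.trans h1 (Eq.symm h2))
  simpa [Subgroup.mem_subgroupOf] using h3

lemma IsClusterPoint.mono {Γ₀ Γ : Subgroup PSL(3, ℂ)} (h : Γ₀ ≤ Γ) {K : Set P2} {q : P2}
    (hq : IsClusterPoint Γ₀ K q) : IsClusterPoint Γ K q := by
  obtain ⟨k, γ, hk, hγ, h'⟩ := hq
  exact ⟨k, γ, hk, fun m => h (hγ m), h'⟩

/-- A cluster point of `Γ K` is a cluster point of `Γ₀ (c K)` for some `c` in `Γ`, when `Γ₀` has
finite index. -/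
lemma IsClusterPoint.exists_of_relIndex {Γ₀ Γ : Subgroup PSL(3, ℂ)} (hi : Γ₀.relIndex Γ ≠ 0)
    {K : Set P2} {q : P2} (hq : IsClusterPoint Γ K q) :
    ∃ c ∈ Γ, IsClusterPoint Γ₀ (c • K) q := by
  obtain ⟨k, γ, hk, hγ, hinj, hlim⟩ := hq
  obtain ⟨φ, hφ, hc⟩ := exists_subseq_coset hi hγ
  refine ⟨γ (φ 0), hγ _, fun m => γ (φ 0) • k (φ m), fun m => γ (φ m) * (γ (φ 0))⁻¹,
    fun m => Set.smul_mem_smul_set (hk _), hc, fun a b hab => ?_, ?_⟩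
  · exact hφ.injective (hinj (by simpa using hab))
  · simpa [mul_smul, Function.comp_def] using hlim.comp hφ.tendsto_atTop

/-- The Kulkarni limit set does not change on passing to a subgroup of finite index. -/
lemma limitSet_eq_of_relIndex {Γ₀ Γ : Subgroup PSL(3, ℂ)} (hle : Γ₀ ≤ Γ)
    (hi : Γ₀.relIndex Γ ≠ 0) : limitSet Γ₀ = limitSet Γ := by
  have h0 : L0 Γ₀ = L0 Γ := by
    unfold L0
    congr 1
    ext x
    constructor
    · exact fun h => h.mono fun γ hγ => ⟨hle hγ.1, hγ.2⟩
    · intro h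
      -- quotients of isotropy elements in a common coset are isotropy elements in `Γ₀`
      let e := h.natEmbedding
      obtain ⟨φ, hφ, hc⟩ := exists_subseq_coset hi (γ := fun m => (e m).1) fun m => (e m).2.1
      refine Set.infinite_of_injective_forall_mem (f := fun m => (e (φ m)).1 * (e (φ 0)).1⁻¹)
        (fun a b hab => ?_) fun m => ⟨hc m, ?_⟩
      · exact hφ.injective (e.injective (Subtype.ext (by simpa using hab)))
      · have := (e (φ 0)).2.2
        rw [mul_smul, inv_smul_eq_iff.2 this.symm, (e (φ m)).2.2]
  have h1 : L1 Γ₀ = L1 Γ := by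
    unfold L1
    congr 1
    ext q
    constructor
    · rintro ⟨z, hz, h⟩
      exact ⟨z, h0 ▸ hz, h.mono hle⟩
    · rintro ⟨z, hz, h⟩
      obtain ⟨c, hc, h⟩ := h.exists_of_relIndex hi
      refine ⟨c • z, ?_, by simpa using h⟩
      rw [h0, ← smul_L0 hc]
      simpa using hz
  have h2 : L2 Γ₀ = L2 Γ := by
    unfold L2
    congr 1
    ext q
    constructor
    · rintro ⟨K, hK, hs, h⟩
      exact ⟨K, hK, by rwa [← h0, ← h1], h.mono hle⟩
    · rintro ⟨K, hK, hs, h⟩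
      obtain ⟨c, hc, h⟩ := h.exists_of_relIndex hi
      refine ⟨c • K, hK.smul c, ?_, h⟩
      rw [h0, h1, ← smul_L0 hc, ← smul_L1 hc, ← Set.smul_set_union, ← Set.smul_set_compl]
      exact Set.smul_set_mono hs
  rw [limitSet, limitSet, h0, h1, h2]

/-! ### Discreteness and degenerate limits of projective transformations -/

/-- In a discrete subgroup, only finitely many elements lift to matrices with entries bounded by
`R`: quotients of consecutive elements of a convergent sequence of matrices tend to `1`. -/
lemma finite_of_bounded {Γ : Subgroup PSL(3, ℂ)} (hΓ : DiscreteTopology Γ) (R : ℝ) :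
    {γ : PSL(3, ℂ) | γ ∈ Γ ∧ ∃ g : SL(3, ℂ), (g : PSL(3, ℂ)) = γ ∧
      ∀ i j, ‖g.1 i j‖ ≤ R}.Finite := by
  by_contra hinf
  let e := Set.Infinite.natEmbedding _ hinf
  choose g hg hgR using fun m => (e m).2.2
  have hK' : IsCompact {M : Fin 3 → Fin 3 → ℂ | ∀ i j, ‖M i j‖ ≤ R} := by
    have : IsCompact (Set.pi Set.univ fun _ : Fin 3 => Set.pi Set.univ
        fun _ : Fin 3 => Metric.closedBall (0 : ℂ) R) :=
      isCompact_univ_pi fun _ => isCompact_univ_pi fun _ => isCompact_closedBall 0 R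
    convert this using 1
    ext M
    simp
  have hK : IsCompact {M : Matrix (Fin 3) (Fin 3) ℂ | ∀ i j, ‖M i j‖ ≤ R} := hK'
  have : FirstCountableTopology (Matrix (Fin 3) (Fin 3) ℂ) :=
    inferInstanceAs (FirstCountableTopology (Fin 3 → Fin 3 → ℂ))
  obtain ⟨M, -, φ, hφ, hlim⟩ := hK.tendsto_subseq (x := fun m => (g m).1) hgR
  have hdet : M.det = 1 := by
    have h1 : Tendsto (fun m => ((g (φ m)).1).det) atTop (𝓝 M.det) :=
      (continuous_id.matrix_det.tendsto M).comp hlim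
    exact tendsto_nhds_unique (h1.congr fun m => (g (φ m)).2) tendsto_const_nhds
  obtain ⟨G, hG⟩ : ∃ G : SL(3, ℂ), G.1 = M := ⟨⟨M, hdet⟩, rfl⟩
  subst hG
  have hlim' : Tendsto (fun m => g (φ m)) atTop (𝓝 G) :=
    tendsto_subtype_rng.2 hlim
  have hmul : Tendsto (fun m => g (φ m) * (g (φ (m + 1)))⁻¹) atTop (𝓝 1) := by
    have := hlim'.mul ((hlim'.comp (tendsto_add_atTop_nat 1)).inv)
    rwa [mul_inv_cancel] at this
  have hmk : Tendsto (fun m => ((g (φ m) * (g (φ (m + 1)))⁻¹ : SL(3, ℂ)) : PSL(3, ℂ))) atTop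
      (𝓝 ((1 : SL(3, ℂ)) : PSL(3, ℂ))) :=
    (QuotientGroup.continuous_mk.tendsto _).comp hmul
  have hev : ∀ᶠ m in atTop, e (φ m) = e (φ (m + 1)) := by
    have hΓ1 : ({1} : Set Γ) ∈ 𝓝 (1 : Γ) := by simp
    obtain ⟨U, hU, hU1⟩ := mem_nhds_subtype _ _ _ |>.1 hΓ1
    filter_upwards [hmk hU] with m hm
    have hmem : (e (φ m)).1 * ((e (φ (m + 1))).1)⁻¹ ∈ Γ :=
      mul_mem (e (φ m)).2.1 (inv_mem (e (φ (m + 1))).2.1)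
    have h1 : (⟨_, hmem⟩ : Γ) ∈ ({1} : Set Γ) := by
      apply hU1
      simpa [← hg] using hm
    have h2 := congrArg Subtype.val h1
    exact Subtype.ext (mul_inv_eq_one.1 h2)
  obtain ⟨m, hm⟩ := hev.exists
  exact (hφ (Nat.lt_succ_self m)).ne (e.injective hm)

/-- A sequence of pairwise distinct elements of a discrete group has, after rescaling its matrices
by factors tending to `0`, a subsequence converging to a nonzero matrix. -/
lemma exists_limit_matrix {Γ : Subgroup PSL(3, ℂ)} (hΓ : DiscreteTopology Γ) {g : ℕ → SL(3, ℂ)}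
    (hg : ∀ m, (g m : PSL(3, ℂ)) ∈ Γ) (hinj : Function.Injective fun m => (g m : PSL(3, ℂ))) :
    ∃ (φ : ℕ → ℕ) (c : ℕ → ℂ) (S : Matrix (Fin 3) (Fin 3) ℂ), StrictMono φ ∧ (∀ m, c m ≠ 0) ∧
      Tendsto c atTop (𝓝 0) ∧ S ≠ 0 ∧ Tendsto (fun m => c m • (g (φ m)).1) atTop (𝓝 S) := by
  let f : ℕ → Fin 3 → Fin 3 → ℂ := fun m i j => (g m).1 i j
  have hpos : ∀ m, 0 < ‖f m‖ := by
    intro m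
    rw [norm_pos_iff]
    intro h
    have h1 := (g m).2
    have h2 : (g m).1 = 0 := h
    rw [h2] at h1
    simp at h1
  have htop : Tendsto (fun m => ‖f m‖) atTop atTop := by
    rw [tendsto_atTop]
    intro R
    have hfin : {m | ‖f m‖ < R}.Finite := by
      refine Set.Finite.of_finite_image ((finite_of_bounded hΓ R).subset ?_) hinj.injOn
      rintro _ ⟨m, hm, rfl⟩
      refine ⟨hg m, g m, rfl, fun i j => ?_⟩
      exact ((norm_le_pi_norm (f m i) j).trans (norm_le_pi_norm (f m) i)).trans (le_of_lt hm)
    rw [← Nat.cofinite_eq_atTop]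
    filter_upwards [hfin.compl_mem_cofinite] with m hm
    simpa using hm
  have hmem : ∀ m, ((‖f m‖⁻¹ : ℝ) : ℂ) • f m ∈ Metric.sphere (0 : Fin 3 → Fin 3 → ℂ) 1 := by
    intro m
    rw [mem_sphere_zero_iff_norm, norm_smul, Complex.norm_real, norm_inv, norm_norm,
      inv_mul_cancel₀ (hpos m).ne']
  obtain ⟨S, hS, φ, hφ, hlim⟩ := (isCompact_sphere (0 : Fin 3 → Fin 3 → ℂ) 1).tendsto_subseq hmem
  refine ⟨φ, fun m => ((‖f (φ m)‖⁻¹ : ℝ) : ℂ), S, hφ, fun m => ?_, ?_, ?_, hlim⟩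
  · simpa using norm_pos_iff.1 (hpos (φ m))
  · have := (tendsto_inv_atTop_zero.comp htop).comp hφ.tendsto_atTop
    have h2 := (Complex.continuous_ofReal.tendsto 0).comp this
    simpa [Function.comp_def] using h2
  · intro h0
    have h1 : ‖S‖ = 1 := mem_sphere_zero_iff_norm.1 hS
    have h2 : ‖S‖ = 0 := norm_eq_zero.2 h0
    exact zero_ne_one (h2.symm.trans h1)

/-- `S` is a nonzero limit of rescaled matrices of pairwise distinct elements of `Γ`, with factors
tending to `0`. -/
def IsLimitMatrix (Γ : Subgroup PSL(3, ℂ)) (S : Matrix (Fin 3) (Fin 3) ℂ) : Prop :=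
  S ≠ 0 ∧ ∃ (g : ℕ → SL(3, ℂ)) (c : ℕ → ℂ), (∀ m, (g m : PSL(3, ℂ)) ∈ Γ) ∧
    (Function.Injective fun m => (g m : PSL(3, ℂ))) ∧ (∀ m, c m ≠ 0) ∧
    Tendsto c atTop (𝓝 0) ∧ Tendsto (fun m => c m • (g m).1) atTop (𝓝 S)

/-- If `γ m • k m` converges to `q` outside the closed set `X`, and `X` contains the kernels of all
limit matrices, then along a subsequence `k m` and `(γ m)⁻¹ • q` have a common limit, in `X`. The
limit is `S q` for a limit matrix `S` of the inverses; it lies in `X` because `S' S = 0` for a limit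
matrix `S'` of the `γ m`. -/
lemma exists_common_limit {Γ : Subgroup PSL(3, ℂ)} (hΓ : DiscreteTopology Γ) {X : Set P2}
    (hker : ∀ S, IsLimitMatrix Γ S → ∀ v, v ≠ 0 → S *ᵥ v = 0 → pr v ∈ X)
    {γ : ℕ → PSL(3, ℂ)} {k : ℕ → P2} {q : P2} (hγ : ∀ m, γ m ∈ Γ) (hinj : Function.Injective γ)
    (hlim : Tendsto (fun m => γ m • k m) atTop (𝓝 q)) (hq : q ∉ X) :
    ∃ φ : ℕ → ℕ, StrictMono φ ∧ ∃ y ∈ X, Tendsto (fun m => k (φ m)) atTop (𝓝 y) ∧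
      Tendsto (fun m => (γ (φ m))⁻¹ • q) atTop (𝓝 y) := by
  obtain ⟨v, hv, rfl⟩ := exists_pr q
  obtain ⟨u, hu0, hu, hulim⟩ := exists_tendsto_lift hv hlim
  choose g hg using fun m => QuotientGroup.mk_surjective (γ m)
  have hginv : ∀ m, (((g m)⁻¹ : SL(3, ℂ)) : PSL(3, ℂ)) = (γ m)⁻¹ := fun m => by
    rw [← hg m]; rfl
  obtain ⟨φ, c, S, hφ, hc, hc0, hS, hSlim⟩ := exists_limit_matrix hΓ (g := fun m => (g m)⁻¹)
    (fun m => by rw [hginv]; exact inv_mem (hγ m))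
    (fun a b hab => hinj (by simpa only [hginv, _root_.inv_inj] using hab))
  obtain ⟨ψ, c', S', hψ, hc', hc0', hS', hSlim'⟩ := exists_limit_matrix hΓ
    (g := fun m => g (φ m)) (fun m => by rw [hg]; exact hγ _)
    (fun a b hab => hφ.injective (hinj (by simpa only [hg] using hab)))
  have hSv : S *ᵥ v ≠ 0 := by
    intro h
    refine hq (hker S ⟨hS, fun m => (g (φ m))⁻¹, c, fun m => ?_, ?_, hc, hc0, hSlim⟩ v hv h)
    · rw [hginv]; exact inv_mem (hγ _)
    · exact fun a b hab => hφ.injective (hinj (by simpa only [hginv, _root_.inv_inj] using hab))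
  have hSS : S' * S = 0 := by
    have h1 : Tendsto (fun m => (c' m • (g (φ (ψ m))).1) * (c (ψ m) • ((g (φ (ψ m)))⁻¹).1)) atTop
        (𝓝 (S' * S)) := hSlim'.mul (hSlim.comp hψ.tendsto_atTop)
    have h2 : ∀ m, (c' m • (g (φ (ψ m))).1) * (c (ψ m) • ((g (φ (ψ m)))⁻¹).1) =
        (c' m * c (ψ m)) • (1 : Matrix (Fin 3) (Fin 3) ℂ) := by
      intro m
      rw [Matrix.smul_mul, Matrix.mul_smul, smul_smul, ← Matrix.SpecialLinearGroup.coe_mul,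
        mul_inv_cancel, Matrix.SpecialLinearGroup.coe_one]
    simp only [h2] at h1
    have h3 : Tendsto (fun m => (c' m * c (ψ m)) • (1 : Matrix (Fin 3) (Fin 3) ℂ)) atTop
        (𝓝 ((0 * 0 : ℂ) • (1 : Matrix (Fin 3) (Fin 3) ℂ))) :=
      (hc0'.mul (hc0.comp hψ.tendsto_atTop)).smul_const _
    simpa using tendsto_nhds_unique h1 h3
  refine ⟨φ, hφ, pr (S *ᵥ v), ?_, ?_, ?_⟩
  · refine hker S' ⟨hS', fun m => g (φ (ψ m)), c', fun m => ?_, ?_, hc', hc0', hSlim'⟩ _ hSv ?_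
    · rw [hg]; exact hγ _
    · exact fun a b hab => hψ.injective (hφ.injective (hinj (by simpa only [hg] using hab)))
    · rw [Matrix.mulVec_mulVec, hSS, Matrix.zero_mulVec]
  · refine (tendsto_pr_mulVec hSlim (hulim.comp hφ.tendsto_atTop) hSv).congr fun m => ?_
    rw [Matrix.smul_mulVec, pr_smul (hc m), Function.comp, ← smul_pr _ (hu0 _), hginv, hu]
    simp
  · refine (tendsto_pr_mulVec hSlim tendsto_const_nhds hSv).congr fun m => ?_
    rw [Matrix.smul_mulVec, pr_smul (hc m), ← smul_pr _ hv, hginv]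

/-- A closed invariant set containing the kernels of all limit matrices contains the Kulkarni limit
set. -/
lemma limitSet_subset_of_kernels {Γ : Subgroup PSL(3, ℂ)} (hΓ : DiscreteTopology Γ) {X : Set P2}
    (hX : IsClosed X) (hinv : ∀ γ ∈ Γ, ∀ p ∈ X, γ • p ∈ X)
    (hker : ∀ S, IsLimitMatrix Γ S → ∀ v, v ≠ 0 → S *ᵥ v = 0 → pr v ∈ X) :
    limitSet Γ ⊆ X := by
  have h0 : L0 Γ ⊆ X := by
    refine closure_minimal (fun x hx => ?_) hX
    by_contra hxX
    let e := Set.Infinite.natEmbedding _ hx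
    obtain ⟨φ, -, y, hy, hlim, -⟩ := exists_common_limit hΓ hker (γ := fun m => (e m).1)
      (k := fun _ => x) (q := x) (fun m => (e m).2.1) (Subtype.val_injective.comp e.injective)
      (tendsto_const_nhds.congr fun m => ((e m).2.2).symm) hxX
    rw [tendsto_nhds_unique hlim tendsto_const_nhds] at hy
    exact hxX hy
  refine Set.union_subset (Set.union_subset h0 ?_) ?_
  · refine closure_minimal ?_ hX
    rintro q ⟨z, -, k, γ, hk, hγ, hinj, hlim⟩
    by_contra hq
    obtain ⟨φ, -, y, hy, hlim', -⟩ := exists_common_limit hΓ hker hγ hinj hlim hq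
    have hkz : ∀ m, k m = z := hk
    simp only [hkz] at hlim hlim'
    rw [tendsto_nhds_unique hlim' tendsto_const_nhds] at hy
    exact hq (hX.mem_of_tendsto hlim (Eventually.of_forall fun m => hinv _ (hγ m) _ hy))
  · refine closure_minimal ?_ hX
    rintro q ⟨K, hK, hKL, k, γ, hk, hγ, hinj, hlim⟩
    by_contra hq
    obtain ⟨φ, hφ, y, hy, hlim1, hlim2⟩ := exists_common_limit hΓ hker hγ hinj hlim hq
    have hyK : y ∈ K := hK.isClosed.mem_of_tendsto hlim1 (Eventually.of_forall fun m => hk _)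
    -- the limit `y` of `(γ m)⁻¹ • q`, a point of `K`, is a cluster point of an orbit off `L0`
    refine hKL hyK (Or.inr (subset_closure ⟨q, fun h => hq (h0 h), fun _ => q,
      fun m => (γ (φ m))⁻¹, fun _ => rfl, fun m => inv_mem (hγ _), fun a b hab => ?_, hlim2⟩))
    exact hφ.injective (hinj (by simpa using hab))

/-- If the closed set `X` lies in `L0 Γ`, and `Γ` acts on the complement of `X` without clustering
of compact sets, then `X` contains the Kulkarni limit set. -/
lemma limitSet_subset_of_proper {Γ : Subgroup PSL(3, ℂ)} {X : Set P2} (hX : IsClosed X)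
    (hXL : X ⊆ L0 Γ)
    (hprop : ∀ K : Set P2, IsCompact K → K ⊆ Xᶜ → ∀ q, IsClusterPoint Γ K q → q ∈ X) :
    limitSet Γ ⊆ X := by
  refine Set.union_subset (Set.union_subset ?_ ?_) ?_
  · refine closure_minimal (fun x hx => ?_) hX
    by_contra hxX
    let e := Set.Infinite.natEmbedding _ hx
    refine hxX (hprop {x} isCompact_singleton (by simpa using hxX) x ⟨fun _ => x,
      fun m => (e m).1, fun _ => rfl, fun m => (e m).2.1,
      Subtype.val_injective.comp e.injective, ?_⟩)
    exact tendsto_const_nhds.congr fun m => ((e m).2.2).symm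
  · refine closure_minimal ?_ hX
    rintro q ⟨z, hz, h⟩
    refine hprop {z} isCompact_singleton ?_ q h
    simpa using fun h => hz (hXL h)
  · refine closure_minimal ?_ hX
    rintro q ⟨K, hK, hs, h⟩
    exact hprop K hK (hs.trans (Set.compl_subset_compl.2 (hXL.trans Set.subset_union_left))) q h

/-! ### Invertible matrices as projective transformations -/

/-- The class in `PSL(3, ℂ)` of an invertible matrix, rescaled to determinant one. -/
noncomputable def toPSL : GL (Fin 3) ℂ →* PSL(3, ℂ) :=
  (ProjectiveSpecialLinearGroup.isoPSLOfAlgClosedOfNonempty (n := Fin 3)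
    (F := ℂ)).toMonoidHom.comp ProjGenLinGroup.mk

lemma toPGL_toPSL (M : GL (Fin 3) ℂ) :
    ProjectiveSpecialLinearGroup.toPGL (toPSL M) = ProjGenLinGroup.mk M :=
  (ProjectiveSpecialLinearGroup.isoPSLOfAlgClosedOfNonempty (n := Fin 3)
    (F := ℂ)).symm_apply_apply (ProjGenLinGroup.mk M)

lemma toPSL_toGL (g : SL(3, ℂ)) : toPSL (SpecialLinearGroup.toGL g) = (g : PSL(3, ℂ)) := by
  apply ProjectiveSpecialLinearGroup.toPGL_injective
  rw [toPGL_toPSL]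
  rfl

/-- An invertible matrix is proportional to a matrix of determinant one in the same projective
class. -/
lemma exists_lift (M : GL (Fin 3) ℂ) :
    ∃ (g : SL(3, ℂ)) (c : ℂ), c ≠ 0 ∧ (g : PSL(3, ℂ)) = toPSL M ∧ g.1 = c • M.1 := by
  obtain ⟨g, hg⟩ := QuotientGroup.mk_surjective (toPSL M)
  have h := toPGL_toPSL M
  rw [← hg] at h
  obtain ⟨u, hu⟩ := ProjGenLinGroup.mk_eq_mk_iff.1 (h : ProjGenLinGroup.mk _ = _)
  refine ⟨g, (u⁻¹ : ℂˣ), (u⁻¹).ne_zero, hg, ?_⟩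
  rw [← hu]
  ext i j
  simp [Matrix.mul_apply, Matrix.diagonal, mul_comm]

lemma toPSL_eq_of_smul {M N : GL (Fin 3) ℂ} {c : ℂ} (h : M.1 = c • N.1) : toPSL M = toPSL N := by
  have hc : c ≠ 0 := by
    rintro rfl
    rw [zero_smul] at h
    exact M.ne_zero h
  apply ProjectiveSpecialLinearGroup.toPGL_injective
  rw [toPGL_toPSL, toPGL_toPSL, eq_comm, ProjGenLinGroup.mk_eq_mk_iff]
  refine ⟨Units.mk0 c hc, Units.ext ?_⟩
  ext i j
  simp [h, Matrix.mul_apply, Matrix.diagonal, mul_comm]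

lemma gl_mulVec_ne_zero (M : GL (Fin 3) ℂ) {v : Fin 3 → ℂ} (hv : v ≠ 0) : M.1 *ᵥ v ≠ 0 := by
  intro h
  apply hv
  have := congrArg (fun w => (M⁻¹).1 *ᵥ w) h
  simpa only [Matrix.mulVec_mulVec, ← Units.val_mul, inv_mul_cancel, Units.val_one,
    Matrix.one_mulVec, Matrix.mulVec_zero] using this

lemma toPSL_smul_pr (M : GL (Fin 3) ℂ) {v : Fin 3 → ℂ} (hv : v ≠ 0) :
    toPSL M • pr v = pr (M.1 *ᵥ v) := by
  obtain ⟨g, c, hc, hg, hgM⟩ := exists_lift M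
  rw [← hg, smul_pr g hv, hgM, Matrix.smul_mulVec, pr_smul hc]

lemma exists_scalar_of_toPSL_eq_one {M : GL (Fin 3) ℂ} (h : toPSL M = 1) :
    ∃ c : ℂ, M.1 = c • (1 : Matrix (Fin 3) (Fin 3) ℂ) := by
  have h1 := toPGL_toPSL M
  rw [h, map_one, ← map_one ProjGenLinGroup.mk] at h1
  obtain ⟨u, hu⟩ := ProjGenLinGroup.mk_eq_mk_iff.1 h1
  refine ⟨u, ?_⟩
  rw [← hu]
  ext i j
  simp [Matrix.diagonal, Matrix.one_apply]

/-! ### Pairs of complex affine maps -/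

/-- The group of maps `(x, y) ↦ (a₀ x + b₀, a₁ y + b₁)` of `ℂ²`. -/
@[ext] structure Aff2 where
  /-- the linear part -/
  a : Fin 2 → ℂˣ
  /-- the translation part -/
  b : Fin 2 → ℂ

namespace Aff2

instance : Mul Aff2 := ⟨fun d e => ⟨d.a * e.a, fun i => d.a i * e.b i + d.b i⟩⟩
instance : One Aff2 := ⟨⟨1, 0⟩⟩
instance : Inv Aff2 := ⟨fun d => ⟨d.a⁻¹, fun i => -(((d.a i)⁻¹ : ℂˣ) * d.b i)⟩⟩

@[simp] lemma mul_a (d e : Aff2) : (d * e).a = d.a * e.a := rfl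
@[simp] lemma mul_b (d e : Aff2) (i : Fin 2) : (d * e).b i = d.a i * e.b i + d.b i := rfl
@[simp] lemma one_a : (1 : Aff2).a = 1 := rfl
@[simp] lemma one_b : (1 : Aff2).b = 0 := rfl
@[simp] lemma inv_a (d : Aff2) : (d⁻¹).a = d.a⁻¹ := rfl
@[simp] lemma inv_b (d : Aff2) (i : Fin 2) :
    (d⁻¹).b i = -(((d.a i)⁻¹ : ℂˣ) * d.b i) := rfl

instance : Group Aff2 where
  mul_assoc d e f := by
    ext i
    · simp [mul_assoc]
    · simp; ring
  one_mul d := by ext i <;> simp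
  mul_one d := by ext i <;> simp
  inv_mul_cancel d := by ext i <;> simp

/-- The map of `ℂ²` given by an element of `Aff2`. -/
def app (d : Aff2) (w : Fin 2 → ℂ) : Fin 2 → ℂ := fun i => d.a i * w i + d.b i

/-- The matrix of an element of `Aff2` in homogeneous coordinates. -/
def mat (d : Aff2) : Matrix (Fin 3) (Fin 3) ℂ :=
  !![(d.a 0 : ℂ), 0, d.b 0; 0, (d.a 1 : ℂ), d.b 1; 0, 0, 1]

lemma det_mat (d : Aff2) : d.mat.det = d.a 0 * d.a 1 := by
  simp [mat, Matrix.det_fin_three]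

lemma mat_mul (d e : Aff2) : (d * e).mat = d.mat * e.mat := by
  ext i j
  fin_cases i <;> fin_cases j <;> simp [mat, Matrix.mul_apply, Fin.sum_univ_three]

lemma mat_one : (1 : Aff2).mat = 1 := by
  ext i j
  fin_cases i <;> fin_cases j <;> simp [mat]

/-- The embedding of `Aff2` in `GL(3, ℂ)`. -/
noncomputable def toGL : Aff2 →* GL (Fin 3) ℂ :=
  MonoidHom.toHomUnits (G := Aff2) (M := Matrix (Fin 3) (Fin 3) ℂ)
    { toFun := mat, map_one' := mat_one, map_mul' := mat_mul }

@[simp] lemma coe_toGL (d : Aff2) : ((toGL d : GL (Fin 3) ℂ) : Matrix (Fin 3) (Fin 3) ℂ) = d.mat :=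
  rfl

/-- The projective transformation given by an element of `Aff2`. -/
noncomputable def toProj : Aff2 →* PSL(3, ℂ) := toPSL.comp toGL

lemma toProj_smul_pr (d : Aff2) {v : Fin 3 → ℂ} (hv : v ≠ 0) :
    toProj d • pr v = pr (d.mat *ᵥ v) := toPSL_smul_pr _ hv

lemma toProj_injective : Function.Injective toProj := by
  rw [injective_iff_map_eq_one]
  intro d hd
  obtain ⟨c, hc⟩ := exists_scalar_of_toPSL_eq_one hd
  have h := fun i j => congrFun (congrFun hc i) j
  have h22 : 1 = c := by simpa [mat] using h 2 2
  subst h22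
  ext i
  · fin_cases i
    · simpa [mat] using h 0 0
    · simpa [mat] using h 1 1
  · fin_cases i
    · simpa [mat] using h 0 2
    · simpa [mat] using h 1 2

lemma mat_mulVec (d : Aff2) (v : Fin 3 → ℂ) :
    d.mat *ᵥ v = ![d.a 0 * v 0 + d.b 0 * v 2, d.a 1 * v 1 + d.b 1 * v 2, v 2] := by
  ext i
  fin_cases i <;> simp [mat, Matrix.mulVec, dotProduct, Fin.sum_univ_three]

end Aff2

/-! ### The affine chart -/

lemma chart_ne_zero (w : Fin 2 → ℂ) : ![w 0, w 1, 1] ≠ 0 := fun h => by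
  simpa using congrFun h 2

/-- The point of the affine chart `z = 1` with coordinates `w`. -/
noncomputable def pt (w : Fin 2 → ℂ) : P2 := pr ![w 0, w 1, 1]

lemma pt_injective : Function.Injective pt := by
  intro w w' h
  obtain ⟨c, -, hc⟩ := (pr_eq_iff (chart_ne_zero w) (chart_ne_zero w')).1 h
  have h := fun i => congrFun hc i
  have h2 : 1 = c := by simpa using h 2
  subst h2
  ext i
  fin_cases i
  · simpa using h 0
  · simpa using h 1

lemma Aff2.toProj_smul_pt (d : Aff2) (w : Fin 2 → ℂ) : d.toProj • pt w = pt (d.app w) := by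
  rw [pt, d.toProj_smul_pr (chart_ne_zero w), d.mat_mulVec, pt]
  simp [Aff2.app]

/-- The set of points of the plane whose homogeneous coordinates satisfy `P`. -/
def locus (P : (Fin 3 → ℂ) → Prop) : Set P2 := {p | ∀ v, v ≠ 0 → pr v = p → P v}

/-- Invariance of a condition under rescaling of the homogeneous coordinates. -/
def Homogeneous (P : (Fin 3 → ℂ) → Prop) : Prop :=
  ∀ (c : ℂ) (v : Fin 3 → ℂ), c ≠ 0 → P v → P (c • v)

lemma pr_mem_locus {P : (Fin 3 → ℂ) → Prop} (hP : Homogeneous P) {v : Fin 3 → ℂ} (hv : v ≠ 0) :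
    pr v ∈ locus P ↔ P v := by
  constructor
  · exact fun h => h v hv rfl
  · intro h u hu huv
    obtain ⟨c, hc, rfl⟩ := (pr_eq_iff hu hv).1 huv
    exact hP c v hc h

lemma pt_mem_locus {P : (Fin 3 → ℂ) → Prop} (hP : Homogeneous P) (w : Fin 2 → ℂ) :
    pt w ∈ locus P ↔ P ![w 0, w 1, 1] := pr_mem_locus hP (chart_ne_zero w)

lemma isClosed_locus {P : (Fin 3 → ℂ) → Prop} (hP : Homogeneous P) (hc : IsClosed {v | P v}) :
    IsClosed (locus P) := by
  rw [← isOpenQuotientMap_mk.isQuotientMap.isClosed_preimage]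
  have : (Projectivization.mk' ℂ : {v : Fin 3 → ℂ // v ≠ 0} → P2) ⁻¹' locus P =
      Subtype.val ⁻¹' {v | P v} := by
    ext v
    have := pr_mem_locus hP v.2
    rwa [pr_of_ne v.2] at this
  rw [this]
  exact hc.preimage continuous_subtype_val

/-- The line at infinity of the affine chart. -/
def lineInf : Set P2 := locus fun v => v 2 = 0

lemma homogeneous_lineInf : Homogeneous fun v => v 2 = 0 := fun c v _ h => by simp [h]

lemma isClosed_lineInf : IsClosed lineInf :=
  isClosed_locus homogeneous_lineInf (isClosed_eq (continuous_apply 2) continuous_const)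

lemma pr_mem_lineInf {v : Fin 3 → ℂ} (hv : v ≠ 0) : pr v ∈ lineInf ↔ v 2 = 0 :=
  pr_mem_locus homogeneous_lineInf hv

/-- The affine coordinates of a point outside the line at infinity. -/
noncomputable def coord (p : P2) : Fin 2 → ℂ := fun i => p.rep i.castSucc / p.rep 2

lemma coord_pr {v : Fin 3 → ℂ} (hv : v ≠ 0) (i : Fin 2) : coord (pr v) i = v i.castSucc / v 2 := by
  have hrep : pr (pr v).rep = pr v := by
    rw [pr_of_ne (pr v).rep_nonzero, Projectivization.mk_rep]
  obtain ⟨c, hc, hc'⟩ := (pr_eq_iff (pr v).rep_nonzero hv).1 hrep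
  rw [coord, hc']
  simp [mul_div_mul_left _ _ hc]

lemma coord_pt (w : Fin 2 → ℂ) : coord (pt w) = w := by
  ext i
  rw [pt, coord_pr (chart_ne_zero w)]
  fin_cases i <;> simp

lemma pr_eq_pt {v : Fin 3 → ℂ} (h : v 2 ≠ 0) : pr v = pt fun i => v i.castSucc / v 2 := by
  have hv : v ≠ 0 := fun h0 => h (by simp [h0])
  rw [pt, pr_eq_iff hv (chart_ne_zero fun i => v i.castSucc / v 2)]
  refine ⟨v 2, h, ?_⟩
  ext i
  fin_cases i <;> simp [mul_div_cancel₀ _ h]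

lemma pt_coord {p : P2} (hp : p ∉ lineInf) : pt (coord p) = p := by
  obtain ⟨v, hv, rfl⟩ := exists_pr p
  rw [pr_mem_lineInf hv] at hp
  rw [pr_eq_pt hp, coord_pt]

lemma continuousAt_coord {p : P2} (hp : p ∉ lineInf) : ContinuousAt coord p := by
  obtain ⟨v, hv, rfl⟩ := exists_pr p
  rw [pr_mem_lineInf hv] at hp
  obtain ⟨u, hu0, hu, hlim⟩ := exists_tendsto_lift (k := id) hv tendsto_id
  rw [ContinuousAt, tendsto_pi_nhds]
  intro i
  rw [coord_pr hv]
  have h := fun j => (tendsto_pi_nhds.1 hlim) j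
  refine ((h i.castSucc).div (h 2) hp).congr fun m => ?_
  have := hu m
  rw [id] at this
  rw [← this, coord_pr (hu0 _), this]
  rfl

lemma continuous_pt : Continuous pt := by
  rw [continuous_iff_continuousAt]
  intro w
  refine ContinuousAt.comp (f := fun w : Fin 2 → ℂ => ![w 0, w 1, 1])
    (continuousAt_pr (chart_ne_zero w)) (Continuous.continuousAt ?_)
  refine continuous_pi fun i => ?_
  fin_cases i
  · exact continuous_apply 0
  · exact continuous_apply 1
  · exact continuous_const

lemma exists_coord_bound {K : Set P2} (hK : IsCompact K) (h : K ⊆ lineInfᶜ) :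
    ∃ R : ℝ, ∀ p ∈ K, ∀ i, ‖coord p i‖ ≤ R := by
  have hc : ContinuousOn coord K := fun p hp => (continuousAt_coord (h hp)).continuousWithinAt
  obtain ⟨R, hR⟩ := (hK.image_of_continuousOn hc).isBounded.exists_norm_le
  exact ⟨R, fun p hp i => (norm_le_pi_norm _ i).trans (hR _ ⟨p, hp, rfl⟩)⟩

/-! ### Discrete groups of pairs of affine maps -/

namespace Aff2

/-- A pair of affine maps lifts to `SL(3, ℂ)` by dividing its matrix by a cube root of the
determinant. -/
lemma exists_mat_lift (d : Aff2) :
    ∃ (g : SL(3, ℂ)) (c : ℂ), (g : PSL(3, ℂ)) = d.toProj ∧ g.1 = c • d.mat ∧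
      c ^ 3 * (d.a 0 * d.a 1) = 1 := by
  obtain ⟨g, c, hc, hg, hgM⟩ := exists_lift (toGL d)
  refine ⟨g, c, hg, hgM, ?_⟩
  have := g.2
  rw [hgM, coe_toGL, Matrix.det_smul, det_mat] at this
  simpa using this

/-- In a discrete group, only finitely many elements have linear parts, inverse linear parts and
translation parts bounded by `R`. -/
lemma finite_of_bounded {Δ : Subgroup Aff2} (hΔ : DiscreteTopology (Δ.map toProj)) (R : ℝ) :
    {d : Aff2 | d ∈ Δ ∧ ∀ i, ‖(d.a i : ℂ)‖ ≤ R ∧ ‖((d.a i)⁻¹ : ℂ)‖ ≤ R ∧ ‖d.b i‖ ≤ R}.Finite := by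
  refine Set.Finite.of_finite_image ((KulkarniLines.finite_of_bounded hΔ
    ((max R 1) ^ 2 * max R 1)).subset ?_) toProj_injective.injOn
  rintro _ ⟨d, ⟨hd, hR⟩, rfl⟩
  obtain ⟨g, c, hg, hgM, hc⟩ := d.exists_mat_lift
  refine ⟨Subgroup.mem_map_of_mem _ hd, g, hg, fun i j => ?_⟩
  have h1 : (1 : ℝ) ≤ max R 1 := le_max_right _ _
  have hRm : R ≤ max R 1 := le_max_left _ _
  have hcn : ‖c‖ ≤ max R 1 ^ 2 := by
    have h3 : ‖c‖ ^ 3 ≤ (max R 1 ^ 2) := by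
      have : c ^ 3 = ((d.a 0)⁻¹ : ℂ) * ((d.a 1)⁻¹ : ℂ) := by
        have h0 := (d.a 0).ne_zero
        have h1 := (d.a 1).ne_zero
        field_simp
        linear_combination hc
      rw [← norm_pow, this, norm_mul, pow_two]
      exact mul_le_mul ((hR 0).2.1.trans hRm) ((hR 1).2.1.trans hRm) (norm_nonneg _) (by positivity)
    by_contra! hlt
    have h4 : 1 ≤ ‖c‖ := (one_le_pow₀ h1).trans hlt.le
    have h5 : ‖c‖ ≤ ‖c‖ ^ 3 := le_self_pow₀ h4 (by norm_num)
    linarith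
  have hent : ‖d.mat i j‖ ≤ max R 1 := by
    have hb := fun i => (hR i).2.2.trans hRm
    have ha := fun i => (hR i).1.trans hRm
    fin_cases i <;> fin_cases j <;> simp [mat, -le_sup_iff] <;>
      first | exact hb _ | exact ha _ | exact h1 | exact zero_le_one.trans h1
  rw [hgM, Matrix.smul_apply, smul_eq_mul, norm_mul]
  exact mul_le_mul hcn hent (norm_nonneg _) (by positivity)

/-- Limit matrices of a discrete group of pairs of affine maps are upper triangular, with a zero on
the diagonal. -/
lemma exists_of_isLimitMatrix {Δ : Subgroup Aff2} {S : Matrix (Fin 3) (Fin 3) ℂ}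
    (hS : IsLimitMatrix (Δ.map toProj) S) :
    ∃ (d : ℕ → Aff2) (c : ℕ → ℂ) (p r : Fin 2 → ℂ) (w : ℂ), (∀ m, d m ∈ Δ) ∧ (∀ m, c m ≠ 0) ∧
      (∀ i, Tendsto (fun m => c m * (d m).a i) atTop (𝓝 (p i))) ∧
      (∀ i, Tendsto (fun m => c m * (d m).b i) atTop (𝓝 (r i))) ∧ Tendsto c atTop (𝓝 w) ∧
      p 0 * p 1 * w = 0 ∧ (p ≠ 0 ∨ r ≠ 0 ∨ w ≠ 0) ∧
      ∀ v, S *ᵥ v = ![p 0 * v 0 + r 0 * v 2, p 1 * v 1 + r 1 * v 2, w * v 2] := by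
  obtain ⟨hS0, g, e, hg, -, he, he0, hlim⟩ := hS
  choose d hd hdg using hg
  choose g' c hg' hgc hc using fun m => (d m).exists_mat_lift
  -- the two lifts of the same projective transformation differ by a central factor
  have hz : ∀ m, ∃ z : ℂ, z ^ 3 = 1 ∧ (g m).1 = z • (g' m).1 := by
    intro m
    have h : ((g' m : SL(3, ℂ)) : PSL(3, ℂ)) = (g m : PSL(3, ℂ)) := by rw [hg', hdg]
    obtain ⟨r, hr1, hr2⟩ := Matrix.SpecialLinearGroup.mem_center_iff.1 (QuotientGroup.eq.1 h)
    refine ⟨r, by simpa using hr1, ?_⟩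
    have h3 : g m = g' m * ((g' m)⁻¹ * g m) := by simp
    conv_lhs => rw [h3, Matrix.SpecialLinearGroup.coe_mul]
    rw [← hr2]
    ext i j
    simp [Matrix.mul_apply, Matrix.diagonal, mul_comm]
  choose z hz1 hz2 using hz
  have hc0 : ∀ m, c m ≠ 0 := by
    intro m h
    simpa [h] using hc m
  have hz0 : ∀ m, z m ≠ 0 := by
    intro m h
    simpa [h] using hz1 m
  have hlim' : Tendsto (fun m => (e m * z m * c m) • (d m).mat) atTop (𝓝 S) := by
    refine hlim.congr fun m => ?_
    rw [hz2, hgc, smul_smul, smul_smul, mul_assoc]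
  have hent : ∀ i j, Tendsto (fun m => (e m * z m * c m) * (d m).mat i j) atTop (𝓝 (S i j)) :=
    fun i j => (tendsto_pi_nhds.1 ((tendsto_pi_nhds.1 hlim') i)) j
  have hzero : ∀ i j, (∀ m, (d m).mat i j = 0) → S i j = 0 := by
    intro i j h
    have := hent i j
    simp only [h, mul_zero] at this
    exact tendsto_nhds_unique this tendsto_const_nhds
  have h01 : S 0 1 = 0 := hzero _ _ fun m => by simp [mat]
  have h10 : S 1 0 = 0 := hzero _ _ fun m => by simp [mat]
  have h20 : S 2 0 = 0 := hzero _ _ fun m => by simp [mat]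
  have h21 : S 2 1 = 0 := hzero _ _ fun m => by simp [mat]
  refine ⟨d, fun m => e m * z m * c m, ![S 0 0, S 1 1], ![S 0 2, S 1 2], S 2 2, hd,
    fun m => mul_ne_zero (mul_ne_zero (he m) (hz0 m)) (hc0 m), ?_, ?_, ?_, ?_, ?_, ?_⟩
  · intro i
    fin_cases i
    · simpa [mat] using hent 0 0
    · simpa [mat] using hent 1 1
  · intro i
    fin_cases i
    · simpa [mat] using hent 0 2
    · simpa [mat] using hent 1 2
  · simpa [mat] using hent 2 2
  -- the determinants are `e m ^ 3`, which tends to `0`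
  · have hprod := ((hent 0 0).mul (hent 1 1)).mul (hent 2 2)
    have h3 : Tendsto (fun m => e m ^ 3) atTop (𝓝 (0 ^ 3)) := he0.pow 3
    have h4 : ∀ m, (e m * z m * c m) * (d m).mat 0 0 * ((e m * z m * c m) * (d m).mat 1 1) *
        ((e m * z m * c m) * (d m).mat 2 2) = e m ^ 3 := by
      intro m
      simp only [mat, Matrix.of_apply, Matrix.cons_val]
      linear_combination e m ^ 3 * z m ^ 3 * hc m + e m ^ 3 * hz1 m
    simp only [h4] at hprod
    have := tendsto_nhds_unique hprod h3
    simpa using this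
  · by_contra! h
    obtain ⟨h1, h2, h3⟩ := h
    apply hS0
    ext i j
    have e1 := fun i => congrFun h1 i
    have e2 := fun i => congrFun h2 i
    have e10 := e1 0
    have e11 := e1 1
    have e20 := e2 0
    have e21 := e2 1
    fin_cases i <;> fin_cases j <;> simp_all
  · intro v
    ext i
    fin_cases i <;> simp [Matrix.mulVec, dotProduct, Fin.sum_univ_three, h01, h10, h20, h21]

/-! ### Groups whose coordinate actions are isometric or have a fixed point -/

/-- If each coordinate action of `Δ` is isometric (`j ∉ J`) or fixes a point `o j` (`j ∈ J`), the
limit set lies in the line at infinity and the lines `w j = o j`, `j ∈ J`. -/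
lemma limitSet_subset_of_elementary {Δ : Subgroup Aff2} (hΔ : DiscreteTopology (Δ.map toProj))
    (J : Set (Fin 2)) (o : Fin 2 → ℂ) (h1 : ∀ j ∉ J, ∀ d ∈ Δ, ‖(d.a j : ℂ)‖ = 1)
    (h2 : ∀ j ∈ J, ∀ d ∈ Δ, d.a j * o j + d.b j = o j) :
    limitSet (Δ.map toProj) ⊆
      locus fun v => v 2 = 0 ∨ ∃ j ∈ J, v j.castSucc = o j * v 2 := by
  have hP : Homogeneous fun v => v 2 = 0 ∨ ∃ j ∈ J, v j.castSucc = o j * v 2 := by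
    rintro c v hc (h | ⟨j, hj, h⟩)
    · exact Or.inl (by simp [h])
    · exact Or.inr ⟨j, hj, by simp [h]; ring⟩
  refine limitSet_subset_of_kernels hΔ (isClosed_locus hP ?_) ?_ ?_
  · have : {v : Fin 3 → ℂ | v 2 = 0 ∨ ∃ j ∈ J, v j.castSucc = o j * v 2} =
        {v | v 2 = 0} ∪ ⋃ j ∈ J, {v | v j.castSucc = o j * v 2} := by
      ext v
      simp
    rw [this]
    refine (isClosed_eq (continuous_apply _) continuous_const).union ?_
    refine (Set.toFinite J).isClosed_biUnion fun j _ => ?_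
    exact isClosed_eq (continuous_apply _) (continuous_const.mul (continuous_apply _))
  · rintro _ ⟨d, hd, rfl⟩ p hp
    obtain ⟨v, hv, rfl⟩ := exists_pr p
    rw [pr_mem_locus hP hv] at hp
    have hv' : d.mat *ᵥ v ≠ 0 := gl_mulVec_ne_zero (toGL d) hv
    change toProj d • pr v ∈ _
    rw [d.toProj_smul_pr hv, pr_mem_locus hP hv', d.mat_mulVec]
    rcases hp with h | ⟨j, hj, h⟩
    · exact Or.inl (by simpa using h)
    · refine Or.inr ⟨j, hj, ?_⟩
      have := h2 j hj d hd
      fin_cases j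
      · simp only [Fin.zero_eta, Fin.castSucc_zero, cons_val] at h this ⊢
        rw [h]; linear_combination v 2 * this
      · simp only [Fin.mk_one, Fin.castSucc_one, cons_val] at h this ⊢
        rw [h]; linear_combination v 2 * this
  · intro S hS v hv hSv
    rw [pr_mem_locus hP hv]
    obtain ⟨d, c, p, r, w, hd, -, hp, hr, hw, hprod, hne, hform⟩ := exists_of_isLimitMatrix hS
    by_contra! hcon
    obtain ⟨hv2, hvj⟩ := hcon
    rw [hform] at hSv
    have hcoord : ∀ j : Fin 2, p j * v j.castSucc + r j * v 2 = 0 := by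
      intro j
      fin_cases j
      · simpa using congrFun hSv 0
      · simpa using congrFun hSv 1
    have hw0 : w = 0 := by simpa [hv2] using congrFun hSv 2
    -- `p j` has the norm of `w` for `j ∉ J`, and the fixed point gives `p j = 0` for `j ∈ J`
    have key : ∀ j, p j = 0 ∧ r j = 0 := by
      intro j
      have hpj : p j = 0 := by
        by_cases hj : j ∈ J
        · have hrel : r j = (w - p j) * o j := by
            refine tendsto_nhds_unique (hr j) (((hw.sub (hp j)).mul_const (o j)).congr fun m => ?_)
            linear_combination -c m * h2 j hj (d m) (hd m)
          have h3 : p j * (v j.castSucc - o j * v 2) = 0 := by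
            have := hcoord j
            rw [hrel, hw0] at this
            linear_combination this
          exact (mul_eq_zero.1 h3).resolve_right (sub_ne_zero.2 (hvj j hj))
        · have hn : ‖p j‖ = ‖w‖ := by
            refine tendsto_nhds_unique (hp j).norm (hw.norm.congr fun m => ?_)
            rw [norm_mul, h1 j hj _ (hd m), mul_one]
          rw [← norm_eq_zero, hn, hw0, norm_zero]
      refine ⟨hpj, ?_⟩
      have := hcoord j
      rw [hpj, zero_mul, zero_add] at this
      exact (mul_eq_zero.1 this).resolve_right hv2
    rcases hne with h | h | h
    · exact h (funext fun j => (key j).1)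
    · exact h (funext fun j => (key j).2)
    · exact h hw0

/-- The limit set of `Δ` contains two parallel lines `w j = c`. -/
def HasParallelLines (Δ : Subgroup Aff2) (j : Fin 2) : Prop :=
  ∃ c₁ c₂ : ℂ, c₁ ≠ c₂ ∧ ∀ w : Fin 2 → ℂ, w j = c₁ ∨ w j = c₂ → pt w ∈ limitSet (Δ.map toProj)

/-- If the limit set contains two parallel lines, then in some coordinate the action is neither
isometric nor has a common fixed point. -/
lemma exists_nonelementary {Δ : Subgroup Aff2} (hΔ : DiscreteTopology (Δ.map toProj)) {j : Fin 2}
    (hl : HasParallelLines Δ j) :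
    ∃ i, (∃ d ∈ Δ, ‖(d.a i : ℂ)‖ ≠ 1) ∧ ∀ o : ℂ, ∃ d ∈ Δ, d.a i * o + d.b i ≠ o := by
  by_contra! hcon
  have hex : ∀ i, ∃ o : ℂ, (∀ d ∈ Δ, ‖(d.a i : ℂ)‖ = 1) ∨ ∀ d ∈ Δ, d.a i * o + d.b i = o := by
    intro i
    by_cases h : ∀ d ∈ Δ, ‖(d.a i : ℂ)‖ = 1
    · exact ⟨0, Or.inl h⟩
    · push Not at h
      obtain ⟨o, ho⟩ := hcon i h
      exact ⟨o, Or.inr ho⟩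
  choose o ho using hex
  have hsub := limitSet_subset_of_elementary hΔ
    {i | ∀ d ∈ Δ, d.a i * o i + d.b i = o i} o (fun i hi => (ho i).resolve_right hi)
    (fun i hi => hi)
  obtain ⟨c₁, c₂, hc, hw⟩ := hl
  obtain ⟨c, hco, hcw⟩ : ∃ c, c ≠ o j ∧ ∀ w : Fin 2 → ℂ, w j = c → pt w ∈ limitSet _ := by
    by_cases h : c₁ = o j
    · exact ⟨c₂, fun h' => hc (h.trans h'.symm), fun w h => hw w (Or.inr h)⟩
    · exact ⟨c₁, h, fun w h => hw w (Or.inl h)⟩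
  -- a point of the limit line `w j = c` off the lines `w i = o i`
  have hmem := hsub (hcw (fun i => if i = j then c else o i + 1) (by simp))
  have hm := hmem _ (chart_ne_zero fun i => if i = j then c else o i + 1) rfl
  simp only [cons_val, one_ne_zero, false_or, mul_one] at hm
  obtain ⟨i, -, hi⟩ := hm
  have hval : (if i = j then c else o i + 1) = o i := by
    fin_cases i
    · simpa using hi
    · simpa using hi
  split_ifs at hval with h
  · exact hco (h ▸ hval)
  · simp at hval

/-! ### The translation lattice -/

/-- The translation vectors of `Δ`. -/
def trans (Δ : Subgroup Aff2) : Submodule ℤ (Fin 2 → ℂ) :=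
  AddSubgroup.toIntSubmodule
    { carrier := {τ | (⟨1, τ⟩ : Aff2) ∈ Δ}
      zero_mem' := Δ.one_mem
      add_mem' := by
        intro τ σ hτ hσ
        have h : (⟨1, τ⟩ * ⟨1, σ⟩ : Aff2) = ⟨1, τ + σ⟩ := by ext i <;> simp [add_comm]
        exact (congrArg (· ∈ Δ) h).mp (Δ.mul_mem hτ hσ)
      neg_mem' := by
        intro τ hτ
        have h : (⟨1, τ⟩⁻¹ : Aff2) = ⟨1, -τ⟩ := by ext i <;> simp
        exact (congrArg (· ∈ Δ) h).mp (Δ.inv_mem hτ) }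

lemma mem_trans {Δ : Subgroup Aff2} {τ : Fin 2 → ℂ} : τ ∈ trans Δ ↔ (⟨1, τ⟩ : Aff2) ∈ Δ := Iff.rfl

/-- Conjugating a translation by `d` multiplies its vector by the linear part of `d`. -/
lemma mul_mem_trans {Δ : Subgroup Aff2} {d : Aff2} (hd : d ∈ Δ) {τ : Fin 2 → ℂ}
    (hτ : τ ∈ trans Δ) : (fun i => d.a i * τ i) ∈ trans Δ := by
  rw [mem_trans] at hτ ⊢
  have := Δ.mul_mem (Δ.mul_mem hd hτ) (Δ.inv_mem hd)
  convert this using 1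
  ext i <;> simp

lemma pow_mul_mem_trans {Δ : Subgroup Aff2} {d : Aff2} (hd : d ∈ Δ) {τ : Fin 2 → ℂ}
    (hτ : τ ∈ trans Δ) (n : ℕ) : (fun i => (d.a i : ℂ) ^ n * τ i) ∈ trans Δ := by
  have hp : (d ^ n).a = d.a ^ n := by
    induction n with
    | zero => rfl
    | succ n ih => rw [pow_succ, pow_succ, mul_a, ih]
  simpa [hp] using mul_mem_trans (Δ.pow_mem hd n) hτ

lemma finite_trans {Δ : Subgroup Aff2} (hΔ : DiscreteTopology (Δ.map toProj)) (R : ℝ) :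
    {τ : Fin 2 → ℂ | τ ∈ trans Δ ∧ ∀ i, ‖τ i‖ ≤ R}.Finite := by
  refine Set.Finite.of_finite_image (f := fun τ => (⟨1, τ⟩ : Aff2))
    ((finite_of_bounded hΔ (max R 1)).subset ?_) (fun τ _ σ _ h => congrArg Aff2.b h)
  rintro _ ⟨τ, ⟨hτ, hR⟩, rfl⟩
  refine ⟨hτ, fun i => ?_⟩
  have := (hR i).trans (le_max_left R 1)
  simpa [-le_sup_iff, le_max_right] using this

/-- A discrete group cannot contract a translation vector. -/
lemma no_contraction {Δ : Subgroup Aff2} (hΔ : DiscreteTopology (Δ.map toProj)) {d : Aff2}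
    (hd : d ∈ Δ) {τ : Fin 2 → ℂ} (hτ : τ ∈ trans Δ) {j : Fin 2} (hj : τ j ≠ 0)
    (hlt : ‖(d.a j : ℂ)‖ < 1) (hle : ∀ i, ‖(d.a i : ℂ)‖ ≤ 1 ∨ τ i = 0) : False := by
  refine Set.infinite_of_injective_forall_mem (f := fun n : ℕ => fun i => (d.a i : ℂ) ^ n * τ i)
    ?_ ?_ (finite_trans hΔ ‖τ‖)
  · intro m n hmn
    have h := congrArg norm (mul_right_cancel₀ hj (congrFun hmn j))
    rw [norm_pow, norm_pow] at h
    exact (pow_right_strictAnti₀ (norm_pos_iff.2 (d.a j).ne_zero) hlt).injective h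
  · intro n
    refine ⟨pow_mul_mem_trans hd hτ n, fun i => ?_⟩
    rw [norm_mul, norm_pow]
    rcases hle i with h | h
    · exact (mul_le_of_le_one_left (norm_nonneg _) (pow_le_one₀ (norm_nonneg _) h)).trans
        (norm_le_pi_norm τ i)
    · simp [h]

/-- The translation lattice of `Δ` is nonzero and meets the coordinate axes only in `0`, and `Δ`
contains an element expanding the first coordinate and contracting the second. -/
structure IsHyperbolic (Δ : Subgroup Aff2) : Prop where
  exists_trans : ∃ τ ∈ trans Δ, τ ≠ 0
  ne_zero : ∀ τ ∈ trans Δ, τ ≠ 0 → ∀ i, τ i ≠ 0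
  exists_expand : ∃ d ∈ Δ, 1 < ‖(d.a 0 : ℂ)‖ ∧ ‖(d.a 1 : ℂ)‖ < 1

lemma norm_inv_a (d : Aff2) (i : Fin 2) : ‖((d⁻¹).a i : ℂ)‖ = ‖(d.a i : ℂ)‖⁻¹ := by simp

/-- A discrete group whose limit set contains two parallel lines is hyperbolic: a commutator gives a
translation, which discreteness forbids to be contracted. -/
lemma isHyperbolic_of_hasParallelLines {Δ : Subgroup Aff2}
    (hΔ : DiscreteTopology (Δ.map toProj)) {j : Fin 2} (hl : HasParallelLines Δ j) :
    IsHyperbolic Δ := by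
  obtain ⟨j, ⟨d, hd, hdj⟩, hfix⟩ := exists_nonelementary hΔ hl
  obtain ⟨d, hd, hlt⟩ : ∃ d ∈ Δ, ‖(d.a j : ℂ)‖ < 1 := by
    rcases lt_or_gt_of_ne hdj with h | h
    · exact ⟨d, hd, h⟩
    · exact ⟨d⁻¹, inv_mem hd, by rw [norm_inv_a]; exact inv_lt_one_of_one_lt₀ h⟩
  have hne1 : 1 - (d.a j : ℂ) ≠ 0 := by
    intro h
    rw [← sub_eq_zero.1 h] at hlt
    simp at hlt
  obtain ⟨e, he, heo⟩ := hfix (d.b j / (1 - d.a j))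
  -- the commutator of `d` with an element moving the fixed point of `d`
  have hτ : (fun i => (d * e * d⁻¹ * e⁻¹).b i) ∈ trans Δ := by
    have h := Δ.mul_mem (Δ.mul_mem (Δ.mul_mem hd he) (Δ.inv_mem hd)) (Δ.inv_mem he)
    rw [mem_trans]
    convert h using 1
    ext i
    · simp
    · rfl
  have hτj : (d * e * d⁻¹ * e⁻¹).b j ≠ 0 := by
    intro h
    apply heo
    have hdj := (d.a j).ne_zero
    have hej := (e.a j).ne_zero
    simp only [mul_b, mul_a, Pi.mul_apply, Units.val_mul, inv_a, Pi.inv_apply, inv_b,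
      Units.val_inv_eq_inv_val] at h
    field_simp at h ⊢
    linear_combination -h
  set τ : Fin 2 → ℂ := fun i => (d * e * d⁻¹ * e⁻¹).b i with hτdef
  -- `d` contracts the coordinate `j`, so it expands the other one
  obtain ⟨i, hi⟩ : ∃ i, 1 < ‖(d.a i : ℂ)‖ := by
    by_contra! h
    exact no_contraction hΔ hd hτ hτj hlt fun i => Or.inl (h i)
  have hij : ∀ k, k = i ∨ k = j := by
    have : i ≠ j := by
      rintro rfl
      exact absurd hlt hi.not_gt
    intro k
    omega
  refine ⟨⟨τ, hτ, fun h => hτj (congrFun h j)⟩, fun σ hσ hσ0 => ?_, ?_⟩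
  · have hall : σ i ≠ 0 ∧ σ j ≠ 0 := by
      constructor
      · intro h
        have hj : σ j ≠ 0 := by
          intro h'
          refine hσ0 (funext fun k => ?_)
          rcases hij k with rfl | rfl <;> assumption
        refine no_contraction hΔ hd hσ hj hlt fun k => ?_
        rcases hij k with rfl | rfl
        · exact Or.inr h
        · exact Or.inl hlt.le
      · intro h
        have hi' : σ i ≠ 0 := by
          intro h'
          refine hσ0 (funext fun k => ?_)
          rcases hij k with rfl | rfl <;> assumption
        have hlt' : ‖((d⁻¹).a i : ℂ)‖ < 1 := by
          rw [norm_inv_a]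
          exact inv_lt_one_of_one_lt₀ hi
        refine no_contraction hΔ (inv_mem hd) hσ hi' hlt' fun k => ?_
        rcases hij k with rfl | rfl
        · exact Or.inl hlt'.le
        · exact Or.inr h
    intro k
    rcases hij k with rfl | rfl
    · exact hall.1
    · exact hall.2
  · rcases hij 0 with h0 | h0
    · have h1 : 1 = j := (hij 1).resolve_left (by rw [← h0]; decide)
      exact ⟨d, hd, h0 ▸ hi, h1 ▸ hlt⟩
    · have h1 : 1 = i := (hij 1).resolve_right (by rw [← h0]; decide)
      refine ⟨d⁻¹, inv_mem hd, ?_, ?_⟩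
      · rw [norm_inv_a, h0]
        exact (one_lt_inv₀ (norm_pos_iff.2 (d.a j).ne_zero)).2 hlt
      · rw [norm_inv_a, h1]
        exact inv_lt_one_of_one_lt₀ hi

/-! ### The real span of the translation lattice -/

lemma pow_app_fixed {d : Aff2} {o : Fin 2 → ℂ} (h : d.app o = o) (n : ℕ) :
    (d ^ n).app o = o := by
  have happ : ∀ e f : Aff2, (e * f).app o = e.app (f.app o) := by
    intro e f
    ext i
    simp [app]
    ring
  induction n with
  | zero => ext i; simp [app]
  | succ n ih => rw [pow_succ, happ, h, ih]

lemma pow_a (d : Aff2) (n : ℕ) : (d ^ n).a = d.a ^ n := by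
  induction n with
  | zero => rfl
  | succ n ih => rw [pow_succ, pow_succ, mul_a, ih]

lemma zpow_a (d : Aff2) (n : ℤ) : (d ^ n).a = d.a ^ n := by
  cases n with
  | ofNat n => simpa using pow_a d n
  | negSucc n => rw [zpow_negSucc, zpow_negSucc, inv_a, pow_a]

/-- Translation vectors are isolated, as bounded sets contain finitely many of them. -/
lemma discreteTopology_trans {Δ : Subgroup Aff2} (hΔ : DiscreteTopology (Δ.map toProj)) :
    DiscreteTopology (trans Δ) := by
  have hfin := finite_trans hΔ 1
  have h0 : ∀ᶠ x in 𝓝 (0 : Fin 2 → ℂ), x ∈ trans Δ → x = 0 := by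
    have h1 : ∀ᶠ x in 𝓝 (0 : Fin 2 → ℂ),
        x ∉ {τ : Fin 2 → ℂ | τ ∈ trans Δ ∧ ∀ i, ‖τ i‖ ≤ 1} \ {0} :=
      (hfin.subset Set.sdiff_subset).isClosed.isOpen_compl.mem_nhds (by simp)
    filter_upwards [h1, Metric.closedBall_mem_nhds (0 : Fin 2 → ℂ) one_pos] with x hx hx1 hxT
    by_contra hx0
    refine hx ⟨⟨hxT, fun i => ?_⟩, hx0⟩
    exact (norm_le_pi_norm x i).trans (mem_closedBall_zero_iff.1 hx1)
  refine discreteTopology_of_isOpen_singleton_zero ?_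
  obtain ⟨U, hU, hUo, hU0⟩ := eventually_nhds_iff.1 h0
  refine ⟨U, hUo, ?_⟩
  ext x
  constructor
  · intro hx
    exact Subtype.ext (hU x.1 hx x.2)
  · rintro rfl
    exact hU0

/-- Some power of an element of `Δ` fixes a given translation vector modulo `n` times the lattice,
since the lattice has finitely many classes modulo `n`. -/
lemma exists_pow_fixed_mod {Δ : Subgroup Aff2} (hΔ : DiscreteTopology (Δ.map toProj)) {d : Aff2}
    (hd : d ∈ Δ) {τ : Fin 2 → ℂ} (hτ : τ ∈ trans Δ) {n : ℕ} (hn : n ≠ 0) :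
    ∃ m : ℕ, m ≠ 0 ∧ ∃ σ ∈ trans Δ, ∀ i, (d.a i : ℂ) ^ m * τ i = τ i + n * σ i := by
  have := discreteTopology_trans hΔ
  have hfg : Module.Finite ℤ (trans Δ) := inferInstance
  let N : Submodule ℤ (trans Δ) :=
    LinearMap.range ((n : ℤ) • (LinearMap.id : trans Δ →ₗ[ℤ] trans Δ))
  have htor : Module.IsTorsion ℤ (trans Δ ⧸ N) := by
    intro x
    obtain ⟨y, rfl⟩ := Submodule.Quotient.mk_surjective _ x
    refine ⟨⟨n, mem_nonZeroDivisors_of_ne_zero (by exact_mod_cast hn)⟩, ?_⟩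
    change (n : ℤ) • N.mkQ y = 0
    rw [← map_smul, Submodule.mkQ_apply, Submodule.Quotient.mk_eq_zero]
    exact ⟨y, rfl⟩
  have hfin : Finite (trans Δ ⧸ N) := Module.finite_of_fg_torsion _ htor
  -- two powers of `d` agree on `τ` modulo `N`
  let f : ℕ → trans Δ ⧸ N := fun k =>
    Submodule.Quotient.mk ⟨fun i => (d.a i : ℂ) ^ k * τ i, pow_mul_mem_trans hd hτ k⟩
  obtain ⟨k, l, hkl, hf⟩ : ∃ k l, k < l ∧ f k = f l := by
    obtain ⟨k, l, hne, hf⟩ := Finite.exists_ne_map_eq_of_infinite f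
    rcases lt_or_gt_of_ne hne with h | h
    · exact ⟨k, l, h, hf⟩
    · exact ⟨l, k, h, hf.symm⟩
  obtain ⟨σ, hσ⟩ := (Submodule.Quotient.eq N).1 hf.symm
  have hσ' : ∀ i, (n : ℂ) * σ.1 i = (d.a i : ℂ) ^ l * τ i - (d.a i : ℂ) ^ k * τ i := by
    intro i
    have := congrFun (congrArg Subtype.val hσ) i
    simpa using this
  refine ⟨l - k, by omega, _, pow_mul_mem_trans (inv_mem hd) σ.2 k, fun i => ?_⟩
  have ha := (d.a i).ne_zero
  have hl : (d.a i : ℂ) ^ l = (d.a i : ℂ) ^ (l - k) * (d.a i : ℂ) ^ k := by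
    rw [← pow_add]; congr 1; omega
  have h := hσ' i
  rw [hl] at h
  have hak : (d.a i : ℂ) ^ k ≠ 0 := pow_ne_zero _ ha
  simp only [inv_a, Pi.inv_apply, Units.val_inv_eq_inv_val, inv_pow]
  field_simp
  linear_combination -h

/-- The real span of the translation vectors. -/
noncomputable def realSpan (Δ : Subgroup Aff2) : Submodule ℝ (Fin 2 → ℂ) :=
  Submodule.span ℝ (trans Δ : Set (Fin 2 → ℂ))

lemma mul_mem_realSpan {Δ : Subgroup Aff2} {d : Aff2} (hd : d ∈ Δ) {w : Fin 2 → ℂ}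
    (hw : w ∈ realSpan Δ) : (fun i => d.a i * w i) ∈ realSpan Δ := by
  induction hw using Submodule.span_induction with
  | mem x hx => exact Submodule.subset_span (mul_mem_trans hd hx)
  | zero => simp only [Pi.zero_apply, mul_zero]; exact (realSpan Δ).zero_mem
  | add x y _ _ hx hy =>
    convert (realSpan Δ).add_mem hx hy using 1
    ext i; simp [mul_add]
  | smul r x _ hx =>
    convert (realSpan Δ).smul_mem r hx using 1
    ext i; simp; ring

lemma pow_injective_of_norm_ne_one {d : Aff2} {j : Fin 2} (hd : ‖(d.a j : ℂ)‖ ≠ 1) :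
    Function.Injective fun n : ℕ => d ^ n := by
  intro m n hmn
  have h : ‖(d.a j : ℂ)‖ ^ m = ‖(d.a j : ℂ)‖ ^ n := by
    have := congrArg (fun e : Aff2 => ‖(e.a j : ℂ)‖) hmn
    simpa [pow_a] using this
  exact pow_right_injective₀ (norm_pos_iff.2 (d.a j).ne_zero) hd h

/-- Translations fix every point at infinity. -/
lemma lineInf_subset_L0 {Δ : Subgroup Aff2} {τ : Fin 2 → ℂ} (hτ : τ ∈ trans Δ) (h0 : τ ≠ 0) :
    lineInf ⊆ L0 (Δ.map toProj) := by
  intro p hp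
  refine subset_closure ?_
  have hmem : ∀ n : ℕ, (⟨1, (n : ℤ) • τ⟩ : Aff2) ∈ Δ := fun n => (trans Δ).smul_mem (n : ℤ) hτ
  refine Set.infinite_of_injective_forall_mem (f := fun n : ℕ => toProj ⟨1, (n : ℤ) • τ⟩)
    (fun m n hmn => ?_) fun n => ⟨Subgroup.mem_map_of_mem _ (hmem n), ?_⟩
  · have := congrArg Aff2.b (toProj_injective hmn)
    simpa using smul_left_injective ℤ h0 this
  · obtain ⟨v, hv, rfl⟩ := exists_pr p
    rw [pr_mem_lineInf hv] at hp
    rw [toProj_smul_pr _ hv, mat_mulVec]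
    congr 1
    ext i
    fin_cases i <;> simp [hp]

/-- The points `o + w`, with `o` the fixed point of a hyperbolic element and `w` in the real span of
the lattice, lie in `L0`: for rational `w` they are fixed by an element of infinite order. -/
lemma add_realSpan_mem_L0 {Δ : Subgroup Aff2} (hΔ : DiscreteTopology (Δ.map toProj)) {d : Aff2}
    (hd : d ∈ Δ) {j : Fin 2} (hdj : ‖(d.a j : ℂ)‖ ≠ 1) {o : Fin 2 → ℂ} (ho : d.app o = o)
    {w : Fin 2 → ℂ} (hw : w ∈ realSpan Δ) : pt (o + w) ∈ L0 (Δ.map toProj) := by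
  -- the rational span of the lattice, which is dense in the real span
  let D : AddSubgroup (Fin 2 → ℂ) :=
    { carrier := {x | ∃ n : ℕ, n ≠ 0 ∧ (n : ℤ) • x ∈ trans Δ}
      zero_mem' := ⟨1, one_ne_zero, by simp⟩
      add_mem' := by
        rintro x y ⟨m, hm, hx⟩ ⟨n, hn, hy⟩
        refine ⟨m * n, mul_ne_zero hm hn, ?_⟩
        have := add_mem ((trans Δ).smul_mem (n : ℤ) hx) ((trans Δ).smul_mem (m : ℤ) hy)
        convert this using 1
        rw [smul_smul, smul_smul, smul_add]
        push_cast
        rw [mul_comm (m : ℤ)]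
      neg_mem' := by
        rintro x ⟨m, hm, hx⟩
        exact ⟨m, hm, by simpa using neg_mem hx⟩ }
  have hD : ∀ x ∈ D, pt (o + x) ∈ L0 (Δ.map toProj) := by
    rintro x ⟨n, hn, hx⟩
    obtain ⟨m, hm, σ, hσ, hmσ⟩ := exists_pow_fixed_mod hΔ hd hx hn
    -- `d ^ m` moves `o + x` by the lattice vector `σ`, which a translation undoes
    have he : (⟨1, -σ⟩ * d ^ m : Aff2) ∈ Δ := mul_mem ((trans Δ).neg_mem hσ) (pow_mem hd m)
    set e : Aff2 := ⟨1, -σ⟩ * d ^ m with hedef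
    have hea : e.a = d.a ^ m := by simp [hedef, pow_a]
    have hfix : e.app (o + x) = o + x := by
      have h1 := pow_app_fixed ho m
      ext i
      have h2 := congrFun h1 i
      have h3 := hmσ i
      have hn' : (n : ℂ) ≠ 0 := by exact_mod_cast hn
      simp only [app, pow_a, Pi.pow_apply, Units.val_pow_eq_pow_val] at h2
      simp only [zsmul_eq_mul, Pi.mul_apply, Int.cast_natCast] at h3
      have h4 : (d.a i : ℂ) ^ m * x i = x i + σ i := by
        refine mul_left_cancel₀ hn' ?_
        linear_combination h3
      simp only [app, hea, Pi.pow_apply, Units.val_pow_eq_pow_val, Pi.add_apply]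
      simp only [hedef, mul_b, Pi.one_apply, Units.val_one, Pi.neg_apply]
      linear_combination h2 + h4
    have hfixn : ∀ k : ℕ, (e ^ k).app (o + x) = o + x := pow_app_fixed hfix
    have hne : ‖(e.a j : ℂ)‖ ≠ 1 := by
      rw [hea]
      simp only [Pi.pow_apply, Units.val_pow_eq_pow_val, norm_pow]
      intro h
      exact hdj ((pow_eq_one_iff_of_nonneg (norm_nonneg _) hm).1 h)
    refine subset_closure (Set.infinite_of_injective_forall_mem
      (f := fun k : ℕ => toProj (e ^ k))
      (toProj_injective.comp (pow_injective_of_norm_ne_one hne))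
      fun k => ⟨Subgroup.mem_map_of_mem _ (pow_mem he k), ?_⟩)
    rw [toProj_smul_pt, hfixn]
  have hclosed : IsClosed {x : Fin 2 → ℂ | pt (o + x) ∈ L0 (Δ.map toProj)} :=
    isClosed_closure.preimage (continuous_pt.comp (continuous_const.add continuous_id))
  have hDc : closure (D : Set (Fin 2 → ℂ)) ⊆ {x | pt (o + x) ∈ L0 (Δ.map toProj)} :=
    closure_minimal hD hclosed
  apply hDc
  change w ∈ D.topologicalClosure
  have hsmul : ∀ (r : ℝ), ∀ x ∈ D.topologicalClosure, r • x ∈ D.topologicalClosure := by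
    intro r x hx
    have h1 : IsClosed {y : Fin 2 → ℂ | r • y ∈ D.topologicalClosure} :=
      D.isClosed_topologicalClosure.preimage (continuous_const_smul r)
    refine closure_minimal (s := (D : Set (Fin 2 → ℂ))) (fun y hy => ?_) h1 hx
    refine Rat.denseRange_cast.induction_on (p := fun r : ℝ => r • y ∈ D.topologicalClosure) r
      (D.isClosed_topologicalClosure.preimage (continuous_id.smul continuous_const)) fun q => ?_
    apply D.le_topologicalClosure
    obtain ⟨n, hn, hy⟩ := hy
    refine ⟨n * q.den, mul_ne_zero hn q.den_nz, ?_⟩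
    have := (trans Δ).smul_mem q.num hy
    convert this using 1
    ext i
    have hq : (q : ℂ) * q.den = q.num := by exact_mod_cast Rat.mul_den_eq_num q
    simp only [Nat.cast_mul, zsmul_eq_mul, Int.cast_mul, Int.cast_natCast, Pi.mul_apply,
      Pi.smul_apply, Complex.real_smul, Complex.ofReal_ratCast, Pi.natCast_apply]
    linear_combination n * y i * hq
  induction hw using Submodule.span_induction with
  | mem x hx => exact D.le_topologicalClosure ⟨1, one_ne_zero, by simpa using hx⟩
  | zero => exact zero_mem _
  | add x y _ _ hx hy => exact add_mem hx hy
  | smul r x _ hx => exact hsmul r x hx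

/-- The vectors in one coordinate direction which lie in the real span. -/
noncomputable def axisSpan (Δ : Subgroup Aff2) (i : Fin 2) : Submodule ℝ ℂ :=
  (realSpan Δ).comap (LinearMap.single ℝ (fun _ : Fin 2 => ℂ) i)

/-- The real span of the lattice of a hyperbolic group is the product of its coordinate parts, as
the linear part of a hyperbolic element has no eigenvalue in common, nor conjugate, on the two
axes. -/
lemma apply_mem_axisSpan {Δ : Subgroup Aff2} {d : Aff2} (hd : d ∈ Δ) {i j : Fin 2} (hij : i ≠ j)
    (hne : ‖(d.a i : ℂ)‖ ≠ ‖(d.a j : ℂ)‖) {w : Fin 2 → ℂ} (hw : w ∈ realSpan Δ) :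
    w i ∈ axisSpan Δ i := by
  set α : ℂ := (d.a i : ℂ) with hα
  set β : ℂ := (d.a j : ℂ) with hβ
  -- `α` differs from `β` and its conjugate, having another norm
  have hc : (α - β) * (α - (starRingEnd ℂ) β) ≠ 0 := by
    refine mul_ne_zero (sub_ne_zero.2 fun h => hne (by rw [h])) (sub_ne_zero.2 fun h => hne ?_)
    rw [h, RCLike.norm_conj]
  -- apply the real polynomial with roots `β` and its conjugate to the linear part
  have hpoly : ∀ x ∈ realSpan Δ,
      ((α - β) * (α - (starRingEnd ℂ) β)) * x i ∈ axisSpan Δ i := by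
    intro x hx
    have h1 := mul_mem_realSpan hd hx
    have h2 := mul_mem_realSpan hd h1
    have h3 := add_mem (sub_mem h2 ((realSpan Δ).smul_mem (2 * β.re) h1))
      ((realSpan Δ).smul_mem (Complex.normSq β) hx)
    change LinearMap.single ℝ (fun _ : Fin 2 => ℂ) i _ ∈ realSpan Δ
    convert h3 using 1
    have hsum : β + (starRingEnd ℂ) β = (2 * β.re : ℝ) := Complex.add_conj β
    have hprod : β * (starRingEnd ℂ) β = (Complex.normSq β : ℝ) := Complex.mul_conj β
    have hall : ∀ k, k = i ∨ k = j := by omega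
    ext k
    rcases hall k with rfl | rfl
    · simp only [LinearMap.single_apply, Pi.single_eq_same, Pi.add_apply, Pi.sub_apply,
        Pi.smul_apply, Complex.real_smul, ← hα]
      linear_combination (-α * x k) * hsum + x k * hprod
    · simp only [LinearMap.single_apply, Pi.add_apply, Pi.sub_apply, Pi.smul_apply,
        Complex.real_smul, ← hβ, Pi.single_eq_of_ne hij.symm]
      linear_combination (-β * x k) * hsum + x k * hprod
  -- the projection of the span contains `axisSpan` and embeds in it by a multiplication
  let X : Submodule ℝ ℂ := (realSpan Δ).map (LinearMap.proj i)
  have hle : axisSpan Δ i ≤ X := by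
    intro z hz
    exact ⟨_, hz, by simp⟩
  let f : ℂ →ₗ[ℝ] ℂ := LinearMap.mulLeft ℝ ((α - β) * (α - (starRingEnd ℂ) β))
  have hf : Function.Injective f := fun x y h => mul_left_cancel₀ hc h
  have hXf : X.map f ≤ axisSpan Δ i := by
    rintro _ ⟨_, ⟨x, hx, rfl⟩, rfl⟩
    exact hpoly x hx
  have hrank : Module.finrank ℝ X ≤ Module.finrank ℝ (axisSpan Δ i) := by
    rw [(Submodule.equivMapOfInjective f hf X).finrank_eq]
    exact Submodule.finrank_mono hXf
  rw [Submodule.eq_of_le_of_finrank_le hle hrank]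
  exact ⟨w, hw, rfl⟩

/-! ### The lattice of a group with parallel limit lines in both directions -/

lemma exists_fixed {d : Aff2} (h : ∀ i, (d.a i : ℂ) ≠ 1) : ∃ o, d.app o = o := by
  refine ⟨fun i => d.b i / (1 - d.a i), funext fun i => ?_⟩
  have : 1 - (d.a i : ℂ) ≠ 0 := sub_ne_zero.2 (h i).symm
  simp only [app]
  field_simp
  ring

/-- A hyperbolic group contains an element with fixed point whose linear part has norms distinct
from `1` and from each other. -/
lemma IsHyperbolic.exists_norm {Δ : Subgroup Aff2} (h : IsHyperbolic Δ) :
    ∃ d ∈ Δ, (∀ i, ‖(d.a i : ℂ)‖ ≠ 1) ∧ (∀ i j, i ≠ j → ‖(d.a i : ℂ)‖ ≠ ‖(d.a j : ℂ)‖) ∧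
      ∃ o, d.app o = o := by
  obtain ⟨d, hd, h0, h1⟩ := h.exists_expand
  have hn : ∀ i, ‖(d.a i : ℂ)‖ ≠ 1 := by
    intro i
    fin_cases i
    · exact h0.ne'
    · exact h1.ne
  refine ⟨d, hd, hn, fun i j hij => ?_, exists_fixed fun i hi => hn i (by rw [hi, norm_one])⟩
  fin_cases i <;> fin_cases j
  · exact absurd rfl hij
  · exact (h1.trans h0).ne'
  · exact (h1.trans h0).ne
  · exact absurd rfl hij

/-- The real span of the lattice is the product of its intersections with the axes. -/
lemma IsHyperbolic.mem_realSpan_iff {Δ : Subgroup Aff2} (h : IsHyperbolic Δ) {w : Fin 2 → ℂ} :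
    w ∈ realSpan Δ ↔ ∀ i, w i ∈ axisSpan Δ i := by
  obtain ⟨d, hd, -, hne, -⟩ := h.exists_norm
  constructor
  · intro hw i
    fin_cases i
    · exact apply_mem_axisSpan hd zero_ne_one (hne 0 1 zero_ne_one) hw
    · exact apply_mem_axisSpan hd one_ne_zero (hne 1 0 one_ne_zero) hw
  · intro hw
    have h0 : LinearMap.single ℝ (fun _ : Fin 2 => ℂ) 0 (w 0) ∈ realSpan Δ := hw 0
    have h1 : LinearMap.single ℝ (fun _ : Fin 2 => ℂ) 1 (w 1) ∈ realSpan Δ := hw 1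
    convert add_mem h0 h1 using 1
    ext i
    fin_cases i <;> simp

/-- A nonzero real subspace of `ℂ` is `ℂ` or a real line. -/
lemma real_subspace_eq {S : Submodule ℝ ℂ} (hS : S ≠ ⊥) :
    S = ⊤ ∨ ∃ u : ℂ, u ≠ 0 ∧ ∀ z, z ∈ S ↔ ∃ r : ℝ, z = r * u := by
  have h2 : Module.finrank ℝ ℂ = 2 := Complex.finrank_real_complex
  have hle : Module.finrank ℝ S ≤ 2 := h2 ▸ S.finrank_le
  have hpos : Module.finrank ℝ S ≠ 0 := fun h => hS (Submodule.finrank_eq_zero.1 h)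
  rcases (by omega : Module.finrank ℝ S = 2 ∨ Module.finrank ℝ S = 1) with h | h
  · exact Or.inl (Submodule.eq_top_of_finrank_eq (h.trans h2.symm))
  · right
    obtain ⟨u, hu, hspan⟩ := finrank_eq_one_iff'.1 h
    refine ⟨u, fun h => hu (Subtype.ext h), fun z => ⟨fun hz => ?_, ?_⟩⟩
    · obtain ⟨r, hr⟩ := hspan ⟨z, hz⟩
      exact ⟨r, by rw [← Complex.real_smul]; exact (congrArg Subtype.val hr).symm⟩
    · rintro ⟨r, rfl⟩
      rw [← Complex.real_smul]
      exact S.smul_mem r u.2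

/-- In a hyperbolic group a bound on the linear part in one coordinate leaves finitely many linear
parts: such elements, or their inverses, move a lattice vector inside a bounded set. -/
lemma finite_linear_part {Δ : Subgroup Aff2} (hΔ : DiscreteTopology (Δ.map toProj))
    (h : IsHyperbolic Δ) (j : Fin 2) (R : ℝ) :
    {a : Fin 2 → ℂˣ | ∃ d ∈ Δ, d.a = a ∧ ‖(a j : ℂ)‖ ≤ R ∧ ‖(a j : ℂ)‖⁻¹ ≤ R}.Finite := by
  obtain ⟨τ, hτ, hτ0⟩ := h.exists_trans
  have hτi := h.ne_zero τ hτ hτ0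
  have hfin := finite_trans hΔ (max R 1 * ‖τ‖)
  have hbound : ∀ c : ℂ, ‖c‖ ≤ max R 1 → ∀ k, ‖c * τ k‖ ≤ max R 1 * ‖τ‖ := by
    intro c hc k
    rw [norm_mul]
    exact mul_le_mul hc (norm_le_pi_norm τ k) (norm_nonneg _) (by positivity)
  have h1 : {a : Fin 2 → ℂˣ | ∃ d ∈ Δ, d.a = a ∧ ∀ k, ‖(a k : ℂ)‖ ≤ max R 1}.Finite := by
    refine Set.Finite.of_finite_image (f := fun a k => (a k : ℂ) * τ k) (hfin.subset ?_) ?_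
    · rintro _ ⟨_, ⟨d, hd, rfl, hk⟩, rfl⟩
      exact ⟨mul_mem_trans hd hτ, fun k => hbound _ (hk k) k⟩
    · intro a _ b _ hab
      ext k
      exact mul_right_cancel₀ (hτi k) (congrFun hab k)
  have h2 : {a : Fin 2 → ℂˣ | ∃ d ∈ Δ, d.a = a ∧ ∀ k, ‖(a k : ℂ)‖⁻¹ ≤ max R 1}.Finite := by
    refine Set.Finite.of_finite_image (f := fun a => a⁻¹) (h1.subset ?_) inv_injective.injOn
    rintro _ ⟨_, ⟨d, hd, rfl, hk⟩, rfl⟩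
    exact ⟨d⁻¹, inv_mem hd, rfl, fun k => by simpa [-le_sup_iff] using hk k⟩
  refine (h1.union h2).subset ?_
  rintro _ ⟨d, hd, rfl, hj, hj'⟩
  have hother : ∃ i, ∀ k, k = i ∨ k = j := by
    fin_cases j
    · exact ⟨1, fun k => by fin_cases k <;> simp⟩
    · exact ⟨0, fun k => by fin_cases k <;> simp⟩
  obtain ⟨i, hi⟩ := hother
  have hR : R ≤ max R 1 := le_max_left _ _
  have h1R : 1 ≤ max R 1 := le_max_right _ _
  -- in the other coordinate, the linear part or its inverse is bounded by `1`
  rcases le_total ‖(d.a i : ℂ)‖ 1 with hle | hle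
  · refine Or.inl ⟨d, hd, rfl, fun k => ?_⟩
    rcases hi k with rfl | rfl
    · exact hle.trans h1R
    · exact hj.trans hR
  · refine Or.inr ⟨d, hd, rfl, fun k => ?_⟩
    rcases hi k with rfl | rfl
    · exact (inv_le_one_of_one_le₀ hle).trans h1R
    · exact hj'.trans hR

/-- The action on the `j`-th coordinate, when the lattice spans there only a real line through `0`:
real affine relative to the line through a fixed point of a hyperbolic element. -/
lemma exists_real_factor {Δ : Subgroup Aff2} {j : Fin 2} {u : ℂ} (hu : u ≠ 0)
    (hS : ∀ z, z ∈ axisSpan Δ j ↔ ∃ r : ℝ, z = r * u) (h : IsHyperbolic Δ) {g : Aff2} (hg : g ∈ Δ)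
    (hgj : (g.a j : ℂ) ≠ 1) {o : Fin 2 → ℂ} (ho : g.app o = o) {d : Aff2} (hd : d ∈ Δ) :
    ∃ ρ σ : ℝ, (d.a j : ℂ) = ρ ∧ d.b j = o j + σ * u - ρ * o j := by
  -- linear parts preserve the real line spanned by `u`
  have hreal : ∀ e ∈ Δ, ∃ ρ : ℝ, (e.a j : ℂ) = ρ := by
    intro e he
    have hmem : u ∈ axisSpan Δ j := (hS u).2 ⟨1, by simp⟩
    have h1 := mul_mem_realSpan he (show LinearMap.single ℝ (fun _ : Fin 2 => ℂ) j u ∈ _ from hmem)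
    have h2 := h.mem_realSpan_iff.1 h1 j
    simp only [LinearMap.single_apply, Pi.single_eq_same] at h2
    obtain ⟨r, hr⟩ := (hS _).1 h2
    exact ⟨r, mul_right_cancel₀ hu hr⟩
  obtain ⟨ρ, hρ⟩ := hreal d hd
  obtain ⟨κ, hκ⟩ := hreal g hg
  -- the commutator of `d` and `g` is a translation of the lattice
  have hτ : (fun i => (d * g * d⁻¹ * g⁻¹).b i) ∈ trans Δ := by
    have h := Δ.mul_mem (Δ.mul_mem (Δ.mul_mem hd hg) (Δ.inv_mem hd)) (Δ.inv_mem hg)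
    rw [mem_trans]
    convert h using 1
    ext i
    · simp
    · rfl
  have hτj := h.mem_realSpan_iff.1 (Submodule.subset_span hτ) j
  obtain ⟨s, hs⟩ := (hS _).1 hτj
  have hκ1 : (1 : ℂ) - κ ≠ 0 := sub_ne_zero.2 fun h => hgj (hκ.trans h.symm)
  refine ⟨ρ, s / (1 - κ), hρ, ?_⟩
  have hoj : (g.a j : ℂ) * o j + g.b j = o j := congrFun ho j
  have hda := (d.a j).ne_zero
  have hga := (g.a j).ne_zero
  simp only [mul_b, mul_a, Pi.mul_apply, Units.val_mul, inv_a, Pi.inv_apply, inv_b,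
    Units.val_inv_eq_inv_val] at hs
  have hgb : g.b j = o j - κ * o j := by rw [← hκ]; linear_combination hoj
  field_simp at hs
  rw [hρ] at hs hda
  rw [hκ] at hs hga
  rw [hgb] at hs
  push_cast
  field_simp
  linear_combination hs

/-- If the lattice spans a real line in the coordinate `j` and the whole plane in the coordinate
`i`, the limit set lies in a set containing no line `w i = c`: the set of points whose coordinate
`w j` lies on the real line through a hyperbolic fixed point. It lies in `L0`, and off this set the
signed distance to the real line is multiplied by the linear part, which excludes clustering. -/
lemma not_hasParallelLines_of_axisSpan {Δ : Subgroup Aff2} (hΔ : DiscreteTopology (Δ.map toProj))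
    (h : IsHyperbolic Δ) {i j : Fin 2} (hij : i ≠ j) {u : ℂ} (hu : u ≠ 0)
    (htop : axisSpan Δ i = ⊤) (hS : ∀ z, z ∈ axisSpan Δ j ↔ ∃ r : ℝ, z = r * u) :
    ¬ HasParallelLines Δ i := by
  obtain ⟨g, hg, hg1, -, o, ho⟩ := h.exists_norm
  have hgj : (g.a j : ℂ) ≠ 1 := fun h => hg1 j (by rw [h, norm_one])
  have hall : ∀ k, k = i ∨ k = j := by omega
  -- the homogeneous form of the condition that `(w j - o j) / u` is real
  let P : (Fin 3 → ℂ) → Prop := fun v =>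
    ((v j.castSucc - o j * v 2) * (starRingEnd ℂ) (u * v 2)).im = 0
  have hP : Homogeneous P := by
    intro c v _ hv
    have : ((c • v) j.castSucc - o j * (c • v) 2) * (starRingEnd ℂ) (u * (c • v) 2) =
        (Complex.normSq c : ℂ) * ((v j.castSucc - o j * v 2) * (starRingEnd ℂ) (u * v 2)) := by
      rw [← Complex.mul_conj]
      simp only [Pi.smul_apply, smul_eq_mul, map_mul]
      ring
    simp only [P] at hv ⊢
    rw [this, Complex.im_ofReal_mul, hv, mul_zero]
  have hPpt : ∀ w : Fin 2 → ℂ, pt w ∈ locus P ↔ ((w j - o j) * (starRingEnd ℂ) u).im = 0 := by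
    intro w
    rw [pt_mem_locus hP]
    have : ∀ k : Fin 2, (![w 0, w 1, 1] : Fin 3 → ℂ) k.castSucc = w k := by
      intro k
      fin_cases k <;> rfl
    simp [P, this]
  have hPreal : ∀ z : ℂ, (z * (starRingEnd ℂ) u).im = 0 → ∃ r : ℝ, z = r * u := by
    intro z hz
    refine ⟨(z * (starRingEnd ℂ) u).re / Complex.normSq u, ?_⟩
    have h1 : ((z * (starRingEnd ℂ) u).re : ℂ) = z * (starRingEnd ℂ) u := by
      apply Complex.ext <;> simp [hz]
    have h2 : (Complex.normSq u : ℂ) ≠ 0 := by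
      exact_mod_cast (Complex.normSq_pos.2 hu).ne'
    push_cast
    rw [h1]
    field_simp
    rw [← Complex.mul_conj]
    ring
  have hXclosed : IsClosed (locus P) := by
    refine isClosed_locus hP (isClosed_eq (Complex.continuous_im.comp ?_) continuous_const)
    fun_prop
  have hinf : lineInf ⊆ locus P := by
    intro p hp v hv hvp
    have : v 2 = 0 := hp v hv hvp
    simp [P, this]
  have hXL : locus P ⊆ L0 (Δ.map toProj) := by
    intro p hp
    by_cases hpi : p ∈ lineInf
    · obtain ⟨τ, hτ, hτ0⟩ := h.exists_trans
      exact lineInf_subset_L0 hτ hτ0 hpi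
    · rw [← pt_coord hpi] at hp ⊢
      rw [hPpt] at hp
      have hw : coord p - o ∈ realSpan Δ := by
        rw [h.mem_realSpan_iff]
        intro k
        rcases hall k with rfl | rfl
        · rw [htop]; trivial
        · exact (hS _).2 (hPreal _ hp)
      simpa using add_realSpan_mem_L0 hΔ hg (hg1 j) ho hw
  have hsub : limitSet (Δ.map toProj) ⊆ locus P := by
    refine limitSet_subset_of_proper hXclosed hXL fun K hK hKX q hq => ?_
    by_contra hqX
    obtain ⟨k, γ, hk, hγ, hinj, hlim⟩ := hq
    choose d hd hdγ using hγ
    have hKinf : K ⊆ lineInfᶜ := hKX.trans (Set.compl_subset_compl.2 hinf)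
    have hqinf : q ∉ lineInf := fun h => hqX (hinf h)
    obtain ⟨R, hR⟩ := exists_coord_bound hK hKinf
    -- the signed distance to the real line, in the coordinate `j`
    let f : P2 → ℝ := fun p => ((coord p j - o j) * (starRingEnd ℂ) u).im
    have hf0 : ∀ p ∉ locus P, f p ≠ 0 := by
      intro p hp h0
      have hpi : p ∉ lineInf := fun h => hp (hinf h)
      apply hp
      rw [← pt_coord hpi, hPpt]
      exact h0
    have hfc : ∀ p ∉ lineInf, ContinuousAt f p := by
      intro p hp
      have h1 : ContinuousAt (fun p => coord p j) p :=
        (continuous_apply j).continuousAt.comp (continuousAt_coord hp)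
      exact Complex.continuous_im.continuousAt.comp
        ((h1.sub continuousAt_const).mul continuousAt_const)
    have hw : ∀ m, (d m).toProj • k m = pt ((d m).app (coord (k m))) := by
      intro m
      conv_lhs => rw [← pt_coord (hKinf (hk m))]
      rw [toProj_smul_pt]
    have hlim1 : Tendsto (fun m => pt ((d m).app (coord (k m)))) atTop (𝓝 q) := by
      refine hlim.congr fun m => ?_
      rw [← hw, hdγ]
    have hlim2 : Tendsto (fun m => (d m).app (coord (k m))) atTop (𝓝 (coord q)) := by
      have := (continuousAt_coord hqinf).tendsto.comp hlim1
      simpa [Function.comp_def, coord_pt] using this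
    have hlimf : Tendsto (fun m => f (pt ((d m).app (coord (k m))))) atTop (𝓝 (f q)) :=
      (hfc q hqinf).tendsto.comp hlim1
    -- elements act on `f` by multiplication by their linear part in the coordinate `j`
    have hfac : ∀ m, ∃ ρ : ℝ, ((d m).a j : ℂ) = ρ ∧
        f (pt ((d m).app (coord (k m)))) = ρ * f (k m) := by
      intro m
      obtain ⟨ρ, σ, h1, h2⟩ := exists_real_factor hu hS h hg hgj ho (hd m)
      refine ⟨ρ, h1, ?_⟩
      simp only [f, coord_pt, app]
      rw [h1, h2]
      have : ((ρ : ℂ) * coord (k m) j + (o j + σ * u - ρ * o j) - o j) * (starRingEnd ℂ) u =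
          (ρ : ℂ) * ((coord (k m) j - o j) * (starRingEnd ℂ) u) +
            ((σ * Complex.normSq u : ℝ) : ℂ) := by
        push_cast
        rw [← Complex.mul_conj]
        ring
      rw [this, Complex.add_im, Complex.ofReal_im, add_zero, Complex.im_ofReal_mul]
    choose ρ hρ hfρ using hfac
    -- bounds for `f` on the compact set
    obtain ⟨δ, hδ, C, hδC⟩ : ∃ δ > 0, ∃ C : ℝ, ∀ p ∈ K, δ ≤ |f p| ∧ |f p| ≤ C := by
      have hfK : ContinuousOn (fun p => |f p|) K := fun p hp =>
        ((hfc p (hKinf hp)).abs).continuousWithinAt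
      obtain ⟨p, hp, hmin⟩ := hK.exists_isMinOn ⟨k 0, hk 0⟩ hfK
      obtain ⟨p', hp', hmax⟩ := hK.exists_isMaxOn ⟨k 0, hk 0⟩ hfK
      exact ⟨|f p|, abs_pos.2 (hf0 p (hKX hp)), |f p'|, fun x hx => ⟨hmin hx, hmax hx⟩⟩
    have hfq : 0 < |f q| := abs_pos.2 (hf0 q hqX)
    have hC : 0 < C := hδ.trans_le ((hδC _ (hk 0)).1.trans (hδC _ (hk 0)).2)
    -- both `f (k m)` and its images are bounded away from `0` and infinity, so the linear parts are
    set R₁ := max (2 * |f q| / δ) (2 * C / |f q|)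
    have hev1 : ∀ᶠ m in atTop, ‖((d m).a j : ℂ)‖ ≤ R₁ ∧ ‖((d m).a j : ℂ)‖⁻¹ ≤ R₁ := by
      have hlo := hlimf.abs.eventually_const_lt (half_lt_self hfq)
      have hhi := hlimf.abs.eventually_lt_const (lt_two_mul_self hfq)
      filter_upwards [hlo, hhi] with m h1 h2
      obtain ⟨hd1, hd2⟩ := hδC _ (hk m)
      rw [hfρ, abs_mul] at h1 h2
      rw [hρ, Complex.norm_real, Real.norm_eq_abs]
      have hpos : 0 < |ρ m| := by
        by_contra! h
        have := mul_nonpos_of_nonpos_of_nonneg h (abs_nonneg (f (k m)))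
        linarith
      constructor
      · refine le_trans ?_ (le_max_left _ _)
        rw [le_div_iff₀ hδ]
        exact (mul_le_mul_of_nonneg_left hd1 hpos.le).trans h2.le
      · refine le_trans ?_ (le_max_right _ _)
        rw [inv_le_comm₀ hpos (by positivity), inv_div, div_le_iff₀ (by positivity)]
        have := mul_le_mul_of_nonneg_left hd2 hpos.le
        linarith
    -- hence finitely many linear parts occur, and then translation parts are bounded too
    obtain ⟨R₂, hR₂⟩ : ∃ R₂ : ℝ, ∀ a ∈ {a : Fin 2 → ℂˣ | ∃ d ∈ Δ, d.a = a ∧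
        ‖(a j : ℂ)‖ ≤ R₁ ∧ ‖(a j : ℂ)‖⁻¹ ≤ R₁}, ∀ i, ‖(a i : ℂ)‖ ≤ R₂ ∧ ‖(a i : ℂ)‖⁻¹ ≤ R₂ := by
      obtain ⟨B, hB⟩ := ((finite_linear_part hΔ h j R₁).image
        fun a => ∑ i, (‖(a i : ℂ)‖ + ‖(a i : ℂ)‖⁻¹)).bddAbove
      refine ⟨B, fun a ha i => ?_⟩
      have h1 := hB ⟨a, ha, rfl⟩
      have h2 := Finset.single_le_sum (f := fun i => ‖(a i : ℂ)‖ + ‖(a i : ℂ)‖⁻¹)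
        (fun i _ => by positivity) (Finset.mem_univ i)
      have h3 : 0 ≤ ‖(a i : ℂ)‖ := norm_nonneg _
      have h4 : 0 ≤ ‖(a i : ℂ)‖⁻¹ := by positivity
      have h5 := h2.trans h1
      constructor <;> linarith
    have hev2 : ∀ᶠ m in atTop, ∀ i, ‖(d m).app (coord (k m)) i‖ ≤ ‖coord q‖ + 1 := by
      have := hlim2.norm.eventually_lt_const (lt_add_one ‖coord q‖)
      filter_upwards [this] with m hm i
      exact (norm_le_pi_norm _ i).trans hm.le
    have hev3 : ∀ᶠ m in atTop, d m ∈ {d : Aff2 | d ∈ Δ ∧ ∀ i,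
        ‖(d.a i : ℂ)‖ ≤ max R₂ (‖coord q‖ + 1 + R₂ * R) ∧
        ‖((d.a i)⁻¹ : ℂ)‖ ≤ max R₂ (‖coord q‖ + 1 + R₂ * R) ∧
        ‖d.b i‖ ≤ max R₂ (‖coord q‖ + 1 + R₂ * R)} := by
      filter_upwards [hev1, hev2] with m h1 h2
      refine ⟨hd m, fun i => ?_⟩
      obtain ⟨h3, h4⟩ := hR₂ _ ⟨d m, hd m, rfl, h1⟩ i
      refine ⟨h3.trans (le_max_left _ _), ?_, le_trans ?_ (le_max_right _ _)⟩
      · rw [norm_inv]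
        exact h4.trans (le_max_left _ _)
      · have hb : (d m).b i = (d m).app (coord (k m)) i - (d m).a i * coord (k m) i := by
          simp [app]
        rw [hb]
        refine (norm_sub_le _ _).trans (add_le_add (h2 i) ?_)
        rw [norm_mul]
        exact mul_le_mul h3 (hR _ (hk m) i) (norm_nonneg _) ((norm_nonneg _).trans h3)
    obtain ⟨N, hN⟩ := eventually_atTop.1 hev3
    refine Set.infinite_of_injective_forall_mem (f := fun m => d (m + N)) (fun a b hab => ?_)
      (fun m => hN _ (by omega)) (finite_of_bounded hΔ _)
    have := hinj (show γ (a + N) = γ (b + N) by rw [← hdγ, ← hdγ]; exact congrArg toProj hab)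
    omega
  -- a point of the line `w i = c` whose coordinate `j` is off the real line
  rintro ⟨c, _, -, hc⟩
  have hmem := hsub (hc (fun k => if k = i then c else o j + Complex.I * u) (Or.inl (by simp)))
  rw [hPpt] at hmem
  obtain ⟨r, hr⟩ := hPreal _ hmem
  simp only [if_neg hij.symm, add_sub_cancel_left] at hr
  have := congrArg Complex.im (mul_right_cancel₀ hu hr)
  simp at this

/-- In a hyperbolic group whose limit set is not the whole plane and contains parallel lines in both
directions, the lattice spans a real line in each coordinate. -/
lemma exists_axisSpan_eq {Δ : Subgroup Aff2} (hΔ : DiscreteTopology (Δ.map toProj))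
    (h : IsHyperbolic Δ) (hne : limitSet (Δ.map toProj) ≠ Set.univ)
    (hl : ∀ i, HasParallelLines Δ i) :
    ∃ u : Fin 2 → ℂ, (∀ i, u i ≠ 0) ∧ ∀ i z, z ∈ axisSpan Δ i ↔ ∃ r : ℝ, z = r * u i := by
  obtain ⟨τ, hτ, hτ0⟩ := h.exists_trans
  have hbot : ∀ i, axisSpan Δ i ≠ ⊥ := by
    intro i hi
    have := h.mem_realSpan_iff.1 (Submodule.subset_span hτ) i
    rw [hi] at this
    exact h.ne_zero τ hτ hτ0 i this
  by_cases htop : ∃ i, axisSpan Δ i = ⊤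
  · exfalso
    obtain ⟨i, hi⟩ := htop
    obtain ⟨j, hij, hall⟩ : ∃ j, i ≠ j ∧ ∀ k, k = i ∨ k = j := by
      fin_cases i
      · exact ⟨1, by simp, fun k => by fin_cases k <;> simp⟩
      · exact ⟨0, by simp, fun k => by fin_cases k <;> simp⟩
    rcases real_subspace_eq (hbot j) with hj | ⟨u, hu, hS⟩
    -- the lattice spans `ℂ²`, and every point lies in `L0`
    · apply hne
      obtain ⟨g, hg, hg1, -, o, ho⟩ := h.exists_norm
      refine Set.eq_univ_of_forall fun p => Or.inl (Or.inl ?_)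
      by_cases hp : p ∈ lineInf
      · exact lineInf_subset_L0 hτ hτ0 hp
      · rw [← pt_coord hp]
        have hw : coord p - o ∈ realSpan Δ := by
          rw [h.mem_realSpan_iff]
          intro k
          rcases hall k with rfl | rfl
          · rw [hi]; trivial
          · rw [hj]; trivial
        simpa using add_realSpan_mem_L0 hΔ hg (hg1 i) ho hw
    · exact not_hasParallelLines_of_axisSpan hΔ h hij hu hi hS (hl i)
  · push Not at htop
    choose u hu hS using fun i => (real_subspace_eq (hbot i)).resolve_left (htop i)
    exact ⟨u, hu, hS⟩

end Aff2

/-! ### Diagonalizing a hyperbolic toral automorphism -/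

/-- An integral matrix of determinant one as a complex matrix. -/
def cmat (A : SL(2, ℤ)) : Matrix (Fin 2) (Fin 2) ℂ := A.1.map (Int.cast : ℤ → ℂ)

lemma cmat_mul (A B : SL(2, ℤ)) : cmat (A * B) = cmat A * cmat B := by
  simp only [cmat, Matrix.SpecialLinearGroup.coe_mul]
  exact Matrix.map_mul (f := Int.castRingHom ℂ)

lemma cmat_one : cmat 1 = 1 := by
  ext i j
  fin_cases i <;> fin_cases j <;> simp [cmat]

/-- A diagonalization of `A` diagonalizes the powers of `A`. -/
lemma mul_cmat_zpow {A : SL(2, ℤ)} {Q : Matrix (Fin 2) (Fin 2) ℂ} {a : Fin 2 → ℂˣ}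
    (h : Q * cmat A = Matrix.diagonal (fun i => (a i : ℂ)) * Q) (k : ℤ) :
    Q * cmat (A ^ k) = Matrix.diagonal (fun i => ((a i ^ k : ℂˣ) : ℂ)) * Q := by
  have hinv : Q * cmat A⁻¹ = Matrix.diagonal (fun i => ((a i)⁻¹ : ℂˣ).1) * Q := by
    have h1 : Matrix.diagonal (fun i => ((a i)⁻¹ : ℂˣ).1) *
        Matrix.diagonal (fun i => (a i : ℂ)) = 1 := by
      rw [Matrix.diagonal_mul_diagonal]
      simp
    calc Q * cmat A⁻¹ = Matrix.diagonal (fun i => ((a i)⁻¹ : ℂˣ).1) *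
        (Matrix.diagonal (fun i => (a i : ℂ)) * Q) * cmat A⁻¹ := by
          rw [← mul_assoc, h1, one_mul]
      _ = Matrix.diagonal (fun i => ((a i)⁻¹ : ℂˣ).1) * Q * (cmat A * cmat A⁻¹) := by
          rw [← h]; simp only [mul_assoc]
      _ = _ := by rw [← cmat_mul, mul_inv_cancel, cmat_one, mul_one]
  have step : ∀ (k l : ℤ),
      Q * cmat (A ^ k) = Matrix.diagonal (fun i => ((a i ^ k : ℂˣ) : ℂ)) * Q →
      Q * cmat (A ^ l) = Matrix.diagonal (fun i => ((a i ^ l : ℂˣ) : ℂ)) * Q →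
      Q * cmat (A ^ (k + l)) = Matrix.diagonal (fun i => ((a i ^ (k + l) : ℂˣ) : ℂ)) * Q := by
    intro k l hk hl
    rw [_root_.zpow_add, cmat_mul, ← mul_assoc, hk, mul_assoc, hl, ← mul_assoc,
      Matrix.diagonal_mul_diagonal]
    simp only [_root_.zpow_add, Units.val_mul]
  induction k using Int.induction_on with
  | zero => simp [cmat_one]
  | succ k ih => exact step _ _ ih (by simpa using h)
  | pred k ih => exact step _ (-1) ih (by simpa using hinv)

/-- The affine map `w ↦ Q w + o` in homogeneous coordinates. -/
noncomputable def affGL (Q : Matrix (Fin 2) (Fin 2) ℂ) (hQ : Q.det ≠ 0) (o : Fin 2 → ℂ) :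
    GL (Fin 3) ℂ :=
  Matrix.GeneralLinearGroup.mkOfDetNeZero
    !![Q 0 0, Q 0 1, o 0; Q 1 0, Q 1 1, o 1; 0, 0, 1] (by
      rw [Matrix.det_fin_two] at hQ
      rw [Matrix.det_fin_three]
      simpa using hQ)

lemma coe_affGL (Q : Matrix (Fin 2) (Fin 2) ℂ) (hQ : Q.det ≠ 0) (o : Fin 2 → ℂ) :
    (affGL Q hQ o).1 = !![Q 0 0, Q 0 1, o 0; Q 1 0, Q 1 1, o 1; 0, 0, 1] := rfl

/-- The map diagonalizing `A` conjugates the elements of `Γ_A` to pairs of affine maps. -/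
lemma affGL_conj {A : SL(2, ℤ)} {Q : Matrix (Fin 2) (Fin 2) ℂ} (hQ : Q.det ≠ 0) {a : Fin 2 → ℂˣ}
    (h : Q * cmat A = Matrix.diagonal (fun i => (a i : ℂ)) * Q) (o : Fin 2 → ℂ) (k : ℤ)
    (b : Fin 2 → ℤ) :
    toPSL (affGL Q hQ o) * (affineSL (A ^ k) (intVec b) : SL(3, ℂ)) * (toPSL (affGL Q hQ o))⁻¹ =
      Aff2.toProj ⟨a ^ k, fun i => ∑ j, Q i j * b j + o i - (a i ^ k : ℂˣ) * o i⟩ := by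
  rw [mul_inv_eq_iff_eq_mul, ← toPSL_toGL, Aff2.toProj, MonoidHom.comp_apply, ← map_mul, ← map_mul]
  congr 1
  apply Units.ext
  have hk := mul_cmat_zpow h k
  have hk' : ∀ i j, Q i 0 * ((A ^ k).1 0 j : ℂ) + Q i 1 * ((A ^ k).1 1 j : ℂ) =
      ((a i ^ k : ℂˣ) : ℂ) * Q i j := by
    intro i j
    have := congrFun (congrFun hk i) j
    rwa [Matrix.diagonal_mul, Matrix.mul_apply, Fin.sum_univ_two] at this
  have h1 : (SpecialLinearGroup.toGL (affineSL (A ^ k) (intVec b)) : GL (Fin 3) ℂ).1 =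
      (affineSL (A ^ k) (intVec b)).1 := rfl
  rw [Units.val_mul, Units.val_mul, Aff2.coe_toGL, coe_affGL, h1]
  have h00 := hk' 0 0
  have h01 := hk' 0 1
  have h10 := hk' 1 0
  have h11 := hk' 1 1
  ext i j
  fin_cases i <;> fin_cases j <;>
    simp [Matrix.mul_apply, Fin.sum_univ_three, affineSL, Aff2.mat, intVec] at h00 h01 h10 h11 ⊢ <;>
    assumption

/-- The map `w ↦ Q w + o`, where `Q` diagonalizes `A`, conjugates `Γ_A` to a group of pairs of
affine maps. -/
lemma image_toralOne {A : SL(2, ℤ)} {Q : Matrix (Fin 2) (Fin 2) ℂ} (hQ : Q.det ≠ 0)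
    {a : Fin 2 → ℂˣ} (h : Q * cmat A = Matrix.diagonal (fun i => (a i : ℂ)) * Q)
    (o : Fin 2 → ℂ) :
    (fun γ => toPSL (affGL Q hQ o) * γ * (toPSL (affGL Q hQ o))⁻¹) '' toralOne A =
      Aff2.toProj '' {d | ∃ (k : ℤ) (b : Fin 2 → ℤ), d =
        ⟨a ^ k, fun i => ∑ j, Q i j * b j + o i - (a i ^ k : ℂˣ) * o i⟩} := by
  ext γ
  constructor
  · rintro ⟨_, ⟨k, b, rfl⟩, rfl⟩
    exact ⟨_, ⟨k, b, rfl⟩, (affGL_conj hQ h o k b).symm⟩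
  · rintro ⟨_, ⟨k, b, rfl⟩, rfl⟩
    exact ⟨_, ⟨k, b, rfl⟩, affGL_conj hQ h o k b⟩

namespace Aff2

/-- The elements of `Aff2` with positive real linear part. -/
def posLinear : Subgroup Aff2 where
  carrier := {d | ∀ i, ∃ r : ℝ, 0 < r ∧ (d.a i : ℂ) = r}
  one_mem' := fun _ => ⟨1, one_pos, by simp⟩
  mul_mem' := by
    intro d e hd he i
    obtain ⟨r, hr, h1⟩ := hd i
    obtain ⟨s, hs, h2⟩ := he i
    exact ⟨r * s, mul_pos hr hs, by simp [h1, h2]⟩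
  inv_mem' := by
    intro d hd i
    obtain ⟨r, hr, h1⟩ := hd i
    exact ⟨r⁻¹, inv_pos.2 hr, by simp [h1]⟩

/-- In a group with real linear parts, the elements with positive linear part have index at most
four: they form the kernel of the homomorphism of signs. -/
lemma relIndex_posLinear {Δ : Subgroup Aff2} (hreal : ∀ d ∈ Δ, ∀ i, ∃ r : ℝ, (d.a i : ℂ) = r) :
    (Δ ⊓ posLinear).relIndex Δ ≠ 0 ∧ (Δ ⊓ posLinear).relIndex Δ ≤ 4 := by
  choose! ρ hρ using hreal
  have hne : ∀ d ∈ Δ, ∀ i, ρ d i ≠ 0 := by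
    intro d hd i h0
    have := hρ d hd i
    rw [h0, Complex.ofReal_zero] at this
    exact (d.a i).ne_zero this
  have hmul : ∀ d ∈ Δ, ∀ e ∈ Δ, ∀ i, ρ (d * e) i = ρ d i * ρ e i := by
    intro d hd e he i
    have h1 := hρ _ (mul_mem hd he) i
    simp only [mul_a, Pi.mul_apply, Units.val_mul, hρ d hd, hρ e he] at h1
    exact_mod_cast h1.symm
  have h1 : ∀ i, ρ 1 i = 1 := by
    intro i
    have := hρ 1 (one_mem Δ) i
    simp only [one_a, Pi.one_apply, Units.val_one] at this
    exact_mod_cast this.symm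
  let f : Δ →* (Fin 2 → ℤˣ) :=
    { toFun := fun d i => if 0 < ρ d.1 i then 1 else -1
      map_one' := by
        ext i
        simp [h1]
      map_mul' := by
        intro d e
        ext i
        simp only [Subgroup.coe_mul, hmul d.1 d.2 e.1 e.2, Pi.mul_apply]
        rcases lt_or_gt_of_ne (hne d.1 d.2 i) with hd | hd <;>
        rcases lt_or_gt_of_ne (hne e.1 e.2 i) with he | he
        · simp [mul_pos_of_neg_of_neg hd he, hd.not_gt, he.not_gt]
        · simp [(mul_neg_of_neg_of_pos hd he).not_gt, hd.not_gt, he]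
        · simp [(mul_neg_of_pos_of_neg hd he).not_gt, hd, he.not_gt]
        · simp [mul_pos hd he, hd, he] }
  have hker : (Δ ⊓ posLinear).subgroupOf Δ = f.ker := by
    ext d
    rw [Subgroup.mem_subgroupOf, Subgroup.mem_inf, MonoidHom.mem_ker]
    constructor
    · rintro ⟨-, h⟩
      ext i
      obtain ⟨r, hr, hri⟩ := h i
      have : ρ d.1 i = r := by
        have := hρ d.1 d.2 i
        rw [hri] at this
        exact_mod_cast this.symm
      simp [f, this, hr]
    · intro h
      refine ⟨d.2, fun i => ⟨ρ d.1 i, ?_, hρ d.1 d.2 i⟩⟩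
      have := congrFun h i
      by_contra hneg
      simp only [f, MonoidHom.coe_mk, OneHom.coe_mk, if_neg hneg, Pi.one_apply] at this
      exact absurd this (by decide : (-1 : ℤˣ) ≠ 1)
  rw [Subgroup.relIndex, hker, Subgroup.index_ker]
  refine ⟨Nat.card_pos.ne', ?_⟩
  refine (Subgroup.card_le_card_group f.range).trans ?_
  simp [Nat.card_eq_fintype_card]

/-- The lattice has a basis formed by the columns of an invertible matrix with entries in the real
lines it spans. -/
lemma exists_lattice_basis {Δ : Subgroup Aff2} (hΔ : DiscreteTopology (Δ.map toProj))
    (h : IsHyperbolic Δ) {u : Fin 2 → ℂ} (hu : ∀ i, u i ≠ 0)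
    (hS : ∀ i z, z ∈ axisSpan Δ i ↔ ∃ r : ℝ, z = r * u i) :
    ∃ Q : Matrix (Fin 2) (Fin 2) ℂ, Q.det ≠ 0 ∧
      ∀ τ, τ ∈ trans Δ ↔ ∃ b : Fin 2 → ℤ, ∀ i, τ i = ∑ j, Q i j * b j := by
  let L : (Fin 2 → ℝ) →ₗ[ℝ] (Fin 2 → ℂ) :=
    { toFun := fun x i => x i * u i
      map_add' := fun x y => by ext i; simp [add_mul]
      map_smul' := fun r x => by ext i; simp [mul_assoc] }
  have hL : Function.Injective L := by
    intro x y hxy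
    ext i
    exact_mod_cast mul_right_cancel₀ (hu i) (congrFun hxy i)
  -- the lattice in the real coordinates `x` with `τ i = x i * u i`
  let T : Submodule ℤ (Fin 2 → ℝ) := ZLattice.comap ℝ (trans Δ) L
  have hTmem : ∀ x, x ∈ T ↔ L x ∈ trans Δ := fun x => Iff.rfl
  have := discreteTopology_trans hΔ
  have hT : DiscreteTopology T :=
    ZLattice.comap_discreteTopology ℝ (trans Δ) (LinearMap.continuous_of_finiteDimensional L) hL
  have hrange : ∀ τ ∈ trans Δ, ∃ x ∈ T, L x = τ := by
    intro τ hτ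
    have h1 := h.mem_realSpan_iff.1 (Submodule.subset_span hτ)
    choose r hr using fun i => (hS i _).1 (h1 i)
    have h2 : L r = τ := funext fun i => (hr i).symm
    exact ⟨r, (hTmem r).2 (h2 ▸ hτ), h2⟩
  have hZ : IsZLattice ℝ T := by
    refine ⟨?_⟩
    rw [eq_top_iff]
    intro x _
    have h1 : realSpan Δ ≤ (Submodule.span ℝ (T : Set (Fin 2 → ℝ))).map L := by
      refine Submodule.span_le.2 fun τ hτ => ?_
      obtain ⟨x, hx, rfl⟩ := hrange τ hτ
      exact ⟨x, Submodule.subset_span hx, rfl⟩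
    have h2 : L x ∈ realSpan Δ := h.mem_realSpan_iff.2 fun i => (hS i _).2 ⟨x i, rfl⟩
    obtain ⟨y, hy, hxy⟩ := h1 h2
    exact hL hxy ▸ hy
  let β := IsZLattice.basis T
  let βR := β.ofZLatticeBasis ℝ T
  have hβR : ∀ j, βR j = (β j : Fin 2 → ℝ) := β.ofZLatticeBasis_apply ℝ T
  refine ⟨Matrix.of fun i j => ((β j : Fin 2 → ℝ) i : ℂ) * u i, ?_, fun τ => ⟨?_, ?_⟩⟩
  · have hdet : (Matrix.of fun i j => (β j : Fin 2 → ℝ) i).det ≠ 0 := by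
      intro h0
      obtain ⟨v, hv, hv0⟩ := Matrix.exists_mulVec_eq_zero_iff.2 h0
      apply hv
      have hli := Fintype.linearIndependent_iff.1 βR.linearIndependent v (by
        ext i
        have := congrFun hv0 i
        simpa [hβR, Matrix.mulVec, dotProduct, mul_comm, Fin.sum_univ_two] using this)
      exact funext hli
    have h2 : (Matrix.of fun i j => ((β j : Fin 2 → ℝ) i : ℂ) * u i).det =
        ((Matrix.of fun i j => (β j : Fin 2 → ℝ) i).det : ℝ) * (u 0 * u 1) := by
      simp only [Matrix.det_fin_two, Matrix.of_apply]
      push_cast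
      ring
    rw [h2]
    exact mul_ne_zero (by exact_mod_cast hdet) (mul_ne_zero (hu 0) (hu 1))
  · intro hτ
    obtain ⟨x, hx, rfl⟩ := hrange τ hτ
    refine ⟨fun j => β.repr ⟨x, hx⟩ j, fun i => ?_⟩
    have h1 := congrArg Subtype.val (β.sum_repr ⟨x, hx⟩)
    have h2 := congrFun h1 i
    simp only [Fin.sum_univ_two, Submodule.coe_add, Submodule.coe_smul, Pi.add_apply,
      zsmul_eq_mul, Pi.mul_apply, Pi.intCast_apply] at h2
    change (x i : ℂ) * u i = _
    rw [← h2]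
    simp only [Fin.sum_univ_two, Matrix.of_apply]
    push_cast
    ring
  · rintro ⟨b, hb⟩
    have h1 : (∑ j, b j • (β j : T)).1 ∈ T := (∑ j, b j • (β j : T)).2
    have h2 : L (∑ j, b j • (β j : T)).1 = τ := by
      ext i
      rw [hb]
      change (((∑ j, b j • (β j : T)).1 i : ℝ) : ℂ) * u i = _
      simp only [Fin.sum_univ_two, Submodule.coe_add, Submodule.coe_smul, Pi.add_apply,
        zsmul_eq_mul, Pi.mul_apply, Pi.intCast_apply, Matrix.of_apply]
      push_cast
      ring
    exact h2 ▸ (hTmem _).1 h1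

/-! ### Recovering a toral group from the lattice -/

/-- In a basis of the lattice, linear parts are integral matrices of determinant `±1`. -/
lemma exists_integral_matrix {Δ : Subgroup Aff2} {Q : Matrix (Fin 2) (Fin 2) ℂ} (hQ : Q.det ≠ 0)
    (hτ : ∀ τ, τ ∈ trans Δ ↔ ∃ b : Fin 2 → ℤ, ∀ i, τ i = ∑ j, Q i j * b j) {d : Aff2}
    (hd : d ∈ Δ) :
    ∃ N : Matrix (Fin 2) (Fin 2) ℤ,
      Q * N.map (Int.cast : ℤ → ℂ) = Matrix.diagonal (fun i => (d.a i : ℂ)) * Q ∧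
      (N.det : ℂ) = d.a 0 * d.a 1 ∧ IsUnit N.det := by
  have key : ∀ e ∈ Δ, ∃ N : Matrix (Fin 2) (Fin 2) ℤ,
      Q * N.map (Int.cast : ℤ → ℂ) = Matrix.diagonal (fun i => (e.a i : ℂ)) * Q ∧
      (N.det : ℂ) = e.a 0 * e.a 1 := by
    intro e he
    have hcol : ∀ j, (fun i => Q i j) ∈ trans Δ := by
      intro j
      refine (hτ _).2 ⟨Pi.single j 1, fun i => ?_⟩
      fin_cases j <;> simp [Fin.sum_univ_two]
    choose b hb using fun j => (hτ _).1 (mul_mem_trans he (hcol j))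
    have h1 : Q * (Matrix.of fun k j => b j k).map (Int.cast : ℤ → ℂ) =
        Matrix.diagonal (fun i => (e.a i : ℂ)) * Q := by
      ext i j
      rw [Matrix.diagonal_mul, hb j i, Matrix.mul_apply]
      rfl
    refine ⟨_, h1, ?_⟩
    have h2 := congrArg Matrix.det h1
    rw [Matrix.det_mul, Matrix.det_mul, Matrix.det_diagonal, Fin.prod_univ_two, mul_comm] at h2
    rw [← mul_right_cancel₀ hQ h2]
    exact RingHom.map_det (Int.castRingHom ℂ) _
  obtain ⟨N, hN, hdet⟩ := key d hd
  -- the matrix of the inverse is integral as well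
  obtain ⟨M, -, hM⟩ := key d⁻¹ (inv_mem hd)
  refine ⟨N, hN, hdet, IsUnit.of_mul_eq_one M.det ?_⟩
  have h0 := (d.a 0).ne_zero
  have h1 := (d.a 1).ne_zero
  have : (N.det : ℂ) * M.det = 1 := by
    rw [hdet, hM]
    simp only [inv_a, Pi.inv_apply, Units.val_inv_eq_inv_val]
    field_simp
  exact_mod_cast this

/-- The positive linear parts form an infinite cyclic group. The generator is an element of least
norm greater than `1` in the first coordinate, which exists by `finite_linear_part`. -/
lemma exists_generator {Δ : Subgroup Aff2} (hΔ : DiscreteTopology (Δ.map toProj))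
    (h : IsHyperbolic Δ) (hreal : ∀ d ∈ Δ, ∀ i, ∃ r : ℝ, (d.a i : ℂ) = r)
    (hone : ∀ d ∈ Δ ⊓ posLinear, d.a 0 * d.a 1 = 1) :
    ∃ g ∈ Δ ⊓ posLinear, 1 < ‖(g.a 0 : ℂ)‖ ∧ ∀ d ∈ Δ ⊓ posLinear, ∃ k : ℤ, d.a = g.a ^ k := by
  obtain ⟨e, he, he0, -⟩ := h.exists_expand
  -- the square of a real linear part is positive
  have hpos : e ^ 2 ∈ Δ ⊓ posLinear := by
    refine ⟨pow_mem he 2, fun i => ?_⟩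
    obtain ⟨r, hr⟩ := hreal e he i
    have hr0 : r ≠ 0 := by
      rintro rfl
      simp at hr
    exact ⟨r ^ 2, by positivity, by rw [pow_a]; simp [hr]⟩
  have he2 : 1 < ‖((e ^ 2).a 0 : ℂ)‖ := by
    rw [pow_a]
    simpa using one_lt_pow₀ he0 two_ne_zero
  let S : Set (Fin 2 → ℂˣ) := {a | ∃ d ∈ Δ ⊓ posLinear, d.a = a ∧ 1 < ‖(a 0 : ℂ)‖ ∧
    ‖(a 0 : ℂ)‖ ≤ ‖((e ^ 2).a 0 : ℂ)‖}
  have hS : S.Finite := by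
    refine (finite_linear_part hΔ h 0 ‖((e ^ 2).a 0 : ℂ)‖).subset ?_
    rintro _ ⟨d, hd, rfl, h1, h2⟩
    exact ⟨d, hd.1, rfl, h2, (inv_le_one_of_one_le₀ h1.le).trans he2.le⟩
  obtain ⟨_, ⟨g, hg, rfl, hg1, hg2⟩, hmin⟩ :=
    Set.exists_min_image S (fun a => ‖(a 0 : ℂ)‖) hS ⟨_, e ^ 2, hpos, rfl, he2, le_rfl⟩
  refine ⟨g, hg, hg1, fun d hd => ?_⟩
  obtain ⟨k, hk1, hk2⟩ := exists_mem_Ico_zpow (norm_pos_iff.2 (d.a 0).ne_zero) hg1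
  refine ⟨k, ?_⟩
  have hf : d * (g ^ k)⁻¹ ∈ Δ ⊓ posLinear := mul_mem hd (inv_mem (zpow_mem hg k))
  set f := d * (g ^ k)⁻¹ with hfdef
  have hfa : f.a = d.a * (g.a ^ k)⁻¹ := by rw [hfdef, mul_a, inv_a, zpow_a]
  have hgk : 0 < ‖(g.a 0 : ℂ)‖ ^ k := zpow_pos (one_pos.trans hg1) k
  have hnf : ‖(f.a 0 : ℂ)‖ = ‖(d.a 0 : ℂ)‖ / ‖(g.a 0 : ℂ)‖ ^ k := by
    rw [hfa]
    simp [div_eq_mul_inv]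
  have hf1 : 1 ≤ ‖(f.a 0 : ℂ)‖ := by rwa [hnf, one_le_div hgk]
  have hf2 : ‖(f.a 0 : ℂ)‖ < ‖(g.a 0 : ℂ)‖ := by
    rw [hnf, div_lt_iff₀ hgk, mul_comm]
    rwa [zpow_add_one₀ (one_pos.trans hg1).ne'] at hk2
  -- minimality of `g`
  have hfn : ‖(f.a 0 : ℂ)‖ = 1 := by
    by_contra hne
    have := hmin _ ⟨f, hf, rfl, lt_of_le_of_ne hf1 (Ne.symm hne), hf2.le.trans hg2⟩
    exact absurd hf2 this.not_gt
  have hf0 : f.a 0 = 1 := by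
    obtain ⟨r, hr, hr0⟩ := hf.2 0
    rw [hr0, Complex.norm_real, Real.norm_of_nonneg hr.le] at hfn
    ext
    rw [hr0, hfn]
    simp
  have hfone : f.a = 1 := by
    have := hone f hf
    rw [hf0, one_mul] at this
    ext i
    fin_cases i
    · simp [hf0]
    · simp [this]
  rw [hfa, mul_inv_eq_one] at hfone
  exact hfone

/-- A hyperbolic group whose lattice spans a real line in each coordinate has a hyperbolic toral
subgroup of index at most four. -/
lemma exists_toral {Δ : Subgroup Aff2} (hΔ : DiscreteTopology (Δ.map toProj))
    (h : IsHyperbolic Δ) {u : Fin 2 → ℂ} (hu : ∀ i, u i ≠ 0)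
    (hS : ∀ i z, z ∈ axisSpan Δ i ↔ ∃ r : ℝ, z = r * u i) :
    ∃ H ≤ Δ, H.relIndex Δ ≠ 0 ∧ H.relIndex Δ ≤ 4 ∧ IsHyperbolicToralGroup (H.map toProj) := by
  obtain ⟨g₀, hg₀, hg₁, -, o₀, ho₀⟩ := h.exists_norm
  have hreal : ∀ d ∈ Δ, ∀ i, ∃ r : ℝ, (d.a i : ℂ) = r := by
    intro d hd i
    obtain ⟨ρ, -, hρ, -⟩ := exists_real_factor (hu i) (hS i) h hg₀
      (fun h => hg₁ i (by rw [h, norm_one])) ho₀ hd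
    exact ⟨ρ, hρ⟩
  obtain ⟨Q, hQ, hτ⟩ := exists_lattice_basis hΔ h hu hS
  -- the determinant is `1`, being positive and `±1`
  have hdet : ∀ d ∈ Δ ⊓ posLinear, ∃ A : SL(2, ℤ),
      Q * cmat A = Matrix.diagonal (fun i => (d.a i : ℂ)) * Q := by
    intro d hd
    obtain ⟨N, hN, hN1, hN2⟩ := exists_integral_matrix hQ hτ hd.1
    have hN3 : N.det = 1 := by
      refine (Int.isUnit_iff.1 hN2).resolve_right fun hneg => ?_
      obtain ⟨r, hr, hr0⟩ := hd.2 0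
      obtain ⟨s, hs, hs0⟩ := hd.2 1
      rw [hneg, hr0, hs0] at hN1
      have : (-1 : ℝ) = r * s := by exact_mod_cast hN1
      linarith [mul_pos hr hs]
    exact ⟨⟨N, hN3⟩, hN⟩
  have hone : ∀ d ∈ Δ ⊓ posLinear, d.a 0 * d.a 1 = 1 := by
    intro d hd
    obtain ⟨A, hA⟩ := hdet d hd
    have h2 := congrArg Matrix.det hA
    have h3 : (cmat A).det = 1 := by
      have := RingHom.map_det (Int.castRingHom ℂ) A.1
      rw [A.2, map_one] at this
      exact this.symm
    rw [Matrix.det_mul, Matrix.det_mul, Matrix.det_diagonal, Fin.prod_univ_two, h3, mul_comm] at h2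
    ext
    simpa using (mul_right_cancel₀ hQ h2).symm
  obtain ⟨g, hg, hg1, hgen⟩ := exists_generator hΔ h hreal hone
  obtain ⟨A, hA⟩ := hdet g hg
  have hn0 : ‖(g.a 0 : ℂ)‖ * ‖(g.a 1 : ℂ)‖ = 1 := by
    rw [← norm_mul, ← Units.val_mul, hone g hg, Units.val_one, norm_one]
  have hgn : ∀ i, ‖(g.a i : ℂ)‖ ≠ 1 := by
    intro i hi
    fin_cases i
    · exact hg1.ne' hi
    · simp only [Fin.mk_one] at hi
      rw [hi, mul_one] at hn0
      exact hg1.ne' hn0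
  -- with the fixed point of `g` as origin, the group consists of the products of a lattice
  -- translation and a power of the linear map `g`
  obtain ⟨o, ho⟩ := exists_fixed fun i hi => hgn i (by rw [hi, norm_one])
  -- the eigenvalues of `A` are those of the linear part of `g`
  have hAhyp : IsHyperbolicToralAut A := by
    intro μ hμ hμ1
    obtain ⟨v, hv⟩ := hμ.exists_hasEigenvector
    have hv1 : cmat A *ᵥ v = μ • v := by
      have := hv.apply_eq_smul
      rwa [Matrix.toLin'_apply] at this
    have hv2 : ∀ i, (g.a i : ℂ) * (Q *ᵥ v) i = μ * (Q *ᵥ v) i := by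
      intro i
      have h1 : (Q * cmat A) *ᵥ v = μ • (Q *ᵥ v) := by
        rw [← Matrix.mulVec_mulVec, hv1, Matrix.mulVec_smul]
      rw [hA, ← Matrix.mulVec_mulVec] at h1
      have := congrFun h1 i
      rwa [Matrix.mulVec_diagonal] at this
    have hv3 : Q *ᵥ v ≠ 0 := fun h0 =>
      hv.2 (Matrix.eq_zero_of_mulVec_eq_zero hQ h0)
    obtain ⟨i, hi⟩ := Function.ne_iff.1 hv3
    exact hgn i (by rw [mul_right_cancel₀ hi (hv2 i), hμ1])
  obtain ⟨hi0, hi4⟩ := relIndex_posLinear hreal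
  refine ⟨Δ ⊓ posLinear, inf_le_left, hi0, hi4, Or.inl ⟨A, hAhyp, toPSL (affGL Q hQ o), ?_⟩⟩
  rw [image_toralOne hQ hA o, Subgroup.coe_map]
  congr 1
  have hzo : ∀ k : ℤ, (⟨g.a ^ k, fun i => o i - (g.a i ^ k : ℂˣ) * o i⟩ : Aff2) = g ^ k := by
    intro k
    have happ : (g ^ k).app o = o := by
      cases k with
      | ofNat n => simpa using pow_app_fixed ho n
      | negSucc n =>
        have h1 := pow_app_fixed ho (n + 1)
        rw [zpow_negSucc]
        ext i
        have h2 := congrFun h1 i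
        simp only [app, inv_a, inv_b, Pi.inv_apply] at h2 ⊢
        have h3 := ((g ^ (n + 1)).a i).ne_zero
        rw [Units.val_inv_eq_inv_val]
        field_simp
        linear_combination -h2
    have ha : (g ^ k).a = g.a ^ k := zpow_a g k
    refine Aff2.ext ha.symm ?_
    ext i
    have := congrFun happ i
    simp only [app, ha, Pi.pow_apply] at this
    linear_combination -this
  have hmulτ : ∀ (τ : Fin 2 → ℂ) (k : ℤ), (⟨1, τ⟩ : Aff2) * g ^ k =
      ⟨g.a ^ k, fun i => τ i + o i - (g.a i ^ k : ℂˣ) * o i⟩ := by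
    intro τ k
    rw [← hzo k]
    ext i
    · simp
    · simp
      ring
  ext d
  constructor
  · intro hd
    obtain ⟨k, hk⟩ := hgen d hd
    have h1 : d * (g ^ k)⁻¹ ∈ Δ := mul_mem hd.1 (inv_mem (Δ.zpow_mem hg.1 k))
    have ha : (d * (g ^ k)⁻¹).a = 1 := by rw [mul_a, inv_a, zpow_a, hk, _root_.mul_inv_cancel]
    have h2 : (d * (g ^ k)⁻¹).b ∈ trans Δ := by
      rw [mem_trans, ← ha]
      exact h1
    obtain ⟨b, hb⟩ := (hτ _).1 h2
    refine ⟨k, b, ?_⟩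
    have h3 : d = (⟨1, (d * (g ^ k)⁻¹).b⟩ : Aff2) * g ^ k := by
      rw [← ha]
      change d = d * (g ^ k)⁻¹ * g ^ k
      rw [inv_mul_cancel_right]
    rw [hmulτ] at h3
    simpa only [hb] using h3
  · rintro ⟨k, b, rfl⟩
    rw [← hmulτ (fun i => ∑ j, Q i j * b j) k]
    exact (Δ ⊓ posLinear).mul_mem ⟨mem_trans.1 ((hτ _).2 ⟨b, fun i => rfl⟩),
      fun i => ⟨1, one_pos, by simp⟩⟩ (zpow_mem hg k)

end Aff2

/-! ### Hyperbolic toral automorphisms -/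

/-- An integral matrix of determinant one as a real matrix. -/
def rmat (A : SL(2, ℤ)) : Matrix (Fin 2) (Fin 2) ℝ := A.1.map (Int.cast : ℤ → ℝ)

lemma rmat_mul (A B : SL(2, ℤ)) : rmat (A * B) = rmat A * rmat B := by
  simp only [rmat, Matrix.SpecialLinearGroup.coe_mul]
  exact Matrix.map_mul (f := Int.castRingHom ℝ)

lemma det_rmat (A : SL(2, ℤ)) : (rmat A).det = 1 := by
  have := RingHom.map_det (Int.castRingHom ℝ) A.1
  rw [A.2, map_one] at this
  exact this.symm

/-- A hyperbolic toral automorphism has trace of absolute value greater than two, as otherwise the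
roots of its characteristic polynomial are conjugate and of product one. -/
lemma IsHyperbolicToralAut.two_lt_abs_trace {A : SL(2, ℤ)} (hA : IsHyperbolicToralAut A) :
    2 < |A.1 0 0 + A.1 1 1| := by
  by_contra! hle
  set t : ℤ := A.1 0 0 + A.1 1 1 with ht
  have hdet : A.1 0 0 * A.1 1 1 - A.1 0 1 * A.1 1 0 = 1 := by
    rw [← Matrix.det_fin_two]; exact A.2
  have hdisc : (0 : ℝ) ≤ 1 - (t / 2 : ℝ) ^ 2 := by
    have h1 : |(t : ℝ)| ≤ 2 := by exact_mod_cast hle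
    obtain ⟨h2, h3⟩ := abs_le.1 h1
    nlinarith
  set μ : ℂ := ⟨t / 2, Real.sqrt (1 - (t / 2) ^ 2)⟩ with hμ
  have hsq := Real.sq_sqrt hdisc
  have hnorm : ‖μ‖ = 1 := by
    rw [← sq_eq_sq₀ (norm_nonneg _) zero_le_one, ← Complex.normSq_eq_norm_sq, Complex.normSq_mk]
    nlinarith
  have hroot : μ * μ - t * μ + 1 = 0 := by
    apply Complex.ext
    · simp [hμ]; nlinarith
    · simp [hμ]; ring
  have hdet' : ((A.1 0 0 : ℂ)) * A.1 1 1 - A.1 0 1 * A.1 1 0 = 1 := by exact_mod_cast hdet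
  have hsing : (cmat A - Matrix.scalar (Fin 2) μ).det = 0 := by
    rw [Matrix.det_fin_two]
    have ht' : (t : ℂ) = A.1 0 0 + A.1 1 1 := by rw [ht]; push_cast; rfl
    rw [ht'] at hroot
    simp [cmat]
    linear_combination hroot + hdet'
  obtain ⟨v, hv, hv0⟩ := Matrix.exists_mulVec_eq_zero_iff.2 hsing
  refine hA μ (Module.End.hasEigenvalue_of_hasEigenvector (x := v) ⟨?_, hv⟩) hnorm
  rw [Module.End.mem_eigenspace_iff, Matrix.toLin'_apply]
  rw [Matrix.sub_mulVec, sub_eq_zero] at hv0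
  rw [show A.1.map (Int.cast : ℤ → ℂ) = cmat A from rfl, hv0]
  ext i
  simp [Matrix.scalar_apply, Matrix.mulVec_diagonal]

/-- Real diagonalization; the rows of `Q` are the row eigenvectors `(A₁₀, λ - A₀₀)`. -/
lemma IsHyperbolicToralAut.exists_diagonalization {A : SL(2, ℤ)} (hA : IsHyperbolicToralAut A) :
    ∃ (r : ℝ) (Q : Matrix (Fin 2) (Fin 2) ℝ), 1 < |r| ∧ Q.det ≠ 0 ∧ (∀ i, Q i 0 ≠ 0) ∧
      Q * rmat A = Matrix.diagonal ![r, r⁻¹] * Q := by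
  have htr := hA.two_lt_abs_trace
  have hdet : A.1 0 0 * A.1 1 1 - A.1 0 1 * A.1 1 0 = 1 := by
    rw [← Matrix.det_fin_two]; exact A.2
  -- a triangular integral matrix of determinant one has trace `±2`
  have hc : A.1 1 0 ≠ 0 := by
    intro h0
    rw [h0, mul_zero, sub_zero] at hdet
    rcases Int.mul_eq_one_iff_eq_one_or_neg_one.1 hdet with ⟨h1, h2⟩ | ⟨h1, h2⟩ <;>
      simp [h1, h2] at htr
  set t : ℝ := ((A.1 0 0 + A.1 1 1 : ℤ) : ℝ) with ht
  have htr' : 2 < |t| := by rw [ht]; exact_mod_cast htr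
  have hdisc : 0 < t ^ 2 - 4 := by
    have := sq_abs t
    nlinarith
  have hs := Real.sq_sqrt hdisc.le
  have hspos := Real.sqrt_pos.2 hdisc
  obtain ⟨r, hr, hroot⟩ : ∃ r : ℝ, 1 < |r| ∧ r ^ 2 - t * r + 1 = 0 := by
    rcases lt_or_ge 0 t with h | h
    · refine ⟨(t + Real.sqrt (t ^ 2 - 4)) / 2, ?_, by nlinarith⟩
      rw [abs_of_pos h] at htr'
      rw [abs_of_pos (by positivity)]
      linarith
    · refine ⟨(t - Real.sqrt (t ^ 2 - 4)) / 2, ?_, by nlinarith⟩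
      rw [abs_of_nonpos h] at htr'
      rw [abs_of_neg (by linarith)]
      linarith
  have hr0 : r ≠ 0 := by
    rintro rfl
    simp at hr
    linarith
  have hrr : r⁻¹ ≠ r := by
    intro h
    have h1 : r * r = 1 := by rw [← mul_inv_cancel₀ hr0, h]
    have := abs_mul_abs_self r
    nlinarith
  have hroot' : r⁻¹ ^ 2 - t * r⁻¹ + 1 = 0 := by
    field_simp
    linear_combination hroot
  have hcr : (A.1 1 0 : ℝ) ≠ 0 := by exact_mod_cast hc
  have hdet' : ((A.1 0 0 : ℝ)) * A.1 1 1 - A.1 0 1 * A.1 1 0 = 1 := by exact_mod_cast hdet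
  have ht' : t = A.1 0 0 + A.1 1 1 := by rw [ht]; push_cast; rfl
  rw [ht'] at hroot hroot'
  refine ⟨r, !![(A.1 1 0 : ℝ), r - A.1 0 0; (A.1 1 0 : ℝ), r⁻¹ - A.1 0 0], hr, ?_, ?_, ?_⟩
  · rw [Matrix.det_fin_two]
    have : (A.1 1 0 : ℝ) * (r⁻¹ - r) ≠ 0 := mul_ne_zero hcr (sub_ne_zero.2 hrr)
    intro h
    apply this
    simp at h
    linear_combination h
  · intro i
    fin_cases i <;> simpa using hc
  · have h00 : (A.1 1 0 : ℝ) * A.1 0 0 + (r - A.1 0 0) * A.1 1 0 = r * A.1 1 0 := by ring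
    have h01 : (A.1 1 0 : ℝ) * A.1 0 1 + (r - A.1 0 0) * A.1 1 1 = r * (r - A.1 0 0) := by
      linear_combination -hroot - hdet'
    have h10 : (A.1 1 0 : ℝ) * A.1 0 0 + (r⁻¹ - A.1 0 0) * A.1 1 0 = r⁻¹ * A.1 1 0 := by ring
    have h11 : (A.1 1 0 : ℝ) * A.1 0 1 + (r⁻¹ - A.1 0 0) * A.1 1 1 = r⁻¹ * (r⁻¹ - A.1 0 0) := by
      linear_combination -hroot' - hdet'
    ext i j
    fin_cases i <;> fin_cases j <;> simpa [Matrix.mul_apply, Fin.sum_univ_two, rmat]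

/-- An additive homomorphism from `ℤ²` to `ℝ` with zero isolated in its image is not injective, as
its image is cyclic. -/
lemma not_injective_of_isolated_zero (F : ℤ × ℤ →+ ℝ) {ε : ℝ} (hε : 0 < ε)
    (h : ∀ z, ¬ (0 < F z ∧ F z < ε)) : ¬ Function.Injective F := by
  intro hinj
  obtain ⟨b, hb⟩ := AddSubgroup.cyclic_of_isolated_zero (H := F.range) hε (by
    rw [Set.disjoint_left]
    rintro _ ⟨z, rfl⟩ hz
    exact h z hz)
  obtain ⟨g, hg⟩ : b ∈ F.range := hb ▸ AddSubgroup.subset_closure rfl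
  have hall : ∀ z, ∃ n : ℤ, n • g = z := by
    intro z
    have : F z ∈ AddSubgroup.closure {b} := hb ▸ ⟨z, rfl⟩
    obtain ⟨n, hn⟩ := AddSubgroup.mem_closure_singleton.1 this
    exact ⟨n, hinj (by rw [map_zsmul, hg, hn])⟩
  obtain ⟨m, hm⟩ := hall (1, 0)
  obtain ⟨n, hn⟩ := hall (0, 1)
  simp only [Prod.ext_iff, Prod.smul_fst, Prod.smul_snd, smul_eq_mul] at hm hn
  have hm0 : m ≠ 0 := by
    rintro rfl
    simp at hm
  have hg2 : g.2 = 0 := by simpa [hm0] using hm.2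
  simp [hg2] at hn

/-- No two commuting matrices of `SL(2, ℤ)` satisfy the conditions imposed on the data of a group
`Γ_{A,B,ν}`: on the common eigenbasis, the logarithm of the absolute value of the first eigenvalue
would be an injective homomorphism from `ℤ²` to `ℝ`, with image discrete since traces are
integral. -/
lemma not_toralTwoData {A B : SL(2, ℤ)} {ν : Fin 2 → ℚ} : ¬ ToralTwoData A B ν := by
  rintro ⟨⟨e⟩, hhyp, -⟩
  let M : ℤ × ℤ → SL(2, ℤ) := fun z => (e.symm (Multiplicative.ofAdd z)).1
  have hM : ∀ z, z ≠ 0 → IsHyperbolicToralAut (M z) := by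
    intro z hz
    refine hhyp _ (e.symm _).2 fun h => hz ?_
    have h1 : e.symm (Multiplicative.ofAdd z) = 1 := Subtype.ext h
    rwa [MulEquiv.map_eq_one_iff, ofAdd_eq_one] at h1
  have hadd : ∀ z w, M (z + w) = M z * M w := by
    intro z w
    simp [M, ofAdd_add]
  obtain ⟨r, Q, hr, hQ, -, hQA⟩ := (hM (1, 0) (by simp)).exists_diagonalization
  have hr0 : r ≠ 0 := by
    rintro rfl
    simp at hr
    linarith
  have hu : IsUnit Q.det := hQ.isUnit
  let N : ℤ × ℤ → Matrix (Fin 2) (Fin 2) ℝ := fun z => Q * rmat (M z) * Q⁻¹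
  have hNadd : ∀ z w, N (z + w) = N z * N w := by
    intro z w
    simp only [N, hadd, rmat_mul]
    calc Q * (rmat (M z) * rmat (M w)) * Q⁻¹ = Q * rmat (M z) * 1 * rmat (M w) * Q⁻¹ := by
          simp only [mul_assoc, one_mul]
      _ = _ := by rw [← Matrix.nonsing_inv_mul Q hu]; simp only [mul_assoc]
  have hN1 : N (1, 0) = Matrix.diagonal ![r, r⁻¹] := by
    simp only [N, hQA]
    rw [mul_assoc, Matrix.mul_nonsing_inv Q hu, mul_one]
  have hr2 : r⁻¹ ≠ r := by
    intro h
    have h1 : r * r = 1 := by rw [← mul_inv_cancel₀ hr0, h]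
    have := abs_mul_abs_self r
    nlinarith
  -- `N z` commutes with a diagonal matrix with distinct entries
  have hN01 : ∀ z, N z 0 1 = 0 := by
    intro z
    have h1 : N z * N (1, 0) = N (1, 0) * N z := by rw [← hNadd, ← hNadd, add_comm]
    have h2 := congrFun (congrFun h1 0) 1
    rw [hN1, Matrix.mul_diagonal, Matrix.diagonal_mul] at h2
    simp at h2
    have : N z 0 1 * (r⁻¹ - r) = 0 := by linear_combination h2
    exact (mul_eq_zero.1 this).resolve_right (sub_ne_zero.2 hr2)
  have hdet : ∀ z, N z 0 0 * N z 1 1 = 1 := by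
    intro z
    have h1 : (N z).det = 1 := by
      simp only [N, Matrix.det_mul, det_rmat, mul_one]
      rw [← Matrix.det_mul, Matrix.mul_nonsing_inv Q hu, Matrix.det_one]
    rw [Matrix.det_fin_two, hN01, zero_mul, sub_zero] at h1
    exact h1
  have htrace : ∀ z, N z 0 0 + N z 1 1 = ((M z).1 0 0 + (M z).1 1 1 : ℤ) := by
    intro z
    have h1 : (N z).trace = (rmat (M z)).trace := by
      simp only [N]
      rw [Matrix.trace_mul_comm, ← mul_assoc, Matrix.nonsing_inv_mul Q hu, one_mul]
    rw [Matrix.trace_fin_two, Matrix.trace_fin_two] at h1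
    rw [h1]
    simp [rmat]
  have hne : ∀ z, N z 0 0 ≠ 0 := fun z h0 => by simpa [h0] using hdet z
  have habs : ∀ z, |N z 0 0| + |N z 0 0|⁻¹ = ((|(M z).1 0 0 + (M z).1 1 1| : ℤ) : ℝ) := by
    intro z
    have h1 : |N z 0 0|⁻¹ = |N z 1 1| := by
      rw [← abs_inv, inv_eq_of_mul_eq_one_right (hdet z)]
    rw [h1, Int.cast_abs, ← htrace]
    have hpos : 0 < N z 0 0 * N z 1 1 := by rw [hdet]; exact one_pos
    rcases mul_pos_iff.1 hpos with ⟨h2, h3⟩ | ⟨h2, h3⟩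
    · rw [abs_of_pos h2, abs_of_pos h3, abs_of_pos (by linarith)]
    · rw [abs_of_neg h2, abs_of_neg h3, abs_of_neg (by linarith)]
      ring
  let F : ℤ × ℤ →+ ℝ := AddMonoidHom.mk' (fun z => Real.log |N z 0 0|) (by
    intro z w
    rw [hNadd, Matrix.mul_apply, Fin.sum_univ_two, hN01, zero_mul, add_zero, abs_mul,
      Real.log_mul (abs_ne_zero.2 (hne z)) (abs_ne_zero.2 (hne w))])
  have hF : ∀ z, F z = Real.log |N z 0 0| := fun z => rfl
  refine not_injective_of_isolated_zero F (Real.log_pos one_lt_two) ?_ ?_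
  · rintro z ⟨h1, h2⟩
    have hp : 0 < |N z 0 0| := abs_pos.2 (hne z)
    rw [hF] at h1 h2
    have h3 : 1 < |N z 0 0| := (Real.log_pos_iff hp.le).1 h1
    have h4 : |N z 0 0| < 2 := (Real.log_lt_log_iff hp two_pos).1 h2
    set x := |N z 0 0| with hx
    have hz0 : z ≠ 0 := by
      rintro rfl
      exact h1.ne' ((hF 0).symm.trans (map_zero F))
    have h5 : 3 ≤ |(M z).1 0 0 + (M z).1 1 1| := (hM z hz0).two_lt_abs_trace
    -- `x + x⁻¹` is an integer larger than `2`, so that `x` is at least `2`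
    have h6 : (3 : ℝ) ≤ x + x⁻¹ := by rw [habs z]; exact_mod_cast h5
    have h7 : x * x⁻¹ = 1 := mul_inv_cancel₀ hp.ne'
    nlinarith
  · rw [injective_iff_map_eq_zero]
    intro z hz
    by_contra hz0
    have hp : 0 < |N z 0 0| := abs_pos.2 (hne z)
    have h1 : |N z 0 0| = 1 := Real.eq_one_of_pos_of_log_eq_zero hp hz
    have h2 := habs z
    rw [h1] at h2
    have h3 := (hM z hz0).two_lt_abs_trace
    have h4 : (2 : ℝ) < ((|(M z).1 0 0 + (M z).1 1 1| : ℤ) : ℝ) := by exact_mod_cast h3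
    rw [← h2] at h4
    norm_num at h4

namespace Aff2

/-! ### The limit set of a group of real unimodular maps -/

/-- The elements are real, with linear part of determinant one. -/
structure IsRealUnimodular (Δ : Subgroup Aff2) : Prop where
  real_a : ∀ d ∈ Δ, ∀ i, ∃ x : ℝ, (d.a i : ℂ) = x
  real_b : ∀ d ∈ Δ, ∀ i, ∃ x : ℝ, d.b i = x
  det_eq_one : ∀ d ∈ Δ, d.a 0 * d.a 1 = 1

/-- The points one of whose affine coordinates is real, together with the line at infinity. The
coordinate `v i / v 2` is real exactly if `v i` times the conjugate of `v 2` is. -/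
def someReal : Set P2 := locus fun v => ∃ i : Fin 2, (v i.castSucc * (starRingEnd ℂ) (v 2)).im = 0

/-- The points with real affine coordinates, together with the line at infinity. -/
def allReal : Set P2 := locus fun v => ∀ i : Fin 2, (v i.castSucc * (starRingEnd ℂ) (v 2)).im = 0

lemma im_smul_mul_conj {c x y : ℂ} (h : (x * (starRingEnd ℂ) y).im = 0) :
    (c * x * (starRingEnd ℂ) (c * y)).im = 0 := by
  have : c * x * (starRingEnd ℂ) (c * y) = (Complex.normSq c : ℂ) * (x * (starRingEnd ℂ) y) := by
    rw [← Complex.mul_conj, map_mul]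
    ring
  rw [this, Complex.im_ofReal_mul, h, mul_zero]

lemma homogeneous_someReal :
    Homogeneous fun v => ∃ i : Fin 2, (v i.castSucc * (starRingEnd ℂ) (v 2)).im = 0 := by
  rintro c v _ ⟨i, hi⟩
  exact ⟨i, im_smul_mul_conj hi⟩

lemma homogeneous_allReal :
    Homogeneous fun v => ∀ i : Fin 2, (v i.castSucc * (starRingEnd ℂ) (v 2)).im = 0 :=
  fun _ _ _ h i => im_smul_mul_conj (h i)

lemma isClosed_im_eq (i : Fin 2) :
    IsClosed {v : Fin 3 → ℂ | (v i.castSucc * (starRingEnd ℂ) (v 2)).im = 0} :=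
  isClosed_eq (Complex.continuous_im.comp (by fun_prop)) continuous_const

lemma isClosed_someReal : IsClosed someReal := by
  refine isClosed_locus homogeneous_someReal ?_
  have : {v : Fin 3 → ℂ | ∃ i : Fin 2, (v i.castSucc * (starRingEnd ℂ) (v 2)).im = 0} =
      ⋃ i : Fin 2, {v : Fin 3 → ℂ | (v i.castSucc * (starRingEnd ℂ) (v 2)).im = 0} := by
    ext v
    simp
  rw [this]
  exact isClosed_iUnion_of_finite isClosed_im_eq

lemma isClosed_allReal : IsClosed allReal := by
  refine isClosed_locus homogeneous_allReal ?_
  have : {v : Fin 3 → ℂ | ∀ i : Fin 2, (v i.castSucc * (starRingEnd ℂ) (v 2)).im = 0} =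
      ⋂ i : Fin 2, {v : Fin 3 → ℂ | (v i.castSucc * (starRingEnd ℂ) (v 2)).im = 0} := by
    ext v
    simp
  rw [this]
  exact isClosed_iInter isClosed_im_eq

lemma vec_castSucc (w : Fin 2 → ℂ) (i : Fin 2) : (![w 0, w 1, 1] : Fin 3 → ℂ) i.castSucc = w i := by
  fin_cases i <;> rfl

lemma pt_mem_someReal {w : Fin 2 → ℂ} : pt w ∈ someReal ↔ ∃ i, (w i).im = 0 := by
  rw [someReal, pt_mem_locus homogeneous_someReal]
  simp only [vec_castSucc]
  simp

lemma pt_mem_allReal {w : Fin 2 → ℂ} : pt w ∈ allReal ↔ ∀ i, (w i).im = 0 := by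
  rw [allReal, pt_mem_locus homogeneous_allReal]
  simp only [vec_castSucc]
  simp

lemma lineInf_subset_allReal : lineInf ⊆ allReal := by
  intro p hp v hv hvp i
  have : v 2 = 0 := hp v hv hvp
  simp [this]

/-- The limit matrices of a real group are real up to a factor, so that the finite points of their
kernels have a real coordinate. -/
lemma IsRealUnimodular.limitSet_subset {Δ : Subgroup Aff2} (hΔ : DiscreteTopology (Δ.map toProj))
    (h : IsRealUnimodular Δ) : limitSet (Δ.map toProj) ⊆ someReal := by
  refine limitSet_subset_of_kernels hΔ isClosed_someReal ?_ ?_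
  · rintro _ ⟨d, hd, rfl⟩ p hp
    by_cases hpi : p ∈ lineInf
    · obtain ⟨v, hv, rfl⟩ := exists_pr p
      have hv2 : v 2 = 0 := (pr_mem_lineInf hv).1 hpi
      have hv' : d.mat *ᵥ v ≠ 0 := gl_mulVec_ne_zero (toGL d) hv
      change toProj d • pr v ∈ _
      rw [d.toProj_smul_pr hv, someReal, pr_mem_locus homogeneous_someReal hv', d.mat_mulVec]
      exact ⟨0, by simp [hv2]⟩
    · rw [← pt_coord hpi] at hp ⊢
      rw [toProj_smul_pt, pt_mem_someReal]
      obtain ⟨i, hi⟩ := pt_mem_someReal.1 hp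
      obtain ⟨x, hx⟩ := h.real_a d hd i
      obtain ⟨y, hy⟩ := h.real_b d hd i
      exact ⟨i, by simp [app, hx, hy, hi]⟩
  · intro S hS v hv hSv
    rw [someReal, pr_mem_locus homogeneous_someReal hv]
    by_cases hv2 : v 2 = 0
    · exact ⟨0, by simp [hv2]⟩
    obtain ⟨d, c, p, r, w, hd, hc, hp, hr, -, -, hne, hform⟩ := exists_of_isLimitMatrix hS
    rw [hform] at hSv
    have hcoord : ∀ j : Fin 2, p j * v j.castSucc + r j * v 2 = 0 := by
      intro j
      fin_cases j
      · simpa using congrFun hSv 0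
      · simpa using congrFun hSv 1
    have hw0 : w = 0 := by simpa [hv2] using congrFun hSv 2
    obtain ⟨i, hi⟩ : ∃ i, p i ≠ 0 := by
      by_contra! hp0
      have hr0 : r = 0 := by
        ext j
        have := hcoord j
        rw [hp0, zero_mul, zero_add] at this
        exact (mul_eq_zero.1 this).resolve_right hv2
      rcases hne with h | h | h
      exacts [h (funext hp0), h hr0, h hw0]
    -- `-r i / p i` is the coordinate `i` of the points of the kernel
    have hlim : Tendsto (fun m => ((c m * (d m).b i) / (c m * (d m).a i)).im) atTop
        (𝓝 (r i / p i).im) :=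
      (Complex.continuous_im.tendsto _).comp ((hr i).div (hp i) hi)
    have hreal : (r i / p i).im = 0 := by
      refine tendsto_nhds_unique hlim (tendsto_const_nhds.congr fun m => ?_)
      obtain ⟨x, hx⟩ := h.real_a _ (hd m) i
      obtain ⟨y, hy⟩ := h.real_b _ (hd m) i
      rw [mul_div_mul_left _ _ (hc m), hx, hy, ← Complex.ofReal_div, Complex.ofReal_im]
    refine ⟨i, ?_⟩
    have h1 : v i.castSucc = -(r i / p i) * v 2 := by
      field_simp
      linear_combination hcoord i
    rw [h1, mul_assoc, Complex.mul_conj, Complex.mul_im, Complex.ofReal_re, Complex.ofReal_im,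
      Complex.neg_im, hreal]
    simp

lemma IsRealUnimodular.a_eq_one {Δ : Subgroup Aff2} (h : IsRealUnimodular Δ) {d : Aff2}
    (hd : d ∈ Δ) {i : Fin 2} (hi : d.a i = 1) : d.a = 1 := by
  have h1 := h.det_eq_one d hd
  ext j
  fin_cases i <;> simp_all <;> fin_cases j <;> simp_all

lemma IsRealUnimodular.norm_eq_inv {Δ : Subgroup Aff2} (h : IsRealUnimodular Δ) {d : Aff2}
    (hd : d ∈ Δ) {i j : Fin 2} (hij : i ≠ j) : ‖(d.a j : ℂ)‖ = ‖(d.a i : ℂ)‖⁻¹ := by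
  have h1 : ‖(d.a 0 : ℂ)‖ * ‖(d.a 1 : ℂ)‖ = 1 := by
    rw [← norm_mul, ← Units.val_mul, h.det_eq_one d hd, Units.val_one, norm_one]
  fin_cases i <;> fin_cases j
  · exact absurd rfl hij
  · exact eq_inv_of_mul_eq_one_right h1
  · exact eq_inv_of_mul_eq_one_left h1
  · exact absurd rfl hij

/-- A nontrivial element fixing a finite point has linear part distinct from `1` in both
coordinates, so that its unique finite fixed point is real. -/
lemma IsRealUnimodular.L0_subset {Δ : Subgroup Aff2} (h : IsRealUnimodular Δ) :
    L0 (Δ.map toProj) ⊆ allReal := by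
  refine closure_minimal (fun p hp => ?_) isClosed_allReal
  by_cases hpi : p ∈ lineInf
  · exact lineInf_subset_allReal hpi
  obtain ⟨γ, ⟨hγ, hfix⟩, hγ1⟩ := hp.exists_notMem_finset {1}
  obtain ⟨d, hd, rfl⟩ := hγ
  rw [← pt_coord hpi] at hfix ⊢
  change toProj d • _ = _ at hfix
  rw [toProj_smul_pt] at hfix
  have hfix' := pt_injective hfix
  rw [pt_mem_allReal]
  intro i
  have h1 : ∀ i, d.a i * coord p i + d.b i = coord p i := fun i => congrFun hfix' i
  have hne : (d.a i : ℂ) ≠ 1 := by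
    intro h0
    apply hγ1
    have ha := h.a_eq_one hd (Units.ext h0)
    have : d = 1 := by
      ext j
      · rw [ha]; rfl
      · have := h1 j
        rw [ha] at this
        simpa using this
    rw [this]
    simp
  obtain ⟨x, hx⟩ := h.real_a d hd i
  obtain ⟨y, hy⟩ := h.real_b d hd i
  have h2 := h1 i
  rw [hx] at hne h2
  rw [hy] at h2
  have h3 : (1 : ℂ) - x ≠ 0 := sub_ne_zero.2 hne.symm
  have h4 : coord p i = ((y / (1 - x) : ℝ) : ℂ) := by
    push_cast
    field_simp
    linear_combination -h2
  rw [h4, Complex.ofReal_im]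

/-- If an orbit of a non-real point accumulated at a non-real point, then along it linear parts, and
so translation parts, would be bounded. -/
lemma IsRealUnimodular.L1_subset {Δ : Subgroup Aff2} (hΔ : DiscreteTopology (Δ.map toProj))
    (h : IsRealUnimodular Δ) : L1 (Δ.map toProj) ⊆ allReal := by
  refine closure_minimal ?_ isClosed_allReal
  rintro q ⟨z, -, k, γ, hk, hγ, hinj, hlim⟩
  by_cases hqi : q ∈ lineInf
  · exact lineInf_subset_allReal hqi
  choose d hd hdγ using hγ
  have hkz : ∀ m, k m = z := hk
  have hzi : z ∉ lineInf := by
    intro hz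
    refine hqi (isClosed_lineInf.mem_of_tendsto hlim (Eventually.of_forall fun m => ?_))
    obtain ⟨v, hv, rfl⟩ := exists_pr z
    have hv2 : v 2 = 0 := (pr_mem_lineInf hv).1 hz
    have hv' : (d m).mat *ᵥ v ≠ 0 := gl_mulVec_ne_zero (toGL (d m)) hv
    rw [hkz, ← hdγ m, (d m).toProj_smul_pr hv, pr_mem_lineInf hv', (d m).mat_mulVec]
    simpa using hv2
  have hlim1 : Tendsto (fun m => (d m).app (coord z)) atTop (𝓝 (coord q)) := by
    have h1 : Tendsto (fun m => pt ((d m).app (coord z))) atTop (𝓝 q) := by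
      refine hlim.congr fun m => ?_
      rw [hkz, ← hdγ m, ← pt_coord hzi, toProj_smul_pt, pt_coord hzi]
    have := (continuousAt_coord hqi).tendsto.comp h1
    simpa [Function.comp_def, coord_pt] using this
  rw [← pt_coord hqi, pt_mem_allReal]
  by_contra! hcon
  obtain ⟨i, hi⟩ := hcon
  have hlimi : ∀ i, Tendsto (fun m => (d m).app (coord z) i) atTop (𝓝 (coord q i)) :=
    tendsto_pi_nhds.1 hlim1
  -- real elements multiply imaginary parts by their linear part
  have him : Tendsto (fun m => ‖((d m).a i : ℂ)‖ * |(coord z i).im|) atTop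
      (𝓝 |(coord q i).im|) := by
    refine (((Complex.continuous_im.tendsto _).comp (hlimi i)).abs).congr fun m => ?_
    obtain ⟨x, hx⟩ := h.real_a _ (hd m) i
    obtain ⟨y, hy⟩ := h.real_b _ (hd m) i
    simp [app, hx, hy, abs_mul]
  have hz0 : |(coord z i).im| ≠ 0 := by
    intro h0
    simp only [h0, mul_zero] at him
    exact hi (abs_eq_zero.1 (tendsto_nhds_unique him tendsto_const_nhds))
  have hai : Tendsto (fun m => ‖((d m).a i : ℂ)‖) atTop
      (𝓝 (|(coord q i).im| / |(coord z i).im|)) := by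
    refine (him.div_const _).congr fun m => ?_
    field_simp
  have hpos : |(coord q i).im| / |(coord z i).im| ≠ 0 := div_ne_zero (abs_ne_zero.2 hi) hz0
  -- the other linear part is the inverse
  have hall : ∀ j, ∃ ℓ ≠ 0, Tendsto (fun m => ‖((d m).a j : ℂ)‖) atTop (𝓝 ℓ) := by
    intro j
    by_cases hij : i = j
    · subst hij
      exact ⟨_, hpos, hai⟩
    · refine ⟨_, inv_ne_zero hpos, (hai.inv₀ hpos).congr fun m => ?_⟩
      rw [h.norm_eq_inv (hd m) hij]
  -- all the entries are bounded
  have hbdd : ∃ R : ℝ, ∀ m, ∀ j, ‖((d m).a j : ℂ)‖ ≤ R ∧ ‖(((d m).a j)⁻¹ : ℂ)‖ ≤ R ∧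
      ‖(d m).b j‖ ≤ R := by
    have hj : ∀ j, ∃ R : ℝ, ∀ m, ‖((d m).a j : ℂ)‖ ≤ R ∧ ‖(((d m).a j)⁻¹ : ℂ)‖ ≤ R ∧
        ‖(d m).b j‖ ≤ R := by
      intro j
      obtain ⟨ℓ, hℓ, ha⟩ := hall j
      have hinv : Tendsto (fun m => ‖(((d m).a j)⁻¹ : ℂ)‖) atTop (𝓝 ℓ⁻¹) := by
        refine (ha.inv₀ hℓ).congr fun m => ?_
        rw [norm_inv]
      have hsum : Tendsto (fun m => ‖(d m).app (coord z) j‖ + ‖((d m).a j : ℂ)‖ * ‖coord z j‖)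
          atTop (𝓝 (‖coord q j‖ + ℓ * ‖coord z j‖)) := (hlimi j).norm.add (ha.mul_const _)
      obtain ⟨R1, h1⟩ := ha.bddAbove_range
      obtain ⟨R2, h2⟩ := hinv.bddAbove_range
      obtain ⟨R3, h3⟩ := hsum.bddAbove_range
      refine ⟨max R1 (max R2 R3), fun m => ⟨?_, ?_, ?_⟩⟩
      · exact (h1 ⟨m, rfl⟩).trans (le_max_left _ _)
      · exact (h2 ⟨m, rfl⟩).trans ((le_max_left _ _).trans (le_max_right _ _))
      · refine le_trans ?_ ((h3 ⟨m, rfl⟩).trans ((le_max_right _ _).trans (le_max_right _ _)))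
        have : (d m).b j = (d m).app (coord z) j - (d m).a j * coord z j := by simp [app]
        rw [this]
        exact (norm_sub_le _ _).trans_eq (by rw [norm_mul])
    choose R hR using hj
    refine ⟨max (R 0) (R 1), fun m j => ?_⟩
    have hRj : R j ≤ max (R 0) (R 1) := by
      fin_cases j
      exacts [le_max_left _ _, le_max_right _ _]
    obtain ⟨h1, h2, h3⟩ := hR j m
    exact ⟨h1.trans hRj, h2.trans hRj, h3.trans hRj⟩
  obtain ⟨R, hR⟩ := hbdd
  have hdinj : Function.Injective d := fun m n hmn => hinj (by rw [← hdγ m, ← hdγ n, hmn])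
  refine Set.infinite_range_of_injective hdinj ((finite_of_bounded hΔ R).subset ?_)
  rintro _ ⟨m, rfl⟩
  exact ⟨hd m, hR m⟩

/-- The line `w j = σ j` consists of cluster points of the compact set formed by the points
`(a^{-m} (w i - σ i), I)` and their limit `(0, I)`, with linear maps expanding the coordinate `i`
and contracting the coordinate `j`, followed by the translation by `σ`. -/
lemma IsRealUnimodular.line_subset_L2 {Δ : Subgroup Aff2} (hΔ : DiscreteTopology (Δ.map toProj))
    (h : IsRealUnimodular Δ) {e : Aff2} (he : e ∈ Δ) (heb : e.b = 0) {i j : Fin 2} (hij : i ≠ j)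
    (hi : 1 < ‖(e.a i : ℂ)‖) {σ : Fin 2 → ℂ} (hσ : σ ∈ trans Δ) {w : Fin 2 → ℂ}
    (hw : w j = σ j) : pt w ∈ L2 (Δ.map toProj) := by
  have hall : ∀ k, k = i ∨ k = j := by omega
  have hj : ‖(e.a j : ℂ)‖ < 1 := by
    rw [h.norm_eq_inv he hij]
    exact inv_lt_one_of_one_lt₀ hi
  have heo : e.app 0 = 0 := by
    ext k
    simp [app, heb]
  have hpow : ∀ m : ℕ, (e ^ m).b = 0 := by
    intro m
    have := pow_app_fixed heo m
    ext k
    simpa [app] using congrFun this k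
  let z : ℕ → Fin 2 → ℂ := fun m k => if k = i then ((e.a i : ℂ) ^ m)⁻¹ * (w i - σ i) else Complex.I
  let z' : Fin 2 → ℂ := fun k => if k = i then 0 else Complex.I
  have hinv : Tendsto (fun m : ℕ => ((e.a i : ℂ) ^ m)⁻¹) atTop (𝓝 0) := by
    simp_rw [← inv_pow]
    exact tendsto_pow_atTop_nhds_zero_of_norm_lt_one (by
      rw [norm_inv]; exact inv_lt_one_of_one_lt₀ hi)
  have hz : Tendsto z atTop (𝓝 z') := by
    rw [tendsto_pi_nhds]
    intro k
    rcases hall k with rfl | rfl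
    · simpa [z, z'] using hinv.mul_const (w k - σ k)
    · simp [z, z', hij.symm]
  have hzj : ∀ m, z m j = Complex.I := fun m => by simp [z, hij.symm]
  have hz'j : z' j = Complex.I := by simp [z', hij.symm]
  let K : Set P2 := pt '' insert z' (Set.range z)
  have hK : IsCompact K := hz.isCompact_insert_range.image continuous_pt
  refine subset_closure ⟨K, hK, ?_, fun m => pt (z m),
    fun m => toProj ((⟨1, σ⟩ : Aff2) * e ^ m), fun m => ⟨z m, Or.inr ⟨m, rfl⟩, rfl⟩, ?_, ?_, ?_⟩
  · have hIm : ∀ y : Fin 2 → ℂ, y j = Complex.I →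
        pt y ∈ (L0 (Δ.map toProj) ∪ L1 (Δ.map toProj))ᶜ := by
      intro y hy hmem
      have := pt_mem_allReal.1 (Set.union_subset h.L0_subset (h.L1_subset hΔ) hmem) j
      rw [hy, Complex.I_im] at this
      exact one_ne_zero this
    rintro _ ⟨y, rfl | ⟨m, rfl⟩, rfl⟩
    · exact hIm _ hz'j
    · exact hIm _ (hzj m)
  · exact fun m => Subgroup.mem_map_of_mem _ (Δ.mul_mem (mem_trans.1 hσ) (Δ.pow_mem he m))
  · refine toProj_injective.comp fun m n hmn => ?_
    have h1 := congrArg (fun d : Aff2 => d.a i) (mul_left_cancel hmn)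
    simp only [pow_a, Pi.pow_apply] at h1
    have h2 := congrArg (fun x : ℂˣ => ‖(x : ℂ)‖) h1
    simp only [Units.val_pow_eq_pow_val, norm_pow] at h2
    exact pow_right_injective₀ (one_pos.trans hi) hi.ne' h2
  · simp_rw [toProj_smul_pt]
    refine (continuous_pt.tendsto w).comp (tendsto_pi_nhds.2 fun k => ?_)
    have happ : ∀ m, ((⟨1, σ⟩ : Aff2) * e ^ m).app (z m) k = (e.a k : ℂ) ^ m * z m k + σ k := by
      intro m
      simp [app, pow_a, hpow]
    simp_rw [happ]
    rcases hall k with rfl | rfl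
    · refine tendsto_const_nhds.congr fun m => ?_
      have := (e.a k).ne_zero
      simp only [z, if_true]
      field_simp
      ring
    · rw [hw]
      simp_rw [hzj]
      simpa using ((tendsto_pow_atTop_nhds_zero_of_norm_lt_one hj).mul_const
        Complex.I).add_const (σ k)

end Aff2

/-! ### Complex lines -/

lemma pr_submodule_le_iff {v : Fin 3 → ℂ} (hv : v ≠ 0) {W : Submodule ℂ (Fin 3 → ℂ)} :
    (pr v).submodule ≤ W ↔ v ∈ W := by
  rw [pr_of_ne hv, Projectivization.submodule_mk, Submodule.span_singleton_le_iff_mem]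

lemma homogeneous_dotProduct (n : Fin 3 → ℂ) : Homogeneous fun v => n ⬝ᵥ v = 0 :=
  fun c v _ (h : n ⬝ᵥ v = 0) => show n ⬝ᵥ (c • v) = 0 by rw [dotProduct_smul, h, smul_zero]

/-- A nonzero linear form defines a complex line. -/
lemma isComplexLine_of_normal {n : Fin 3 → ℂ} (hn : n ≠ 0) :
    IsComplexLine (locus fun v => n ⬝ᵥ v = 0) := by
  let f : (Fin 3 → ℂ) →ₗ[ℂ] ℂ := dotProductBilin ℂ ℂ n
  have hf : ∀ v, f v = n ⬝ᵥ v := fun v => rfl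
  refine ⟨f.ker, ?_, ?_⟩
  · have h1 := f.finrank_range_add_finrank_ker
    have h2 : f.range = ⊤ := by
      rw [LinearMap.range_eq_top]
      refine LinearMap.surjective ?_
      intro h0
      apply hn
      exact dotProduct_eq_zero n fun v => by rw [← hf, h0, LinearMap.zero_apply]
    rw [h2] at h1
    simp at h1
    omega
  · ext p
    obtain ⟨v, hv, rfl⟩ := exists_pr p
    rw [pr_mem_locus (homogeneous_dotProduct n) hv, Set.mem_ofPred_eq, pr_submodule_le_iff hv,
      LinearMap.mem_ker, hf]

/-- Every complex line is the zero set of a nonzero linear form. -/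
lemma IsComplexLine.exists_normal {l : Set P2} (hl : IsComplexLine l) :
    ∃ n : Fin 3 → ℂ, n ≠ 0 ∧ l = locus fun v => n ⬝ᵥ v = 0 := by
  obtain ⟨W, hW, rfl⟩ := hl
  have hlt : W < ⊤ := by
    rw [lt_top_iff_ne_top]
    rintro rfl
    simp at hW
  obtain ⟨f, hf0, hf⟩ := Submodule.exists_le_ker_of_lt_top W hlt
  let n : Fin 3 → ℂ := fun i => f (Pi.single i 1)
  have hfn : ∀ v, f v = n ⬝ᵥ v := by
    intro v
    conv_lhs => rw [LinearMap.pi_apply_eq_sum_univ f v]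
    simp [n, dotProduct, mul_comm, ← Pi.single_apply]
    refine Finset.sum_congr rfl fun i _ => ?_
    congr 2
    ext j
    simp [Pi.single_apply, eq_comm]
  have hn : n ≠ 0 := by
    intro h0
    apply hf0
    ext v
    simp [hfn, h0]
  have hker : W = f.ker := by
    refine Submodule.eq_of_le_of_finrank_eq hf ?_
    have h1 := f.finrank_range_add_finrank_ker
    have h2 : f.range = ⊤ := LinearMap.range_eq_top.2 (LinearMap.surjective hf0)
    rw [h2] at h1
    simp at h1
    omega
  refine ⟨n, hn, ?_⟩
  ext p
  obtain ⟨v, hv, rfl⟩ := exists_pr p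
  rw [pr_mem_locus (homogeneous_dotProduct n) hv, Set.mem_ofPred_eq, pr_submodule_le_iff hv,
    hker, LinearMap.mem_ker, hfn]

/-- There is only one line through two distinct points. -/
lemma IsComplexLine.eq_of_mem {l m : Set P2} (hl : IsComplexLine l) (hm : IsComplexLine m)
    {p q : P2} (hpq : p ≠ q) (hpl : p ∈ l) (hql : q ∈ l) (hpm : p ∈ m) (hqm : q ∈ m) : l = m := by
  obtain ⟨u, hu, rfl⟩ := exists_pr p
  obtain ⟨v, hv, rfl⟩ := exists_pr q
  have hli : LinearIndependent ℂ ![u, v] := by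
    rw [LinearIndependent.pair_iff' hu]
    intro c hc
    have hc0 : c ≠ 0 := by
      rintro rfl
      exact hv (by simpa using hc.symm)
    exact hpq ((pr_eq_iff hv hu).2 ⟨c, hc0, hc.symm⟩).symm
  have h2 : Module.finrank ℂ (Submodule.span ℂ (Set.range ![u, v])) = 2 := by
    simpa using finrank_span_eq_card hli
  have key : ∀ W : Submodule ℂ (Fin 3 → ℂ), Module.finrank ℂ W = 2 → u ∈ W → v ∈ W →
      Submodule.span ℂ (Set.range ![u, v]) = W := by
    intro W hW huW hvW
    refine Submodule.eq_of_le_of_finrank_eq (Submodule.span_le.2 ?_) (h2.trans hW.symm)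
    rintro _ ⟨i, rfl⟩
    fin_cases i
    exacts [huW, hvW]
  obtain ⟨W, hW, rfl⟩ := hl
  obtain ⟨W', hW', rfl⟩ := hm
  simp only [Set.mem_ofPred_eq, pr_submodule_le_iff hu, pr_submodule_le_iff hv] at *
  rw [← key W hW hpl hql, ← key W' hW' hpm hqm]

lemma IsComplexLine.inter_nonempty {l m : Set P2} (hl : IsComplexLine l) (hm : IsComplexLine m) :
    (l ∩ m).Nonempty := by
  obtain ⟨W, hW, rfl⟩ := hl
  obtain ⟨W', hW', rfl⟩ := hm
  have h1 := Submodule.finrank_sup_add_finrank_inf_eq W W'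
  have h2 : Module.finrank ℂ (W ⊔ W' : Submodule ℂ (Fin 3 → ℂ)) ≤ 3 := by
    simpa using (W ⊔ W').finrank_le
  have h3 : W ⊓ W' ≠ ⊥ := by
    intro h0
    rw [h0, finrank_bot] at h1
    omega
  obtain ⟨v, hv, hv0⟩ := Submodule.exists_mem_ne_zero_of_ne_bot h3
  exact ⟨pr v, (pr_submodule_le_iff hv0).2 hv.1, (pr_submodule_le_iff hv0).2 hv.2⟩

lemma IsComplexLine.inter_subsingleton {l m : Set P2} (hl : IsComplexLine l)
    (hm : IsComplexLine m) (hlm : l ≠ m) : (l ∩ m).Subsingleton := by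
  intro p hp q hq
  by_contra hpq
  exact hlm (hl.eq_of_mem hm hpq hp.1 hq.1 hp.2 hq.2)

lemma IsComplexLine.smul {l : Set P2} (hl : IsComplexLine l) (g : PSL(3, ℂ)) :
    IsComplexLine (g • l) := by
  obtain ⟨n, hn, rfl⟩ := hl.exists_normal
  obtain ⟨M, rfl⟩ := QuotientGroup.mk_surjective g
  have hn' : n ᵥ* (M⁻¹).1 ≠ 0 := by
    intro h0
    apply hn
    have := congrArg (fun w => w ᵥ* M.1) h0
    simpa [Matrix.vecMul_vecMul, ← Matrix.SpecialLinearGroup.coe_mul,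
      -Matrix.SpecialLinearGroup.coe_inv] using this
  convert isComplexLine_of_normal hn' using 1
  ext p
  obtain ⟨v, hv, rfl⟩ := exists_pr p
  rw [Set.mem_smul_set_iff_inv_smul_mem, ← QuotientGroup.mk_inv, smul_pr _ hv,
    pr_mem_locus (homogeneous_dotProduct _) hv,
    pr_mem_locus (homogeneous_dotProduct _) (mulVec_ne_zero _ hv), Matrix.dotProduct_mulVec]

/-! ### Sets of lines in general position in the limit set -/

/-- The complex lines contained in the limit set. -/
def limitLines (Γ : Subgroup PSL(3, ℂ)) : Set (Set P2) :=
  {l | IsComplexLine l ∧ l ⊆ limitSet Γ}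

/-- The sets of lines counted by `LiG` are the sets of limit lines in general position. -/
lemma mem_LG_iff {Γ : Subgroup PSL(3, ℂ)} {S : Set (Set P2)} :
    S ∈ LG (discontinuityRegion Γ) ↔ S ⊆ limitLines Γ ∧ InGeneralPosition S := by
  simp only [LG, discontinuityRegion, compl_compl, Set.mem_ofPred_eq, Set.sUnion_subset_iff]
  constructor
  · rintro ⟨h1, h2, h3⟩
    exact ⟨fun l hl => ⟨h1 l hl, h3 l hl⟩, h2⟩
  · rintro ⟨h1, h2⟩
    exact ⟨fun l hl => (h1 hl).1, h2, fun l hl => (h1 hl).2⟩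

/-- The supremum `LiG` equals four exactly if it is attained by four lines and no more lines are
possible. -/
lemma LiG_eq_four_iff {Γ : Subgroup PSL(3, ℂ)} : LiG (discontinuityRegion Γ) = 4 ↔
    (∃ S ⊆ limitLines Γ, InGeneralPosition S ∧ S.encard = 4) ∧
      ∀ S ⊆ limitLines Γ, InGeneralPosition S → S.encard ≤ 4 := by
  constructor
  · intro h
    have hle : ∀ S ⊆ limitLines Γ, InGeneralPosition S → S.encard ≤ 4 := fun S h1 h2 =>
      h ▸ le_sSup ⟨S, mem_LG_iff.2 ⟨h1, h2⟩, rfl⟩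
    refine ⟨?_, hle⟩
    by_contra! hcon
    have h3 : LiG (discontinuityRegion Γ) ≤ 3 := by
      refine sSup_le ?_
      rintro _ ⟨S, hS, rfl⟩
      obtain ⟨h1, h2⟩ := mem_LG_iff.1 hS
      have h4 : S.encard < 3 + 1 := lt_of_le_of_ne (hle S h1 h2) (hcon S h1 h2)
      exact Order.le_of_lt_add_one h4
    rw [h] at h3
    exact absurd h3 (by decide)
  · rintro ⟨⟨S, h1, h2, h3⟩, hle⟩
    refine le_antisymm (sSup_le ?_) ?_
    · rintro _ ⟨T, hT, rfl⟩
      obtain ⟨h1, h2⟩ := mem_LG_iff.1 hT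
      exact hle T h1 h2
    · exact h3 ▸ le_sSup ⟨S, mem_LG_iff.2 ⟨h1, h2⟩, rfl⟩

lemma limitLines_conjBy (g : PSL(3, ℂ)) (Γ : Subgroup PSL(3, ℂ)) :
    limitLines (conjBy g Γ) = (fun l => g • l) '' limitLines Γ := by
  ext l
  constructor
  · rintro ⟨h1, h2⟩
    refine ⟨g⁻¹ • l, ⟨h1.smul _, ?_⟩, by simp⟩
    rw [limitSet_conjBy] at h2
    exact (Set.smul_set_subset_iff_subset_inv_smul_set (a := g⁻¹)).2 (by simpa using h2)
  · rintro ⟨l, ⟨h1, h2⟩, rfl⟩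
    exact ⟨h1.smul g, by rw [limitSet_conjBy]; exact Set.smul_set_mono h2⟩

lemma smul_limitLines {Γ : Subgroup PSL(3, ℂ)} {γ : PSL(3, ℂ)} (hγ : γ ∈ Γ) {l : Set P2}
    (hl : l ∈ limitLines Γ) : γ • l ∈ limitLines Γ := by
  rw [← conjBy_of_mem hγ, limitLines_conjBy]
  exact ⟨l, hl, rfl⟩

lemma InGeneralPosition.smul {S : Set (Set P2)} (hS : InGeneralPosition S) (g : PSL(3, ℂ)) :
    InGeneralPosition ((fun l => g • l) '' S) := by
  rintro _ ⟨a, ha, rfl⟩ _ ⟨b, hb, rfl⟩ _ ⟨c, hc, rfl⟩ hab hbc hac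
  have := hS a ha b hb c hc (fun h => hab (by rw [h])) (fun h => hbc (by rw [h]))
    (fun h => hac (by rw [h]))
  rw [← Set.smul_set_inter, ← Set.smul_set_inter, this, Set.smul_set_empty]

lemma LiG_conjBy_eq_four {g : PSL(3, ℂ)} {Γ : Subgroup PSL(3, ℂ)}
    (h : LiG (discontinuityRegion (conjBy g Γ)) = 4) : LiG (discontinuityRegion Γ) = 4 := by
  rw [LiG_eq_four_iff] at h ⊢
  obtain ⟨⟨S, h1, h2, h3⟩, hle⟩ := h
  have hinj : ∀ γ : PSL(3, ℂ), Function.Injective fun l : Set P2 => γ • l := MulAction.injective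
  have hΓ : Γ = conjBy g⁻¹ (conjBy g Γ) := by rw [conjBy_conjBy, inv_mul_cancel, conjBy_one]
  refine ⟨⟨(fun l => g⁻¹ • l) '' S, ?_, h2.smul _, by rw [(hinj _).encard_image, h3]⟩,
    fun T hT1 hT2 => ?_⟩
  · rw [hΓ, limitLines_conjBy]
    exact Set.image_mono h1
  · rw [← (hinj g).encard_image T]
    refine hle _ ?_ (hT2.smul g)
    rw [limitLines_conjBy]
    exact Set.image_mono hT1

lemma limitLines_congr {Γ Γ' : Subgroup PSL(3, ℂ)} (h : limitSet Γ = limitSet Γ') :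
    limitLines Γ = limitLines Γ' := by
  rw [limitLines, limitLines, h]

/-- A line through none of the vertices of a set of lines in general position can be added to it. -/
lemma InGeneralPosition.insert {S : Set (Set P2)} (hS : InGeneralPosition S) {l : Set P2}
    (hl : ∀ a ∈ S, ∀ b ∈ S, a ≠ b → ∀ p ∈ l, p ∈ a → p ∉ b) : InGeneralPosition (insert l S) := by
  intro a ha b hb c hc hab hbc hac
  rw [Set.eq_empty_iff_forall_notMem]
  rintro p ⟨⟨hpa, hpb⟩, hpc⟩
  rcases ha with rfl | ha <;> rcases hb with rfl | hb <;> rcases hc with rfl | hc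
  · exact hab rfl
  · exact hab rfl
  · exact hac rfl
  · exact hl b hb c hc hbc p hpa hpb hpc
  · exact hbc rfl
  · exact hl a ha c hc hac p hpb hpa hpc
  · exact hl a ha b hb hab p hpc hpa hpb
  · exact Set.eq_empty_iff_forall_notMem.1 (hS a ha b hb c hc hab hbc hac) p ⟨⟨hpa, hpb⟩, hpc⟩

lemma InGeneralPosition.encard_le_two {S : Set (Set P2)} (hS : InGeneralPosition S) (p : P2) :
    {l ∈ S | p ∈ l}.encard ≤ 2 := by
  by_contra! hlt
  obtain ⟨T, hTS, hT⟩ := Set.exists_subset_encard_eq (Order.add_one_le_of_lt hlt)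
  obtain ⟨a, b, c, hab, hac, hbc, rfl⟩ := Set.encard_eq_three.1 (hT.trans (by norm_num))
  have ha := hTS (by simp : a ∈ _)
  have hb := hTS (by simp : b ∈ _)
  have hc := hTS (by simp : c ∈ _)
  exact Set.eq_empty_iff_forall_notMem.1 (hS a ha.1 b hb.1 c hc.1 hab hbc hac) p
    ⟨⟨ha.2, hb.2⟩, hc.2⟩

/-! ### Lines parallel to the axes -/

/-- The line with affine equation `w i = c`. -/
def coordLine (i : Fin 2) (c : ℂ) : Set P2 := locus fun v => v i.castSucc = c * v 2

/-- The point at infinity in the direction of the `i`-th axis. -/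
noncomputable def axisPt (i : Fin 2) : P2 := pr (Pi.single i.castSucc 1)

lemma single_castSucc_ne_zero (i : Fin 2) : (Pi.single i.castSucc 1 : Fin 3 → ℂ) ≠ 0 := by simp

lemma castSucc_ne_two (i : Fin 2) : i.castSucc ≠ (2 : Fin 3) := by
  fin_cases i <;> decide

lemma homogeneous_coordLine (i : Fin 2) (c : ℂ) :
    Homogeneous fun v => v i.castSucc = c * v 2 := by
  intro a v _ h
  simp only [Pi.smul_apply, smul_eq_mul]
  rw [h]
  ring

lemma pr_mem_coordLine {i : Fin 2} {c : ℂ} {v : Fin 3 → ℂ} (hv : v ≠ 0) :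
    pr v ∈ coordLine i c ↔ v i.castSucc = c * v 2 := pr_mem_locus (homogeneous_coordLine i c) hv

lemma pt_mem_coordLine {i : Fin 2} {c : ℂ} {w : Fin 2 → ℂ} : pt w ∈ coordLine i c ↔ w i = c := by
  rw [pt, pr_mem_coordLine (chart_ne_zero w), Aff2.vec_castSucc]
  simp

lemma axisPt_mem_coordLine {i j : Fin 2} {c : ℂ} : axisPt j ∈ coordLine i c ↔ i ≠ j := by
  rw [axisPt, pr_mem_coordLine (single_castSucc_ne_zero j)]
  simp [Pi.single_apply, (castSucc_ne_two j).symm]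

/-- A line through the point at infinity of the axis `i`, other than the line at infinity, has an
equation `w j = c`. -/
lemma locus_eq_coordLine {n : Fin 3 → ℂ} {i j : Fin 2} (hij : i ≠ j) (hi : n i.castSucc = 0)
    (hj : n j.castSucc ≠ 0) :
    (locus fun v => n ⬝ᵥ v = 0) = coordLine j (-n 2 / n j.castSucc) := by
  ext p
  obtain ⟨v, hv, rfl⟩ := exists_pr p
  rw [pr_mem_locus (homogeneous_dotProduct n) hv, pr_mem_coordLine hv]
  have : n ⬝ᵥ v = n j.castSucc * v j.castSucc + n 2 * v 2 := by
    rw [dotProduct, Fin.sum_univ_three]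
    fin_cases i <;> fin_cases j <;> simp_all
  rw [this]
  field_simp
  constructor <;> intro h <;> linear_combination h

lemma isComplexLine_coordLine (i : Fin 2) (c : ℂ) : IsComplexLine (coordLine i c) := by
  obtain ⟨j, hij⟩ : ∃ j, j ≠ i := exists_ne i
  have h2 := castSucc_ne_two i
  have hc : i.castSucc ≠ j.castSucc := fun h => hij (Fin.castSucc_injective _ h).symm
  let n : Fin 3 → ℂ := Pi.single i.castSucc 1 - Pi.single 2 c
  have hi : n i.castSucc = 1 := by simp [n, h2]
  have hj : n j.castSucc = 0 := by
    simp [n, castSucc_ne_two j, hc.symm]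
  have hn2 : n 2 = -c := by simp [n, h2.symm]
  have h := isComplexLine_of_normal (n := n) (fun h0 => by simp [h0] at hi)
  rwa [locus_eq_coordLine hij hj (by rw [hi]; exact one_ne_zero), hi, hn2, neg_neg, div_one] at h

lemma axisPt_mem_locus {n : Fin 3 → ℂ} {i : Fin 2} :
    axisPt i ∈ (locus fun v => n ⬝ᵥ v = 0) ↔ n i.castSucc = 0 := by
  rw [axisPt, pr_mem_locus (homogeneous_dotProduct n) (single_castSucc_ne_zero i)]
  simp

lemma IsComplexLine.exists_eq_coordLine {l : Set P2} (hl : IsComplexLine l) {i j : Fin 2}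
    (hij : i ≠ j) (hi : axisPt i ∈ l) (hj : axisPt j ∉ l) : ∃ c, l = coordLine j c := by
  obtain ⟨n, -, rfl⟩ := hl.exists_normal
  rw [axisPt_mem_locus] at hi hj
  exact ⟨_, locus_eq_coordLine hij hi hj⟩

lemma coordLine_injective {i i' : Fin 2} {c c' : ℂ} (h : coordLine i c = coordLine i' c') :
    i = i' ∧ c = c' := by
  have hi : i = i' := by
    by_contra hne
    have h1 : axisPt i' ∈ coordLine i c := axisPt_mem_coordLine.2 hne
    rw [h, axisPt_mem_coordLine] at h1
    exact h1 rfl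
  subst hi
  have h1 : pt (fun _ => c) ∈ coordLine i c := pt_mem_coordLine.2 rfl
  rw [h, pt_mem_coordLine] at h1
  exact ⟨rfl, h1⟩

lemma coordLine_subset {i : Fin 2} {c : ℂ} {X : Set P2} (hinf : lineInf ⊆ X)
    (h : ∀ w : Fin 2 → ℂ, w i = c → pt w ∈ X) : coordLine i c ⊆ X := by
  intro p hp
  by_cases hpi : p ∈ lineInf
  · exact hinf hpi
  · rw [← pt_coord hpi] at hp ⊢
    exact h _ (pt_mem_coordLine.1 hp)

/-- A line all of whose finite points have a real coordinate is parallel to an axis. -/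
lemma IsComplexLine.axisPt_mem_of_subset_someReal {l : Set P2} (hl : IsComplexLine l)
    (h : l ⊆ Aff2.someReal) : ∃ i, axisPt i ∈ l := by
  obtain ⟨n, hn, rfl⟩ := hl.exists_normal
  by_contra! hcon
  have h0 : n 0 ≠ 0 := fun h0 => hcon 0 (axisPt_mem_locus.2 h0)
  have h1 : n 1 ≠ 0 := fun h1 => hcon 1 (axisPt_mem_locus.2 h1)
  -- otherwise the line is the graph of `x ↦ α + β x`, which is not real for all non-real `x`
  let α : ℂ := -n 2 / n 1
  let β : ℂ := -n 0 / n 1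
  have hβ : β ≠ 0 := div_ne_zero (neg_ne_zero.2 h0) h1
  have key : ∀ x : ℂ, x.im ≠ 0 → (α + β * x).im = 0 := by
    intro x hx
    have hmem : pt ![x, α + β * x] ∈ locus fun v => n ⬝ᵥ v = 0 := by
      rw [pt_mem_locus (homogeneous_dotProduct n), dotProduct, Fin.sum_univ_three]
      simp only [cons_val, α, β]
      field_simp
      ring
    obtain ⟨i, hi⟩ := Aff2.pt_mem_someReal.1 (h hmem)
    fin_cases i
    · exact absurd hi hx
    · exact hi
  have e1 := key Complex.I (by simp)
  have e2 := key (2 * Complex.I) (by simp)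
  have e3 := key (1 + Complex.I) (by simp)
  simp at e1 e2 e3
  exact hβ (Complex.ext (by simp; linarith) (by simp; linarith))

namespace Aff2

/-- The limit set of a real unimodular group with a hyperbolic linear map and a generic translation
contains exactly four lines in general position: two parallel to each axis. -/
lemma IsRealUnimodular.LiG_eq_four {Δ : Subgroup Aff2} (hΔ : DiscreteTopology (Δ.map toProj))
    (h : IsRealUnimodular Δ) {e : Aff2} (he : e ∈ Δ) (heb : e.b = 0) (h0 : 1 < ‖(e.a 0 : ℂ)‖)
    {σ : Fin 2 → ℂ} (hσ : σ ∈ trans Δ) (hσ0 : ∀ i, σ i ≠ 0) :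
    LiG (discontinuityRegion (Δ.map toProj)) = 4 := by
  have hinf : lineInf ⊆ limitSet (Δ.map toProj) := fun p hp =>
    Or.inl (Or.inl (lineInf_subset_L0 hσ (fun h0 => hσ0 0 (congrFun h0 0)) hp))
  have hline : ∀ j, ∀ τ ∈ trans Δ, coordLine j (τ j) ⊆ limitSet (Δ.map toProj) := by
    intro j τ hτ
    refine coordLine_subset hinf fun w hw => Or.inr ?_
    -- the inverse of `e` expands the second coordinate
    fin_cases j
    · refine h.line_subset_L2 hΔ (inv_mem he) (by ext i; simp [heb]) one_ne_zero ?_ hτ hw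
      rw [norm_inv_a, h.norm_eq_inv he zero_ne_one, inv_inv]
      exact h0
    · exact h.line_subset_L2 hΔ he heb zero_ne_one h0 hτ hw
  rw [LiG_eq_four_iff]
  constructor
  -- the lines `w i = 0` and `w i = σ i`
  · let f : Fin 2 × Bool → Set P2 := fun x => coordLine x.1 (if x.2 then σ x.1 else 0)
    have hf : Function.Injective f := by
      rintro ⟨i, s⟩ ⟨j, t⟩ hst
      obtain ⟨h1, h2⟩ := coordLine_injective hst
      simp only at h1 h2
      subst h1
      have := hσ0 i
      cases s <;> cases t <;> simp_all [eq_comm]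
    refine ⟨Set.range f, ?_, ?_, ?_⟩
    · rintro _ ⟨⟨i, s⟩, rfl⟩
      refine ⟨isComplexLine_coordLine _ _, ?_⟩
      cases s
      · exact hline i 0 (trans Δ).zero_mem
      · exact hline i σ hσ
    · rintro _ ⟨x, rfl⟩ _ ⟨y, rfl⟩ _ ⟨z, rfl⟩ hxy hyz hxz
      rw [Set.eq_empty_iff_forall_notMem]
      rintro p ⟨⟨hx, hy⟩, hz⟩
      obtain ⟨v, hv, rfl⟩ := exists_pr p
      rw [pr_mem_coordLine hv] at hx hy hz
      -- two of the lines have the same direction, so that `p` is at infinity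
      have h2 : v 2 = 0 := by
        by_contra hv2
        have hinj : ∀ x y : Fin 2 × Bool,
            v x.1.castSucc = (if x.2 then σ x.1 else 0) * v 2 →
            v y.1.castSucc = (if y.2 then σ y.1 else 0) * v 2 → x.1 = y.1 → f x = f y := by
          rintro ⟨i, s⟩ ⟨j, t⟩ h1 h2 hij
          simp only at h1 h2 hij
          subst hij
          simp only [f]
          rw [mul_right_cancel₀ hv2 (h1.symm.trans h2)]
        have h1 : x.1 ≠ y.1 := fun h => hxy (hinj x y hx hy h)
        have h2 : y.1 ≠ z.1 := fun h => hyz (hinj y z hy hz h)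
        have h3 : x.1 ≠ z.1 := fun h => hxz (hinj x z hx hz h)
        omega
      -- the three lines have the same direction, as `p` is on a single axis
      rw [h2, mul_zero] at hx hy hz
      have hdir : ∀ i j : Fin 2, v i.castSucc = 0 → v j.castSucc = 0 → i = j := by
        intro i j hi hj
        by_contra hij
        apply hv
        ext k
        fin_cases i <;> fin_cases j <;> fin_cases k <;> simp_all
      have hb : x.2 = y.2 ∨ y.2 = z.2 ∨ x.2 = z.2 := by
        cases x.2 <;> cases y.2 <;> cases z.2 <;> simp
      rcases hb with hb | hb | hb
      · exact hxy (congrArg f (Prod.ext (hdir _ _ hx hy) hb))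
      · exact hyz (congrArg f (Prod.ext (hdir _ _ hy hz) hb))
      · exact hxz (congrArg f (Prod.ext (hdir _ _ hx hz) hb))
    · rw [← Set.image_univ, hf.encard_image]
      simp
  · intro S hS hgen
    -- every limit line passes through the point at infinity of an axis
    have hsub : S ⊆ {l ∈ S | axisPt 0 ∈ l} ∪ {l ∈ S | axisPt 1 ∈ l} := by
      intro l hl
      obtain ⟨i, hi⟩ := (hS hl).1.axisPt_mem_of_subset_someReal
        ((hS hl).2.trans (h.limitSet_subset hΔ))
      fin_cases i
      exacts [Or.inl ⟨hl, hi⟩, Or.inr ⟨hl, hi⟩]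
    calc S.encard ≤ _ := Set.encard_le_encard hsub
      _ ≤ _ := Set.encard_union_le _ _
      _ ≤ 2 + 2 := add_le_add (hgen.encard_le_two _) (hgen.encard_le_two _)
      _ = 4 := by norm_num

end Aff2

/-! ### Hyperbolic toral groups -/

lemma discreteTopology_of_le {Γ Γ' : Subgroup PSL(3, ℂ)} (hΓ : DiscreteTopology Γ) (h : Γ' ≤ Γ) :
    DiscreteTopology Γ' :=
  DiscreteTopology.of_continuous_injective (f := Subgroup.inclusion h)
    (continuous_subtype_val.subtype_mk _) (Subgroup.inclusion_injective h)

lemma discreteTopology_conjBy {Γ : Subgroup PSL(3, ℂ)} (hΓ : DiscreteTopology Γ) (g : PSL(3, ℂ)) :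
    DiscreteTopology (conjBy g Γ) := by
  have hc : Continuous fun γ : conjBy g Γ => (⟨g⁻¹ * γ.1 * g, mem_conjBy.1 γ.2⟩ : Γ) := by
    refine Continuous.subtype_mk ?_ _
    fun_prop
  refine DiscreteTopology.of_continuous_injective hc fun a b hab => ?_
  have := congrArg Subtype.val hab
  exact Subtype.ext (by simpa using this)

/-- A hyperbolic toral group is of type `Γ_A`; a real diagonalization of `A` conjugates it to a
group of real unimodular pairs of affine maps. -/
lemma LiG_of_isHyperbolicToralGroup {H : Subgroup PSL(3, ℂ)} (hH : DiscreteTopology H)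
    (h : IsHyperbolicToralGroup H) : LiG (discontinuityRegion H) = 4 := by
  obtain ⟨A, hA, g, hg⟩ := h.resolve_right fun ⟨A, B, ν, hdata, _⟩ => not_toralTwoData hdata
  obtain ⟨r, Q, hr, hQ, hQ0, hQA⟩ := hA.exists_diagonalization
  have hr0 : r ≠ 0 := by
    rintro rfl
    simp at hr
    linarith
  let u : ℂˣ := Units.mk0 (r : ℂ) (by exact_mod_cast hr0)
  let a : Fin 2 → ℂˣ := ![u, u⁻¹]
  let Qc : Matrix (Fin 2) (Fin 2) ℂ := Q.map (fun x : ℝ => (x : ℂ))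
  have hQc : Qc.det ≠ 0 := by
    have h1 : Qc.det = ((Q.det : ℝ) : ℂ) := (RingHom.map_det Complex.ofRealHom Q).symm
    rw [h1]
    exact_mod_cast hQ
  have hQcA : Qc * cmat A = Matrix.diagonal (fun i => (a i : ℂ)) * Qc := by
    ext i j
    have := congrFun (congrFun hQA i) j
    rw [Matrix.diagonal_mul, Matrix.mul_apply, Fin.sum_univ_two] at this ⊢
    have h2 := congrArg (fun x : ℝ => (x : ℂ)) this
    fin_cases i <;> simpa [a, u, Qc, cmat, rmat] using h2
  let P : PSL(3, ℂ) := toPSL (affGL Qc hQc 0)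
  have hset : (conjBy (P * g⁻¹) H : Set PSL(3, ℂ)) = Aff2.toProj '' {d |
      ∃ (k : ℤ) (b : Fin 2 → ℤ), d = ⟨a ^ k, fun i => ∑ j, Qc i j * b j⟩} := by
    have h1 := image_toralOne hQc hQcA 0
    simp only [Pi.zero_apply, mul_zero, sub_zero, add_zero] at h1
    rw [← h1]
    ext γ
    rw [SetLike.mem_coe, mem_conjBy, ← SetLike.mem_coe, hg]
    constructor
    · rintro ⟨x, hx, hxγ⟩
      refine ⟨x, hx, ?_⟩
      simp only [P] at hxγ ⊢
      have h2 : g * x * g⁻¹ =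
          g * (toPSL (affGL Qc hQc 0))⁻¹ * γ * (toPSL (affGL Qc hQc 0)) * g⁻¹ := by
        simpa [mul_assoc] using hxγ
      have h3 : x = (toPSL (affGL Qc hQc 0))⁻¹ * γ * (toPSL (affGL Qc hQc 0)) := by
        have := mul_right_cancel h2
        rw [mul_assoc, mul_assoc] at this
        rw [mul_left_cancel this, mul_assoc]
      rw [h3]
      group
    · rintro ⟨x, hx, rfl⟩
      exact ⟨x, hx, by simp [P, mul_assoc]⟩
  let Δ : Subgroup Aff2 := (conjBy (P * g⁻¹) H).comap Aff2.toProj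
  have hmap : Δ.map Aff2.toProj = conjBy (P * g⁻¹) H := by
    refine Subgroup.map_comap_eq_self fun γ hγ => ?_
    have : γ ∈ (conjBy (P * g⁻¹) H : Set PSL(3, ℂ)) := hγ
    rw [hset] at this
    obtain ⟨d, -, rfl⟩ := this
    exact ⟨d, rfl⟩
  have hmem : ∀ d, d ∈ Δ ↔ ∃ (k : ℤ) (b : Fin 2 → ℤ),
      d = ⟨a ^ k, fun i => ∑ j, Qc i j * b j⟩ := by
    intro d
    change Aff2.toProj d ∈ (conjBy (P * g⁻¹) H : Set PSL(3, ℂ)) ↔ _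
    rw [hset]
    constructor
    · rintro ⟨d', h, hd⟩
      rwa [Aff2.toProj_injective hd] at h
    · exact fun h => ⟨d, h, rfl⟩
  have hreal : Aff2.IsRealUnimodular Δ := by
    refine ⟨fun d hd i => ?_, fun d hd i => ?_, fun d hd => ?_⟩ <;>
      obtain ⟨k, b, rfl⟩ := (hmem d).1 hd
    · fin_cases i
      · exact ⟨r ^ k, by simp [a, u]⟩
      · exact ⟨(r⁻¹) ^ k, by simp [a, u]⟩
    · exact ⟨∑ j, Q i j * b j, by simp [Qc]⟩
    · simp [a]
  refine LiG_conjBy_eq_four (g := P * g⁻¹) ?_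
  rw [← hmap]
  have hdisc : DiscreteTopology (Δ.map Aff2.toProj) := by
    rw [hmap]
    exact discreteTopology_conjBy hH _
  -- the element `A` itself and the translation by the first basis vector
  refine hreal.LiG_eq_four hdisc (e := ⟨a, 0⟩) ((hmem _).2 ⟨1, 0, ?_⟩) rfl ?_
    (σ := fun i => Qc i 0) (Aff2.mem_trans.2 ((hmem _).2 ⟨0, Pi.single 0 1, ?_⟩)) ?_
  · ext i <;> simp
  · simpa [a, u] using hr
  · ext i <;> simp [Fin.sum_univ_two]
  · intro i
    simpa [Qc] using hQ0 i

/-! ### The lines in a limit set with at most four lines in general position -/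

/-- The lines of the limit set through the point `v`. -/
def pencil (Γ : Subgroup PSL(3, ℂ)) (v : P2) : Set (Set P2) := {l ∈ limitLines Γ | v ∈ l}

/-- The points lying on infinitely many lines of the limit set. -/
def centers (Γ : Subgroup PSL(3, ℂ)) : Set P2 := {v | (pencil Γ v).Infinite}

/-- Finitely many lines through `v` meet a finite set not containing `v`. -/
lemma finite_pencil_meeting (Γ : Subgroup PSL(3, ℂ)) {v : P2} {B : Set P2} (hB : B.Finite)
    (hv : v ∉ B) : {l ∈ pencil Γ v | ∃ p ∈ B, p ∈ l}.Finite := by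
  have hsub : {l ∈ pencil Γ v | ∃ p ∈ B, p ∈ l} ⊆ ⋃ p ∈ B, {l ∈ pencil Γ v | p ∈ l} := by
    rintro l ⟨hl, p, hp, hpl⟩
    exact Set.mem_biUnion hp ⟨hl, hpl⟩
  refine (hB.biUnion fun p hp => Set.Subsingleton.finite ?_).subset hsub
  rintro l ⟨hl, hpl⟩ m ⟨hm, hpm⟩
  exact hl.1.1.eq_of_mem hm.1.1 (by rintro rfl; exact hv hp) hl.2 hpl hm.2 hpm

/-- Finitely many lines have finitely many pairwise intersection points. -/
lemma finite_vertices {Γ : Subgroup PSL(3, ℂ)} {S : Set (Set P2)} (hSf : S.Finite)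
    (hSL : S ⊆ limitLines Γ) : {p | ∃ a ∈ S, ∃ b ∈ S, a ≠ b ∧ p ∈ a ∧ p ∈ b}.Finite := by
  have hsub : {p | ∃ a ∈ S, ∃ b ∈ S, a ≠ b ∧ p ∈ a ∧ p ∈ b} ⊆
      ⋃ a ∈ S, ⋃ b ∈ S, {p | a ≠ b ∧ p ∈ a ∧ p ∈ b} := by
    rintro p ⟨a, ha, b, hb, h⟩
    exact Set.mem_biUnion ha (Set.mem_biUnion hb h)
  refine (hSf.biUnion fun a ha => hSf.biUnion fun b hb => Set.Subsingleton.finite ?_).subset hsub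
  rintro p ⟨hab, hp⟩ q ⟨-, hq⟩
  exact (hSL ha).1.inter_subsingleton (hSL hb).1 hab hp hq

/-- A line of an infinite pencil can be added to a finite set of lines in general position, avoiding
finitely many points, if the centre of the pencil lies on at most one line of the set. -/
lemma exists_insert {Γ : Subgroup PSL(3, ℂ)} {S : Set (Set P2)} (hSf : S.Finite)
    (hSL : S ⊆ limitLines Γ) (hS : InGeneralPosition S) {v : P2} (hvc : v ∈ centers Γ)
    (hv : ∀ a ∈ S, ∀ b ∈ S, a ≠ b → v ∈ a → v ∉ b) {F : Set P2} (hF : F.Finite) (hvF : v ∉ F) :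
    ∃ l ∈ limitLines Γ, v ∈ l ∧ l ∉ S ∧ (∀ p ∈ F, p ∉ l) ∧ InGeneralPosition (insert l S) := by
  have hBf := hF.union (finite_vertices hSf hSL)
  set B := F ∪ {p | ∃ a ∈ S, ∃ b ∈ S, a ≠ b ∧ p ∈ a ∧ p ∈ b} with hB
  have hvB : v ∉ B := by
    rintro (h | ⟨a, ha, b, hb, hab, h1, h2⟩)
    exacts [hvF h, hv a ha b hb hab h1 h2]
  have hinf : (pencil Γ v).Infinite := hvc
  obtain ⟨l, hl, hlbad⟩ := (hinf.sdiff ((finite_pencil_meeting Γ hBf hvB).union hSf)).nonempty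
  have hlB : ∀ p ∈ B, p ∉ l := fun p hp hpl => hlbad (Or.inl ⟨hl, p, hp, hpl⟩)
  refine ⟨l, hl.1, hl.2, fun h => hlbad (Or.inr h), fun p hp => hlB p (Or.inl hp),
    hS.insert fun a ha b hb hab p hpl hpa hpb => hlB p (Or.inr ⟨a, ha, b, hb, hab, hpa, hpb⟩) hpl⟩

/-- Three centres would give five lines in general position: two through each of the first two, and
one through the third. -/
lemma centers_not_three {Γ : Subgroup PSL(3, ℂ)}
    (hmax : ∀ S ⊆ limitLines Γ, InGeneralPosition S → S.encard ≤ 4) {u v w : P2}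
    (hu : u ∈ centers Γ) (hv : v ∈ centers Γ) (hw : w ∈ centers Γ) (huv : u ≠ v) (huw : u ≠ w)
    (hvw : v ≠ w) : False := by
  have h0 : InGeneralPosition (∅ : Set (Set P2)) := fun l hl => absurd hl (Set.notMem_empty l)
  obtain ⟨l₁, hl₁, hu₁, -, hF₁, hS₁⟩ := exists_insert Set.finite_empty (Set.empty_subset _) h0 hu
    (fun a ha => absurd ha (Set.notMem_empty a)) (F := {v, w}) (by simp) (by simp [huv, huw])
  have hv₁ := hF₁ v (by simp)
  have hw₁ := hF₁ w (by simp)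
  obtain ⟨l₂, hl₂, hu₂, hn₂, hF₂, hS₂⟩ := exists_insert (by simp) (by simp [hl₁]) hS₁ hu
    (by simp) (F := {v, w}) (by simp) (by simp [huv, huw])
  have hv₂ := hF₂ v (by simp)
  have hw₂ := hF₂ w (by simp)
  obtain ⟨l₃, hl₃, hu₃, hn₃, hF₃, hS₃⟩ := exists_insert (by simp)
    (by simp [Set.insert_subset_iff, hl₁, hl₂]) hS₂ hv (by simp [hv₁, hv₂]) (F := {w}) (by simp)
    (by simp [hvw])
  have hw₃ := hF₃ w (by simp)
  obtain ⟨l₄, hl₄, hu₄, hn₄, hF₄, hS₄⟩ := exists_insert (by simp)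
    (by simp [Set.insert_subset_iff, hl₁, hl₂, hl₃]) hS₃ hv (by simp [hv₁, hv₂]) (F := {w})
    (by simp) (by simp [hvw])
  have hw₄ := hF₄ w (by simp)
  obtain ⟨l₅, hl₅, hu₅, hn₅, hF₅, hS₅⟩ := exists_insert (by simp)
    (by simp [Set.insert_subset_iff, hl₁, hl₂, hl₃, hl₄]) hS₄ hw (by simp [hw₁, hw₂, hw₃, hw₄])
    (F := ∅) (by simp) (by simp)
  -- the five lines are distinct
  have hle := hmax _ (by simp [Set.insert_subset_iff, hl₁, hl₂, hl₃, hl₄, hl₅]) hS₅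
  rw [Set.encard_insert_of_notMem hn₅, Set.encard_insert_of_notMem hn₄,
    Set.encard_insert_of_notMem hn₃, Set.encard_insert_of_notMem hn₂,
    Set.encard_insert_of_notMem (Set.notMem_empty _), Set.encard_empty] at hle
  norm_num at hle

/-- Four lines in general position that cannot be extended meet every line in one of their
vertices, so that all but finitely many lines pass through a centre. -/
lemma finite_lines_off_centers {Γ : Subgroup PSL(3, ℂ)} {T : Set (Set P2)} (hTL : T ⊆ limitLines Γ)
    (hT : InGeneralPosition T) (hT4 : T.encard = 4)
    (hmax : ∀ S ⊆ limitLines Γ, InGeneralPosition S → S.encard ≤ 4) :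
    {l ∈ limitLines Γ | ∀ v ∈ centers Γ, v ∉ l}.Finite := by
  have hTf : T.Finite := Set.finite_of_encard_eq_coe (k := 4) hT4
  have hcover : ∀ l ∈ limitLines Γ, ∃ p ∈ {p | ∃ a ∈ T, ∃ b ∈ T, a ≠ b ∧ p ∈ a ∧ p ∈ b}, p ∈ l := by
    intro l hl
    by_cases hlT : l ∈ T
    · obtain ⟨b, hb, hbl⟩ : ∃ b ∈ T, b ≠ l := by
        by_contra! hcon
        have : T.encard ≤ 1 := Set.encard_le_one_iff.2 fun a b ha hb => by rw [hcon a ha, hcon b hb]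
        rw [hT4] at this
        exact absurd this (by decide)
      obtain ⟨p, hp⟩ := hl.1.inter_nonempty (hTL hb).1
      exact ⟨p, ⟨l, hlT, b, hb, hbl.symm, hp⟩, hp.1⟩
    · by_contra! hcon
      have h1 := hmax (insert l T) (Set.insert_subset hl hTL) (hT.insert
        fun a ha b hb hab p hpl hpa hpb => hcon p ⟨a, ha, b, hb, hab, hpa, hpb⟩ hpl)
      rw [Set.encard_insert_of_notMem hlT, hT4] at h1
      exact absurd h1 (by decide)
  have hsub : {l ∈ limitLines Γ | ∀ v ∈ centers Γ, v ∉ l} ⊆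
      ⋃ p ∈ {p | ∃ a ∈ T, ∃ b ∈ T, a ≠ b ∧ p ∈ a ∧ p ∈ b}, {l ∈ pencil Γ p | p ∉ centers Γ} := by
    rintro l ⟨hl, hlc⟩
    obtain ⟨p, hp, hpl⟩ := hcover l hl
    exact Set.mem_biUnion hp ⟨⟨hl, hpl⟩, fun h => hlc p h hpl⟩
  refine ((finite_vertices hTf hTL).biUnion fun p _ => ?_).subset hsub
  by_cases hp : p ∈ centers Γ
  · simp [hp]
  · exact (Set.not_infinite.1 hp).subset fun l hl => hl.1

/-- The whole plane contains five lines in general position, tangent to a conic. -/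
lemma limitSet_ne_univ {Γ : Subgroup PSL(3, ℂ)}
    (hmax : ∀ S ⊆ limitLines Γ, InGeneralPosition S → S.encard ≤ 4) :
    limitSet Γ ≠ Set.univ := by
  intro huniv
  let n : Fin 5 → Fin 3 → ℂ := fun t => ![1, (t : ℕ), ((t : ℕ) : ℂ) ^ 2]
  let f : Fin 5 → Set P2 := fun t => locus fun v => n t ⬝ᵥ v = 0
  have hmem : ∀ t v, v ≠ 0 →
      (pr v ∈ f t ↔ v 0 + ((t : ℕ) : ℂ) * v 1 + ((t : ℕ) : ℂ) ^ 2 * v 2 = 0) := by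
    intro t v hv
    rw [pr_mem_locus (homogeneous_dotProduct _) hv, dotProduct, Fin.sum_univ_three]
    simp [n]
  have hcast : ∀ {s t : Fin 5}, s ≠ t → ((s : ℕ) : ℂ) - (t : ℕ) ≠ 0 := by
    intro s t hst h
    apply hst
    rw [sub_eq_zero] at h
    exact Fin.ext (by exact_mod_cast h)
  have hinj : Function.Injective f := by
    intro s t hst
    by_contra hne
    -- the point where the line touches the conic
    let v : Fin 3 → ℂ := ![((s : ℕ) : ℂ) ^ 2, -2 * (s : ℕ), 1]
    have hv : v ≠ 0 := fun h => by simpa [v] using congrFun h 2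
    have h1 : pr v ∈ f s := (hmem s v hv).2 (by simp [v]; ring)
    rw [hst, hmem t v hv] at h1
    refine pow_ne_zero 2 (hcast hne) ?_
    simp only [v, cons_val] at h1
    linear_combination h1
  have hgen : InGeneralPosition (Set.range f) := by
    rintro _ ⟨r, rfl⟩ _ ⟨s, rfl⟩ _ ⟨t, rfl⟩ hrs hst hrt
    rw [Set.eq_empty_iff_forall_notMem]
    rintro p ⟨⟨hr, hs⟩, ht⟩
    obtain ⟨v, hv, rfl⟩ := exists_pr p
    rw [hmem _ v hv] at hr hs ht
    have h1 := hcast fun h => hrs (congrArg f h)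
    have h2 := hcast fun h => hst (congrArg f h)
    have h3 := hcast fun h => hrt (congrArg f h)
    have e1 : v 1 + (((r : ℕ) : ℂ) + (s : ℕ)) * v 2 = 0 := by
      refine (mul_eq_zero.1 ?_).resolve_left h1
      linear_combination hr - hs
    have e2 : v 1 + (((r : ℕ) : ℂ) + (t : ℕ)) * v 2 = 0 := by
      refine (mul_eq_zero.1 ?_).resolve_left h3
      linear_combination hr - ht
    have v2 : v 2 = 0 := by
      refine (mul_eq_zero.1 ?_).resolve_left h2
      linear_combination e1 - e2
    rw [v2] at e1 hr
    have v1 : v 1 = 0 := by linear_combination e1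
    rw [v1] at hr
    have v0 : v 0 = 0 := by linear_combination hr
    exact hv (by ext i; fin_cases i <;> simp [v0, v1, v2])
  have hle := hmax (Set.range f) (by
    rintro _ ⟨t, rfl⟩
    refine ⟨isComplexLine_of_normal fun h => ?_, huniv ▸ Set.subset_univ _⟩
    simpa [n] using congrFun h 0) hgen
  rw [← Set.image_univ, hinj.encard_image] at hle
  simp at hle
  exact absurd hle (by decide)

lemma smul_mem_centers {Γ : Subgroup PSL(3, ℂ)} {γ : PSL(3, ℂ)} (hγ : γ ∈ Γ) {v : P2}
    (hv : v ∈ centers Γ) : γ • v ∈ centers Γ := by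
  have hinf : (pencil Γ v).Infinite := hv
  refine (hinf.image (f := fun l => γ • l) (MulAction.injective γ).injOn).mono ?_
  rintro _ ⟨l, hl, rfl⟩
  exact ⟨smul_limitLines hγ hl.1, Set.smul_mem_smul_set hl.2⟩

/-! ### Finite-index subgroups fixing points and lines -/

/-- The stabilizer of a point of a finite invariant set has index at most the size of the set. -/
lemma relIndex_stabilizer_le {G α : Type*} [Group G] [MulAction G α] {Γ : Subgroup G} {F : Set α}
    (hF : F.Finite) (hinv : ∀ γ ∈ Γ, ∀ x ∈ F, γ • x ∈ F) {x : α} (hx : x ∈ F) :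
    (MulAction.stabilizer G x).relIndex Γ ≠ 0 ∧
      (MulAction.stabilizer G x).relIndex Γ ≤ F.ncard := by
  have h1 : (MulAction.stabilizer G x).subgroupOf Γ = MulAction.stabilizer Γ x := rfl
  have h2 : MulAction.orbit Γ x ⊆ F := by
    rintro _ ⟨γ, rfl⟩
    exact hinv γ.1 γ.2 x hx
  rw [Subgroup.relIndex, h1, MulAction.index_stabilizer]
  refine ⟨?_, Set.ncard_le_ncard h2 hF⟩
  exact ((Set.ncard_pos (hF.subset h2)).2 ⟨x, MulAction.mem_orbit_self x⟩).ne'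

/-- A projective transformation fixing the points at infinity of both axes is a pair of affine
maps. -/
lemma exists_toProj_eq {γ : PSL(3, ℂ)} (h : ∀ i, γ • axisPt i = axisPt i) :
    ∃ d : Aff2, d.toProj = γ := by
  obtain ⟨M, rfl⟩ := QuotientGroup.mk_surjective γ
  have hcol : ∀ i : Fin 2, ∀ k, k ≠ i.castSucc → M.1 k i.castSucc = 0 := by
    intro i k hk
    have h1 := h i
    rw [axisPt, smul_pr _ (single_castSucc_ne_zero i),
      pr_eq_iff (mulVec_ne_zero M (single_castSucc_ne_zero i)) (single_castSucc_ne_zero i)] at h1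
    obtain ⟨c, -, hc⟩ := h1
    have := congrFun hc k
    simpa [hk] using this
  have h10 : M.1 1 0 = 0 := hcol 0 1 (by decide)
  have h20 : M.1 2 0 = 0 := hcol 0 2 (by decide)
  have h01 : M.1 0 1 = 0 := hcol 1 0 (by decide)
  have h21 : M.1 2 1 = 0 := hcol 1 2 (by decide)
  have hdet := M.2
  rw [Matrix.det_fin_three, h10, h20, h01, h21] at hdet
  have hne : M.1 0 0 * M.1 1 1 * M.1 2 2 ≠ 0 := by
    intro h0
    rw [h0] at hdet
    simp at hdet
  have h22 : M.1 2 2 ≠ 0 := right_ne_zero_of_mul hne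
  have h00 : M.1 0 0 ≠ 0 := left_ne_zero_of_mul (left_ne_zero_of_mul hne)
  have h11 : M.1 1 1 ≠ 0 := right_ne_zero_of_mul (left_ne_zero_of_mul hne)
  refine ⟨⟨![Units.mk0 (M.1 0 0 / M.1 2 2) (div_ne_zero h00 h22),
    Units.mk0 (M.1 1 1 / M.1 2 2) (div_ne_zero h11 h22)],
    ![M.1 0 2 / M.1 2 2, M.1 1 2 / M.1 2 2]⟩, ?_⟩
  rw [← toPSL_toGL]
  refine toPSL_eq_of_smul (c := (M.1 2 2)⁻¹) ?_
  have hM : (SpecialLinearGroup.toGL M : GL (Fin 3) ℂ).1 = M.1 := rfl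
  rw [Aff2.coe_toGL, hM]
  ext i j
  fin_cases i <;> fin_cases j <;> simp [Aff2.mat, h10, h20, h01, h21, h22] <;> field_simp

/-- A group fixing two points is conjugate to a group of pairs of affine maps. -/
lemma exists_conjBy_eq_map {Γ : Subgroup PSL(3, ℂ)} {u v : P2} (huv : u ≠ v)
    (hu : ∀ γ ∈ Γ, γ • u = u) (hv : ∀ γ ∈ Γ, γ • v = v) :
    ∃ (g : PSL(3, ℂ)) (Δ : Subgroup Aff2), conjBy g Γ = Δ.map Aff2.toProj ∧
      g • u = axisPt 0 ∧ g • v = axisPt 1 := by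
  have htrans : MulAction.IsMultiplyPretransitive SL(3, ℂ) P2 2 := inferInstance
  rw [MulAction.is_two_pretransitive_iff] at htrans
  have haxis : axisPt 0 ≠ axisPt 1 := by
    intro h
    have h0 : axisPt 0 ∈ coordLine 1 0 := axisPt_mem_coordLine.2 one_ne_zero
    rw [h, axisPt_mem_coordLine] at h0
    exact h0 rfl
  obtain ⟨M, hM0, hM1⟩ := htrans huv haxis
  have hgu : (M : PSL(3, ℂ)) • u = axisPt 0 := hM0
  have hgv : (M : PSL(3, ℂ)) • v = axisPt 1 := hM1
  refine ⟨M, (conjBy M Γ).comap Aff2.toProj, ?_, hgu, hgv⟩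
  refine (Subgroup.map_comap_eq_self fun γ hγ => ?_).symm
  rw [mem_conjBy] at hγ
  refine exists_toProj_eq fun i => ?_
  fin_cases i
  · have := hu _ hγ
    rw [mul_smul, hgu, mul_smul, inv_smul_eq_iff, hgu] at this
    exact this
  · have := hv _ hγ
    rw [mul_smul, hgv, mul_smul, inv_smul_eq_iff, hgv] at this
    exact this

/-! ### Groups with four lines in general position -/

/-- Two limit lines through the point at infinity of the axis `i`, other than the line at infinity,
are parallel limit lines `w j = c`. -/
lemma hasParallelLines_of_lines {Δ : Subgroup Aff2} {i j : Fin 2} (hij : i ≠ j) {l m : Set P2}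
    (hl : l ∈ pencil (Δ.map Aff2.toProj) (axisPt i))
    (hm : m ∈ pencil (Δ.map Aff2.toProj) (axisPt i))
    (hlm : l ≠ m) (hl' : axisPt j ∉ l) (hm' : axisPt j ∉ m) : Aff2.HasParallelLines Δ j := by
  obtain ⟨c, rfl⟩ := hl.1.1.exists_eq_coordLine hij hl.2 hl'
  obtain ⟨c', rfl⟩ := hm.1.1.exists_eq_coordLine hij hm.2 hm'
  refine ⟨c, c', fun h => hlm (by rw [h]), fun w hw => ?_⟩
  rcases hw with hw | hw
  · exact hl.1.2 (pt_mem_coordLine.2 hw)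
  · exact hm.1.2 (pt_mem_coordLine.2 hw)

lemma smul_mem_pencil_conjBy {Γ : Subgroup PSL(3, ℂ)} {v : P2} {l : Set P2} (hl : l ∈ pencil Γ v)
    (g : PSL(3, ℂ)) : g • l ∈ pencil (conjBy g Γ) (g • v) :=
  ⟨limitLines_conjBy g Γ ▸ ⟨l, hl.1, rfl⟩, Set.smul_mem_smul_set hl.2⟩

/-- There are two limit lines through a centre avoiding any other given point. -/
lemma exists_two_lines {Γ : Subgroup PSL(3, ℂ)} {v p : P2} (hv : v ∈ centers Γ) (hvp : v ≠ p) :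
    ∃ l ∈ pencil Γ v, ∃ m ∈ pencil Γ v, l ≠ m ∧ p ∉ l ∧ p ∉ m := by
  have hinf : (pencil Γ v).Infinite := hv
  have h1 := hinf.sdiff (finite_pencil_meeting Γ (Set.finite_singleton p) hvp)
  obtain ⟨l, hl, m, hm, hlm⟩ := h1.nontrivial
  exact ⟨l, hl.1, m, hm.1, hlm, fun h => hl.2 ⟨hl.1, p, rfl, h⟩, fun h => hm.2 ⟨hm.1, p, rfl, h⟩⟩

/-- A group fixing a point `v` and two lines off `v` acts trivially on the pencil of lines through
the common point of the two lines, whereas a discrete group with two limit lines through `v` in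
general position to these contains a transformation expanding this pencil. -/
lemma not_fixed_lines {Γ : Subgroup PSL(3, ℂ)} (hΓ : DiscreteTopology Γ) {v p : P2}
    {n₁ n₂ m₁ m₂ : Set P2} (hn₁ : IsComplexLine n₁) (hn₂ : IsComplexLine n₂) (hn : n₁ ≠ n₂)
    (hv : ∀ γ ∈ Γ, γ • v = v) (hfix₁ : ∀ γ ∈ Γ, γ • n₁ = n₁) (hfix₂ : ∀ γ ∈ Γ, γ • n₂ = n₂)
    (hv₁ : v ∉ n₁) (hv₂ : v ∉ n₂) (hp₁ : p ∈ n₁) (hp₂ : p ∈ n₂) (hm₁ : m₁ ∈ pencil Γ v)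
    (hm₂ : m₂ ∈ pencil Γ v) (hm : m₁ ≠ m₂) (hpm₁ : p ∉ m₁) (hpm₂ : p ∉ m₂) : False := by
  have hp : ∀ γ ∈ Γ, γ • p = p := by
    intro γ hγ
    refine hn₁.inter_subsingleton hn₂ hn ⟨?_, ?_⟩ ⟨hp₁, hp₂⟩
    · rw [← hfix₁ γ hγ]; exact Set.smul_mem_smul_set hp₁
    · rw [← hfix₂ γ hγ]; exact Set.smul_mem_smul_set hp₂
  have hvp : v ≠ p := by
    rintro rfl
    exact hv₁ hp₁
  obtain ⟨g, Δ, hΔ, hg0, hg1⟩ := exists_conjBy_eq_map hvp hv hp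
  have hdisc : DiscreteTopology (Δ.map Aff2.toProj) := hΔ ▸ discreteTopology_conjBy hΓ g
  have hpar : Aff2.HasParallelLines Δ 1 := by
    have h1 := smul_mem_pencil_conjBy hm₁ g
    have h2 := smul_mem_pencil_conjBy hm₂ g
    rw [hΔ, hg0] at h1 h2
    refine hasParallelLines_of_lines zero_ne_one h1 h2
      (fun h => hm (MulAction.injective g h)) ?_ ?_ <;>
    rw [← hg1, Set.smul_mem_smul_set_iff] <;> assumption
  obtain ⟨d, hd, hd1, -⟩ := (Aff2.isHyperbolic_of_hasParallelLines hdisc hpar).exists_expand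
  -- the two fixed lines become lines `w 0 = c` and `w 0 = c'`
  have key : ∀ n : Set P2, IsComplexLine n → (∀ γ ∈ Γ, γ • n = n) → v ∉ n → p ∈ n →
      ∃ c, g • n = coordLine 0 c ∧ d.a 0 * c + d.b 0 = c := by
    intro n hn hfix hvn hpn
    obtain ⟨c, hc⟩ := (hn.smul g).exists_eq_coordLine (i := 1) (j := 0) one_ne_zero
      (by rw [← hg1]; exact Set.smul_mem_smul_set hpn)
      (by rwa [← hg0, Set.smul_mem_smul_set_iff])
    refine ⟨c, hc, ?_⟩
    have hdm : Aff2.toProj d ∈ conjBy g Γ := hΔ ▸ Subgroup.mem_map_of_mem _ hd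
    have h1 := hfix _ (mem_conjBy.1 hdm)
    have h2 : Aff2.toProj d • coordLine 0 c = coordLine 0 c := by
      rw [← hc]
      rw [mul_smul, mul_smul, inv_smul_eq_iff] at h1
      exact h1
    have h3 : pt (fun _ => c) ∈ coordLine 0 c := pt_mem_coordLine.2 rfl
    have h4 := Set.smul_mem_smul_set (a := Aff2.toProj d) h3
    rw [h2, Aff2.toProj_smul_pt, pt_mem_coordLine] at h4
    exact h4
  obtain ⟨c, hc, e⟩ := key n₁ hn₁ hfix₁ hv₁ hp₁
  obtain ⟨c', hc', e'⟩ := key n₂ hn₂ hfix₂ hv₂ hp₂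
  have hcc : c - c' ≠ 0 := by
    refine sub_ne_zero.2 fun h => hn (MulAction.injective g ?_)
    change g • n₁ = g • n₂
    rw [hc, hc', h]
  have hone : (d.a 0 : ℂ) = 1 := by
    refine mul_right_cancel₀ hcc ?_
    linear_combination e - e'
  rw [hone, norm_one] at hd1
  exact lt_irrefl _ hd1

lemma pencil_congr {Γ Γ' : Subgroup PSL(3, ℂ)} (h : limitSet Γ = limitSet Γ') (v : P2) :
    pencil Γ v = pencil Γ' v := by
  rw [pencil, pencil, limitLines_congr h]

lemma limitSet_inf_eq {Γ K : Subgroup PSL(3, ℂ)} (h : K.relIndex Γ ≠ 0) :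
    limitSet (K ⊓ Γ) = limitSet Γ :=
  limitSet_eq_of_relIndex inf_le_right (by rwa [Subgroup.inf_relIndex_right])

/-- At least two points lie on infinitely many limit lines: otherwise a subgroup of finite index
fixes a configuration of lines excluded by `not_fixed_lines`. -/
lemma exists_two_centers {Γ : Subgroup PSL(3, ℂ)} (hΓ : DiscreteTopology Γ) {T : Set (Set P2)}
    (hTL : T ⊆ limitLines Γ) (hT : InGeneralPosition T) (hT4 : T.encard = 4)
    (hmax : ∀ S ⊆ limitLines Γ, InGeneralPosition S → S.encard ≤ 4) :
    ∃ u ∈ centers Γ, ∃ v ∈ centers Γ, u ≠ v := by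
  by_contra! hcon
  have hfin := finite_lines_off_centers hTL hT hT4 hmax
  set 𝓕 := {l ∈ limitLines Γ | ∀ v ∈ centers Γ, v ∉ l} with h𝓕
  have hinv : ∀ γ ∈ Γ, ∀ l ∈ 𝓕, γ • l ∈ 𝓕 := by
    rintro γ hγ l ⟨hl, hlc⟩
    refine ⟨smul_limitLines hγ hl, fun v hv hvl => ?_⟩
    rw [Set.mem_smul_set_iff_inv_smul_mem] at hvl
    exact hlc _ (smul_mem_centers (inv_mem hγ) hv) hvl
  have hstab : ∀ l ∈ 𝓕, (MulAction.stabilizer PSL(3, ℂ) l).relIndex Γ ≠ 0 := fun l hl =>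
    (relIndex_stabilizer_le hfin hinv hl).1
  -- the finite set of limit lines avoiding the centres is invariant under the group
  by_cases hc : ∃ v, v ∈ centers Γ
  · obtain ⟨v, hv⟩ := hc
    have h𝓕v : ∀ l ∈ limitLines Γ, v ∉ l → l ∈ 𝓕 := fun l hl hvl =>
      ⟨hl, fun w hw => hcon v hv w hw ▸ hvl⟩
    have hsplit : T ⊆ {l ∈ T | v ∈ l} ∪ {l ∈ T | v ∉ l} := by
      intro l hl
      by_cases hvl : v ∈ l
      exacts [Or.inl ⟨hl, hvl⟩, Or.inr ⟨hl, hvl⟩]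
    -- a single centre `v`, fixed by the group, lies on at most two of the four lines, and the
    -- other two are fixed by a subgroup of finite index
    have h2 : 1 < {l ∈ T | v ∉ l}.encard := by
      by_contra! hle
      have h4 : T.encard ≤ 2 + 1 := (Set.encard_le_encard hsplit).trans
        ((Set.encard_union_le _ _).trans (add_le_add (hT.encard_le_two v) hle))
      rw [hT4] at h4
      exact absurd h4 (by decide)
    obtain ⟨n₁, n₂, hn₁, hn₂, hn⟩ := Set.one_lt_encard_iff.1 h2
    have hL₁ := hTL hn₁.1
    have hL₂ := hTL hn₂.1
    obtain ⟨p, hp₁, hp₂⟩ := hL₁.1.inter_nonempty hL₂.1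
    have hvp : v ≠ p := by
      rintro rfl
      exact hn₁.2 hp₁
    obtain ⟨m₁, hm₁, m₂, hm₂, hm, hpm₁, hpm₂⟩ := exists_two_lines hv hvp
    have hrel := Subgroup.relIndex_inf_ne_zero (hstab n₁ (h𝓕v n₁ hL₁ hn₁.2))
      (hstab n₂ (h𝓕v n₂ hL₂ hn₂.2))
    rw [← pencil_congr (limitSet_inf_eq hrel)] at hm₁ hm₂
    exact not_fixed_lines (Γ := MulAction.stabilizer PSL(3, ℂ) n₁ ⊓
      MulAction.stabilizer PSL(3, ℂ) n₂ ⊓ Γ) (discreteTopology_of_le hΓ inf_le_right) hL₁.1 hL₂.1 hn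
      (fun γ hγ => (hcon v hv _ (smul_mem_centers hγ.2 hv)).symm)
      (fun γ hγ => hγ.1.1) (fun γ hγ => hγ.1.2) hn₁.2 hn₂.2 hp₁ hp₂ hm₁ hm₂ hm hpm₁ hpm₂
  -- without centres there are finitely many limit lines, and a subgroup of finite index fixes all
  -- of the four given lines; take the common points of `l₁` and `l₂` and of `l₃` and `l₄`
  · have h𝓕all : ∀ l ∈ T, l ∈ 𝓕 := fun l hl => ⟨hTL hl, fun w hw => absurd ⟨w, hw⟩ hc⟩
    have hT4' : T.ncard = 4 := by
      rw [Set.ncard_def, hT4]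
      rfl
    obtain ⟨l₁, l₂, l₃, l₄, h12, h13, h14, h23, h24, h34, rfl⟩ := Set.ncard_eq_four.1 hT4'
    have hm1 : l₁ ∈ ({l₁, l₂, l₃, l₄} : Set (Set P2)) := by simp
    have hm2 : l₂ ∈ ({l₁, l₂, l₃, l₄} : Set (Set P2)) := by simp
    have hm3 : l₃ ∈ ({l₁, l₂, l₃, l₄} : Set (Set P2)) := by simp
    have hm4 : l₄ ∈ ({l₁, l₂, l₃, l₄} : Set (Set P2)) := by simp
    have hno : ∀ {a b c : Set P2}, a ∈ ({l₁, l₂, l₃, l₄} : Set (Set P2)) →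
        b ∈ ({l₁, l₂, l₃, l₄} : Set (Set P2)) → c ∈ ({l₁, l₂, l₃, l₄} : Set (Set P2)) → a ≠ b →
        b ≠ c → a ≠ c → ∀ {q}, q ∈ a → q ∈ b → q ∉ c := by
      intro a b c ha hb hc hab hbc hac q hqa hqb hqc
      exact Set.eq_empty_iff_forall_notMem.1 (hT a ha b hb c hc hab hbc hac) q ⟨⟨hqa, hqb⟩, hqc⟩
    obtain ⟨v, hv1, hv2⟩ := (hTL hm1).1.inter_nonempty (hTL hm2).1
    obtain ⟨p, hp3, hp4⟩ := (hTL hm3).1.inter_nonempty (hTL hm4).1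
    have hrel := Subgroup.relIndex_inf_ne_zero
      (Subgroup.relIndex_inf_ne_zero (hstab l₁ (h𝓕all _ hm1)) (hstab l₂ (h𝓕all _ hm2)))
      (Subgroup.relIndex_inf_ne_zero (hstab l₃ (h𝓕all _ hm3)) (hstab l₄ (h𝓕all _ hm4)))
    have hp1 : l₁ ∈ pencil Γ v := ⟨hTL hm1, hv1⟩
    have hp2 : l₂ ∈ pencil Γ v := ⟨hTL hm2, hv2⟩
    rw [← pencil_congr (limitSet_inf_eq hrel)] at hp1 hp2
    refine not_fixed_lines (Γ := MulAction.stabilizer PSL(3, ℂ) l₁ ⊓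
      MulAction.stabilizer PSL(3, ℂ) l₂ ⊓ (MulAction.stabilizer PSL(3, ℂ) l₃ ⊓
      MulAction.stabilizer PSL(3, ℂ) l₄) ⊓ Γ) (discreteTopology_of_le hΓ inf_le_right)
      (hTL hm3).1 (hTL hm4).1 h34 (fun γ hγ => ?_) (fun γ hγ => hγ.1.2.1) (fun γ hγ => hγ.1.2.2)
      (hno hm1 hm2 hm3 h12 h23 h13 hv1 hv2) (hno hm1 hm2 hm4 h12 h24 h14 hv1 hv2) hp3 hp4 hp1 hp2
      h12 (hno hm3 hm4 hm1 h34 h14.symm h13.symm hp3 hp4)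
      (hno hm3 hm4 hm2 h34 h24.symm h23.symm hp3 hp4)
    refine (hTL hm1).1.inter_subsingleton (hTL hm2).1 h12 ⟨?_, ?_⟩ ⟨hv1, hv2⟩
    · have h := Set.smul_mem_smul_set (a := γ) hv1
      rwa [show γ • l₁ = l₁ from hγ.1.1.1] at h
    · have h := Set.smul_mem_smul_set (a := γ) hv2
      rwa [show γ • l₂ = l₂ from hγ.1.1.2] at h

lemma IsHyperbolicToralGroup.conjBy {H : Subgroup PSL(3, ℂ)} (h : IsHyperbolicToralGroup H)
    (g : PSL(3, ℂ)) : IsHyperbolicToralGroup (conjBy g H) := by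
  have key : ∀ (x : PSL(3, ℂ)) (S : Set PSL(3, ℂ)),
      (H : Set PSL(3, ℂ)) = (fun γ => x * γ * x⁻¹) '' S →
      (KulkarniLines.conjBy g H : Set PSL(3, ℂ)) = (fun γ => g * x * γ * (g * x)⁻¹) '' S := by
    intro x S hS
    have : (KulkarniLines.conjBy g H : Set PSL(3, ℂ)) = (fun γ => g * γ * g⁻¹) '' H := by
      rw [KulkarniLines.conjBy, Subgroup.coe_map]
      rfl
    rw [this, hS, Set.image_image]
    simp only [mul_assoc, _root_.mul_inv_rev]
  rcases h with ⟨A, hA, x, hx⟩ | ⟨A, B, ν, hd, x, hx⟩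
  · exact Or.inl ⟨A, hA, g * x, key x _ hx⟩
  · exact Or.inr ⟨A, B, ν, hd, g * x, key x _ hx⟩

lemma conjBy_mono {H K : Subgroup PSL(3, ℂ)} (h : H ≤ K) (g : PSL(3, ℂ)) :
    conjBy g H ≤ conjBy g K := Subgroup.map_mono h

lemma relIndex_conjBy (H K : Subgroup PSL(3, ℂ)) (g : PSL(3, ℂ)) :
    (conjBy g H).relIndex (conjBy g K) = H.relIndex K :=
  Subgroup.relIndex_map_map_of_injective H K (MulAut.conj g).injective

/-- With two centres, the subgroup of index at most two fixing both is conjugate to a group of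
pairs of affine maps with parallel limit lines in both directions, which has a hyperbolic toral
subgroup of index at most four. -/
lemma exists_toral_of_LiG {Γ : Subgroup PSL(3, ℂ)} (hΓ : DiscreteTopology Γ)
    (h : LiG (discontinuityRegion Γ) = 4) :
    ∃ H : Subgroup PSL(3, ℂ), H ≤ Γ ∧ IsHyperbolicToralGroup H ∧
      H.relIndex Γ ≠ 0 ∧ H.relIndex Γ ≤ 8 := by
  obtain ⟨⟨T, hTL, hT, hT4⟩, hmax⟩ := LiG_eq_four_iff.1 h
  obtain ⟨u, hu, v, hv, huv⟩ := exists_two_centers hΓ hTL hT hT4 hmax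
  have hcent : centers Γ = {u, v} := by
    ext w
    constructor
    · intro hw
      by_contra hcon
      simp only [Set.mem_insert_iff, Set.mem_singleton_iff, not_or] at hcon
      exact centers_not_three hmax hu hv hw huv (Ne.symm hcon.1) (Ne.symm hcon.2)
    · rintro (rfl | rfl)
      exacts [hu, hv]
  obtain ⟨hi0, hi2⟩ := relIndex_stabilizer_le (Γ := Γ) (F := centers Γ)
    (hcent ▸ Set.toFinite _) (fun γ hγ x hx => smul_mem_centers hγ hx) hu
  rw [hcent, Set.ncard_pair huv] at hi2
  set Γ₀ := MulAction.stabilizer PSL(3, ℂ) u ⊓ Γ with hΓ₀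
  have hlim : limitSet Γ₀ = limitSet Γ := limitSet_inf_eq hi0
  have hfu : ∀ γ ∈ Γ₀, γ • u = u := fun γ hγ => hγ.1
  -- the only centre other than `u` is fixed as well
  have hfv : ∀ γ ∈ Γ₀, γ • v = v := by
    intro γ hγ
    have h1 := smul_mem_centers hγ.2 hv
    rw [hcent] at h1
    refine h1.resolve_left fun h2 => huv ?_
    rw [← hfu γ hγ] at h2
    exact (MulAction.injective γ h2).symm
  obtain ⟨g, Δ, hΔ, hgu, hgv⟩ := exists_conjBy_eq_map huv hfu hfv
  have hdisc : DiscreteTopology (Δ.map Aff2.toProj) :=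
    hΔ ▸ discreteTopology_conjBy (discreteTopology_of_le hΓ inf_le_right) g
  have hpar : ∀ i j, i ≠ j → ∀ x y, x ∈ centers Γ → x ≠ y → g • x = axisPt i → g • y = axisPt j →
      Aff2.HasParallelLines Δ j := by
    intro i j hij x y hx hxy hgx hgy
    obtain ⟨l, hl, m, hm, hlm, hyl, hym⟩ := exists_two_lines hx hxy
    rw [← pencil_congr hlim] at hl hm
    have h1 := smul_mem_pencil_conjBy hl g
    have h2 := smul_mem_pencil_conjBy hm g
    rw [hΔ, hgx] at h1 h2
    refine hasParallelLines_of_lines hij h1 h2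
      (fun h => hlm (MulAction.injective g h)) ?_ ?_ <;>
    rw [← hgy, Set.smul_mem_smul_set_iff] <;> assumption
  have hparall : ∀ i, Aff2.HasParallelLines Δ i := by
    intro i
    fin_cases i
    · exact hpar 1 0 one_ne_zero v u hv huv.symm hgv hgu
    · exact hpar 0 1 zero_ne_one u v hu huv hgu hgv
  have hne : limitSet (Δ.map Aff2.toProj) ≠ Set.univ := by
    intro huniv
    rw [← hΔ, limitSet_conjBy, Set.smul_set_eq_univ, hlim] at huniv
    exact limitSet_ne_univ hmax huniv
  have hhyp := Aff2.isHyperbolic_of_hasParallelLines hdisc (hparall 0)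
  obtain ⟨w, hw, hS⟩ := Aff2.exists_axisSpan_eq hdisc hhyp hne hparall
  obtain ⟨H, hHΔ, hH0, hH4, hHt⟩ := Aff2.exists_toral hdisc hhyp hw hS
  have hΓ₀Δ : conjBy g⁻¹ (Δ.map Aff2.toProj) = Γ₀ := by
    rw [← hΔ, conjBy_conjBy, inv_mul_cancel, conjBy_one]
  have hle : conjBy g⁻¹ (H.map Aff2.toProj) ≤ Γ₀ :=
    hΓ₀Δ ▸ conjBy_mono (Subgroup.map_mono hHΔ) g⁻¹
  have hrel : (conjBy g⁻¹ (H.map Aff2.toProj)).relIndex Γ₀ = H.relIndex Δ := by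
    conv_lhs => rw [← hΓ₀Δ, relIndex_conjBy]
    exact Subgroup.relIndex_map_map_of_injective H Δ Aff2.toProj_injective
  have hmul := Subgroup.relIndex_mul_relIndex _ _ _ hle (inf_le_right : Γ₀ ≤ Γ)
  rw [hrel, hΓ₀, Subgroup.inf_relIndex_right] at hmul
  refine ⟨_, hle.trans inf_le_right, hHt.conjBy g⁻¹, ?_, ?_⟩
  · rw [← hmul]
    exact mul_ne_zero hH0 hi0
  · rw [← hmul]
    exact Nat.mul_le_mul hH4 hi2

/-- A group with a hyperbolic toral subgroup of finite index has the limit set of this subgroup. -/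
lemma LiG_of_toral {Γ H : Subgroup PSL(3, ℂ)} (hΓ : DiscreteTopology Γ) (hle : H ≤ Γ)
    (hH : IsHyperbolicToralGroup H) (hi : H.relIndex Γ ≠ 0) :
    LiG (discontinuityRegion Γ) = 4 := by
  have h := LiG_of_isHyperbolicToralGroup (discreteTopology_of_le hΓ hle) hH
  rwa [discontinuityRegion, limitSet_eq_of_relIndex hle hi] at h

end KulkarniLines

theorem mainTheorem1 (Γ : Subgroup PSL(3, ℂ)) (hΓ : DiscreteTopology Γ) :
    KulkarniLines.LiG (KulkarniLines.discontinuityRegion Γ) = 4 ↔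
      ∃ H : Subgroup PSL(3, ℂ), H ≤ Γ ∧ KulkarniLines.IsHyperbolicToralGroup H ∧
        H.relIndex Γ ≠ 0 ∧ H.relIndex Γ ≤ 8 := by
  constructor
  · exact KulkarniLines.exists_toral_of_LiG hΓ
  · rintro ⟨H, hle, hH, hi, -⟩
    exact KulkarniLines.LiG_of_toral hΓ hle hH hi
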